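/- Let $\gamma>1$, $\gamma^*=\gamma/(\gamma-1)$, and $M_\gamma=\{(\zeta_1,\zeta_2)\in\mathbb C^2:\operatorname{Im}\zeta_2=|\zeta_1|^\gamma\}$, $\Omega_\gamma=\{\operatorname{Im}z_2>|z_1|^\gamma\}$. With $\zeta_1=\alpha e^{i\theta}$, $s=\operatorname{Re}\zeta_2$, put $\mu_r=\alpha^r\,ds\,d\alpha\,d\theta=\frac1{2i}|\zeta_1|^{r-1}d\zeta_2\wedge d\bar\zeta_1\wedge d\zeta_1$ and $\sigma=\mu_{\gamma-1}$ on $M_\gamma$. With $c=(\gamma(\gamma-1))^{2/3}/\pi^2$ fixed, the preferred measure is $\widetilde\mu_{M_\delta}=\frac{c\,\delta^{4/3}}{4(\delta-1)^{1/3}}\mu_{(\delta+1)/3}$ on $M_\delta$ for $\delta\in\{\gamma,\gamma^*\}$. The map $w:M_\gamma\to M_{\gamma^*}$, $$w(\zeta)=\Big(\bar\zeta_1|\zeta_1|^{\gamma-2},\ \frac{\zeta_2-i\gamma|\zeta_1|^\gamma}{1-\gamma}\Big),$$ is a bijection; the preferred dual measure on $M_\gamma$ is $\widetilde\mu^*=w^*(\widetilde\mu_{M_{\gamma^*}})$.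 Write $w^*G=G\circ w$ and $w_*g=g\circ w^{-1}$. For $\delta>1$ the Leray transform $\boldsymbol L_\delta f$ of a function $f$ on $M_\delta$ is the boundary value on $M_\delta$ of $$z\mapsto\frac{\delta^2}{8\pi^2i}\int_{M_\delta}f(\zeta)\frac{|\zeta_1|^{\delta-2}\,d\zeta_2\wedge d\bar\zeta_1\wedge d\zeta_1}{[\delta\bar\zeta_1|\zeta_1|^{\delta-2}(\zeta_1-z_1)+i(\zeta_2-z_2)]^2}\qquad(z\in\Omega_\delta),$$ that is, the limit as $\varepsilon\to0^+$, in the $L^2$-space considered, of its values at $z+(0,i\varepsilon)$, $z\in M_\delta$. Let $H^2(M_\delta,\mu)=\boldsymbol L_\delta(L^2(M_\delta,\mu))$, $H^2_{\sf dual}(M_\gamma,\widetilde\mu^*)=w^*\big(H^2(M_{\gamma^*},\widetilde\mu_{M_{\gamma^*}})\big)$, and let $\widetilde{\boldsymbol L}_\gamma=w^*\circ\boldsymbol L_{\gamma^*}\circ w_*$ be the dual Leray transform. Then the Leray transforms below are defined on the whole of the $L^2$-spaces in question, and: (1) $\widetilde{\boldsymbol L}_\gamma$ is a bounded linear operator on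 $L^2(M_\gamma,\widetilde\mu^*)$, it satisfies $\widetilde{\boldsymbol L}_\gamma\circ\widetilde{\boldsymbol L}_\gamma=\widetilde{\boldsymbol L}_\gamma$, and its range is $H^2_{\sf dual}(M_\gamma,\widetilde\mu^*)$. (2) For $g\in L^2(M_\gamma,\widetilde\mu^*)$, $$\widetilde{\boldsymbol L}_\gamma g(z)=\frac{\gamma^2}{8\pi^2i}\int_{M_\gamma}g(\zeta)\frac{|\zeta_1|^{\gamma-2}\,d\zeta_2\wedge d\bar\zeta_1\wedge d\zeta_1}{[\gamma\bar z_1|z_1|^{\gamma-2}(z_1-\zeta_1)+i(z_2-\zeta_2)]^2},$$ in the following sense: if $+\varepsilon$ is added inside the bracket, $\varepsilon>0$, the integral converges absolutely for all $z\in M_\gamma$, and as $\varepsilon\to0^+$ it tends to $\widetilde{\boldsymbol L}_\gamma g$ in $L^2(M_\gamma,\widetilde\mu^*)$; and for almost every $z$ for which the displayed integral converges absolutely, the formula holds literally. (3) $\boldsymbol L_\gamma$ is a bounded linear operator on $L^2(M_\gamma,\sigma)$. Let $\boldsymbol L_\gamma^{(*,\sigma)}$ be its Hilbert space adjoint there,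 and $\mathfrak c$ complex conjugation. Then $\widetilde{\boldsymbol L}_\gamma=\mathfrak c\circ\boldsymbol L_\gamma^{(*,\sigma)}\circ\mathfrak c$ on $L^2(M_\gamma,\sigma)$. Moreover there is a bounded operator on $L^2(M_\gamma,\widetilde\mu^*)$, again denoted $\boldsymbol L_\gamma^{(*,\sigma)}$, which agrees with the adjoint on $L^2(M_\gamma,\sigma)\cap L^2(M_\gamma,\widetilde\mu^*)$ and is given by $$\boldsymbol L_\gamma^{(*,\sigma)}g(z)=\frac{\gamma^2}{8\pi^2i}\int_{M_\gamma}g(\zeta)\frac{|\zeta_1|^{\gamma-2}\,d\zeta_2\wedge d\bar\zeta_1\wedge d\zeta_1}{[\gamma z_1|z_1|^{\gamma-2}(\bar z_1-\bar\zeta_1)-i(\bar z_2-\bar\zeta_2)]^2}$$ (with $+\varepsilon$ added inside the bracket and $\varepsilon\to0^+$ in $L^2(M_\gamma,\widetilde\mu^*)$), and $\widetilde{\boldsymbol L}_\gamma=\mathfrak c\circ\boldsymbol L_\gamma^{(*,\sigma)}\circ\mathfrak c$ on $L^2(M_\gamma,\widetilde\mu^*)$. -/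

import Mathlib

open MeasureTheory Filter Topology Set
open scoped ComplexConjugate ENNReal

noncomputable section

namespace DualLeray

/-! ### The hypersurfaces and their measures -/

/-- The hypersurface `M_γ = {(ζ₁, ζ₂) ∈ ℂ² : Im ζ₂ = |ζ₁|^γ}`. -/
def M (γ : ℝ) : Set (ℂ × ℂ) := {ζ | ζ.2.im = ‖ζ.1‖ ^ γ}

/-- The Hölder conjugate exponent `γ* = γ / (γ - 1)`. -/
def dualExp (γ : ℝ) : ℝ := γ / (γ - 1)

/-- The parametrization `(ζ₁, s) ↦ (ζ₁, s + i |ζ₁|^γ)` of `M_γ`. -/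
def graphMap (γ : ℝ) (p : ℂ × ℝ) : M γ :=
  ⟨(p.1, (p.2 : ℂ) + Complex.I * ((‖p.1‖ ^ γ : ℝ) : ℂ)), by
    simp only [M, mem_ofPred_eq, Complex.add_im, Complex.ofReal_im, Complex.mul_im, Complex.I_re,
      Complex.I_im, Complex.ofReal_re]
    ring⟩

/-- The measure
`μ_r = (1 / 2i) |ζ₁|^(r-1) dζ₂ ∧ dζ̄₁ ∧ dζ₁ = α^r ds ∧ dα ∧ dθ` on `M_γ`, where
`ζ₁ = α e^{iθ}` and `s = Re ζ₂`. In the coordinates `(ζ₁, s)` this is `|ζ₁|^(r-1)` times Lebesgue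
measure on `ℂ × ℝ`, because `α dα dθ` is Lebesgue measure in `ζ₁`. -/
def mu (γ r : ℝ) : Measure (M γ) :=
  ((volume : Measure (ℂ × ℝ)).withDensity
    (fun p => ENNReal.ofReal (‖p.1‖ ^ (r - 1)))).map (graphMap γ)

/-- The measure `σ = μ_{γ-1}`. -/
def sigma (γ : ℝ) : Measure (M γ) := mu γ (γ - 1)

/-- The preferred measure on `M_γ` with normalizing constant `c`:
`c γ^{4/3} / (4 (γ-1)^{1/3}) μ_{(γ+1)/3}`. -/
def preferredMeasure (c γ : ℝ) : Measure (M γ) :=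
  ENNReal.ofReal (c * γ ^ (4 / 3 : ℝ) / (4 * (γ - 1) ^ (1 / 3 : ℝ))) • mu γ ((γ + 1) / 3)

/-- The normalizing constant `(γ (γ-1))^{2/3} / π²`. -/
def normConst (γ : ℝ) : ℝ := (γ * (γ - 1)) ^ (2 / 3 : ℝ) / Real.pi ^ 2

/-! ### The duality map `w : M_γ → M_{γ*}` -/

/-- `w(ζ) = (ζ̄₁ |ζ₁|^(γ-2), (ζ₂ - i γ |ζ₁|^γ) / (1 - γ))`, the coordinates of the complex tangent
line of `M_γ` at `ζ`, written as `{z : i z₂ + γ w₁ z₁ + i (γ - 1) w₂ = 0}`. -/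
def dualPoint (γ : ℝ) (ζ : ℂ × ℂ) : ℂ × ℂ :=
  (conj ζ.1 * ((‖ζ.1‖ ^ (γ - 2) : ℝ) : ℂ),
    (ζ.2 - Complex.I * (γ : ℂ) * ((‖ζ.1‖ ^ γ : ℝ) : ℂ)) / (1 - (γ : ℂ)))

theorem one_lt_dualExp {γ : ℝ} (hγ : 1 < γ) : 1 < dualExp γ := by
  have h : 0 < γ - 1 := by linarith
  rw [dualExp, lt_div_iff₀ h]
  linarith

theorem dualExp_dualExp {γ : ℝ} (hγ : 1 < γ) : dualExp (dualExp γ) = γ := by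
  have h : γ - 1 ≠ 0 := by linarith
  unfold dualExp
  field_simp
  ring

theorem norm_dualPoint_fst {γ : ℝ} (hγ : 1 < γ) (ζ : ℂ × ℂ) :
    ‖(dualPoint γ ζ).1‖ = ‖ζ.1‖ ^ (γ - 1) := by
  rw [dualPoint, norm_mul, RCLike.norm_conj, Complex.norm_real,
    Real.norm_of_nonneg (Real.rpow_nonneg (norm_nonneg _) _)]
  rcases (norm_nonneg ζ.1).eq_or_lt with h | h
  · rw [← h, Real.zero_rpow (by linarith : γ - 1 ≠ 0), zero_mul]
  · rw [show γ - 1 = 1 + (γ - 2) by ring, Real.rpow_add h, Real.rpow_one]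

theorem norm_dualPoint_rpow {γ : ℝ} (hγ : 1 < γ) (ζ : ℂ × ℂ) :
    ‖(dualPoint γ ζ).1‖ ^ dualExp γ = ‖ζ.1‖ ^ γ := by
  have h : γ - 1 ≠ 0 := by linarith
  rw [norm_dualPoint_fst hγ, ← Real.rpow_mul (norm_nonneg _), dualExp, mul_div_cancel₀ _ h]

theorem dualPoint_mem {γ : ℝ} (hγ : 1 < γ) {ζ : ℂ × ℂ} (hζ : ζ ∈ M γ) :
    dualPoint γ ζ ∈ M (dualExp γ) := by
  have h : (1 - γ) ≠ 0 := by linarith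
  have hζ' : ζ.2.im = ‖ζ.1‖ ^ γ := hζ
  change (dualPoint γ ζ).2.im = _
  rw [norm_dualPoint_rpow hγ]
  have e : (1 - (γ : ℂ)) = ((1 - γ : ℝ) : ℂ) := by push_cast; ring
  simp only [dualPoint]
  rw [e, Complex.div_ofReal_im, div_eq_iff h]
  simp [hζ']
  ring

theorem dualPoint_dualPoint {γ : ℝ} (hγ : 1 < γ) (ζ : ℂ × ℂ) :
    dualPoint (dualExp γ) (dualPoint γ ζ) = ζ := by
  have h : γ - 1 ≠ 0 := by linarith
  have hc : (γ : ℂ) - 1 ≠ 0 := by exact_mod_cast h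
  have hc' : 1 - (γ : ℂ) ≠ 0 := by rw [← neg_sub]; exact neg_ne_zero.mpr hc
  refine Prod.ext ?_ ?_
  · change conj (dualPoint γ ζ).1 * ((‖(dualPoint γ ζ).1‖ ^ (dualExp γ - 2) : ℝ) : ℂ) = ζ.1
    rw [norm_dualPoint_fst hγ, ← Real.rpow_mul (norm_nonneg _)]
    have e : (γ - 1) * (dualExp γ - 2) = -(γ - 2) := by
      unfold dualExp; field_simp; ring
    rw [e]
    simp only [dualPoint, map_mul, Complex.conj_conj, Complex.conj_ofReal]
    rcases eq_or_ne ζ.1 0 with h0 | h0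
    · simp [h0]
    · rw [mul_assoc, ← Complex.ofReal_mul, ← Real.rpow_add (norm_pos_iff.mpr h0)]
      simp
  · change ((dualPoint γ ζ).2 - Complex.I * (dualExp γ : ℂ) *
      ((‖(dualPoint γ ζ).1‖ ^ dualExp γ : ℝ) : ℂ)) / (1 - (dualExp γ : ℂ)) = ζ.2
    rw [norm_dualPoint_rpow hγ]
    have e : (dualExp γ : ℂ) = (γ : ℂ) / ((γ : ℂ) - 1) := by
      unfold dualExp; push_cast; ring
    have e2 : 1 - (γ : ℂ) / ((γ : ℂ) - 1) = 1 / (1 - (γ : ℂ)) := by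
      field_simp; ring
    simp only [dualPoint]
    rw [e, e2]
    field_simp
    ring

theorem measurable_dualPoint (γ : ℝ) : Measurable (dualPoint γ) := by
  unfold dualPoint
  have h1 : Measurable fun ζ : ℂ × ℂ => conj ζ.1 :=
    Complex.continuous_conj.measurable.comp measurable_fst
  fun_prop

/-- The duality map `w : M_γ → M_{γ*}` as a measurable bijection with measurable inverse. -/
def dualMap {γ : ℝ} (hγ : 1 < γ) : M γ ≃ᵐ M (dualExp γ) where
  toFun ζ := ⟨dualPoint γ ζ, dualPoint_mem hγ ζ.2⟩
  invFun ω := ⟨dualPoint (dualExp γ) ω, by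
    have h := dualPoint_mem (one_lt_dualExp hγ) ω.2
    rwa [dualExp_dualExp hγ] at h⟩
  left_inv ζ := Subtype.ext (dualPoint_dualPoint hγ ζ)
  right_inv ω := Subtype.ext (by
    have h := dualPoint_dualPoint (one_lt_dualExp hγ) (ω : ℂ × ℂ)
    rwa [dualExp_dualExp hγ] at h)
  measurable_toFun := ((measurable_dualPoint γ).comp measurable_subtype_coe).subtype_mk
  measurable_invFun :=
    ((measurable_dualPoint (dualExp γ)).comp measurable_subtype_coe).subtype_mk

/-- The preferred dual measure on `M_γ`: the pullback under `w` of the preferred measure on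
`M_{γ*}` (with the normalizing constant attached to `γ`). -/
def preferredDualMeasure {γ : ℝ} (hγ : 1 < γ) : Measure (M γ) :=
  (preferredMeasure (normConst γ) (dualExp γ)).comap (dualMap hγ)

theorem measurePreserving_dualMap {γ : ℝ} (hγ : 1 < γ) :
    MeasurePreserving (dualMap hγ) (preferredDualMeasure hγ)
      (preferredMeasure (normConst γ) (dualExp γ)) := by
  refine ⟨(dualMap hγ).measurable, ?_⟩
  rw [preferredDualMeasure, (dualMap hγ).measurableEmbedding.map_comap,
    (dualMap hγ).surjective.range_eq, Measure.restrict_univ]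

/-! ### The Leray transform -/

/-- `γ ζ̄₁ |ζ₁|^(γ-2) (ζ₁ - z₁) + i (ζ₂ - z₂)`, that is `2 ⟨∂ρ(ζ), ζ - z⟩` for the defining
function `ρ(ζ) = |ζ₁|^γ - Im ζ₂`. -/
def bracket (γ : ℝ) (z ζ : ℂ × ℂ) : ℂ :=
  (γ : ℂ) * conj ζ.1 * ((‖ζ.1‖ ^ (γ - 2) : ℝ) : ℂ) * (ζ.1 - z.1) + Complex.I * (ζ.2 - z.2)

/-- The Leray integral
`(γ² / 8π²i) ∫_{M_γ} f(ζ) |ζ₁|^(γ-2) dζ₂ ∧ dζ̄₁ ∧ dζ₁ / [γ ζ̄₁|ζ₁|^(γ-2)(ζ₁-z₁) + i(ζ₂-z₂)]²`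
of `f` at `z ∈ ℂ²`; recall `|ζ₁|^(γ-2) dζ₂ ∧ dζ̄₁ ∧ dζ₁ = 2i σ`. -/
def lerayIntegral (γ : ℝ) (f : M γ → ℂ) (z : ℂ × ℂ) : ℂ :=
  ((γ ^ 2 / (4 * Real.pi ^ 2) : ℝ) : ℂ) * ∫ ζ : M γ, f ζ / bracket γ z ζ ^ 2 ∂(sigma γ)

/-- Upward vertical translation by `ε`; it moves `M_γ` into `Ω_γ = {Im z₂ > |z₁|^γ}`
for `ε > 0`. -/
def lift (ε : ℝ) (z : ℂ × ℂ) : ℂ × ℂ := (z.1, z.2 + Complex.I * (ε : ℂ))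

/-- `F` is the boundary value in `L²(M_γ, μ)` of the Leray integral of `f` on `Ω_γ`:
`lim_{ε → 0+} ‖(Leray integral of f)(· + (0, iε)) - F‖_{L²(μ)} = 0`. -/
def IsLeray (γ : ℝ) (μ : Measure (M γ)) (f F : M γ → ℂ) : Prop :=
  Tendsto (fun ε : ℝ => eLpNorm (fun z : M γ => lerayIntegral γ f (lift ε z) - F z) 2 μ)
    (𝓝[>] 0) (𝓝 0)

open Classical in
/-- The Leray transform `L_γ` on `L²(M_γ, μ)`: the boundary value of the Leray integral
(zero where this does not exist). -/
def lerayTransform (γ : ℝ) (μ : Measure (M γ)) (f : Lp ℂ 2 μ) : Lp ℂ 2 μ :=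
  if h : ∃ F : Lp ℂ 2 μ, IsLeray γ μ f F then h.choose else 0

/-- The Hardy space `H²(M_γ, μ) = L_γ(L²(M_γ, μ))`. -/
def hardySpace (γ : ℝ) (μ : Measure (M γ)) : Set (Lp ℂ 2 μ) := range (lerayTransform γ μ)

/-! ### Duals -/

/-- Pullback `w^* : L²(M_{γ*}, ν) → L²(M_γ, μ)`, `G ↦ G ∘ w`, where `μ = w^* ν`. -/
def pullback {γ : ℝ} {hγ : 1 < γ} {μ : Measure (M γ)} {ν : Measure (M (dualExp γ))}
    (h : MeasurePreserving (dualMap hγ) μ ν) (G : Lp ℂ 2 ν) : Lp ℂ 2 μ :=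
  Lp.compMeasurePreserving (dualMap hγ) h G

/-- Pushforward `w_* : L²(M_γ, μ) → L²(M_{γ*}, ν)`, `g ↦ g ∘ w⁻¹`, where `μ = w^* ν`. -/
def pushforward {γ : ℝ} {hγ : 1 < γ} {μ : Measure (M γ)} {ν : Measure (M (dualExp γ))}
    (h : MeasurePreserving (dualMap hγ) μ ν) (g : Lp ℂ 2 μ) : Lp ℂ 2 ν :=
  Lp.compMeasurePreserving (dualMap hγ).symm (h.symm (dualMap hγ)) g

/-- The dual Leray transform `w^* ∘ L_{γ*} ∘ w_*` on `L²(M_γ, μ)`. -/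
def dualLeray {γ : ℝ} {hγ : 1 < γ} {μ : Measure (M γ)} {ν : Measure (M (dualExp γ))}
    (h : MeasurePreserving (dualMap hγ) μ ν) (g : Lp ℂ 2 μ) : Lp ℂ 2 μ :=
  pullback h (lerayTransform (dualExp γ) ν (pushforward h g))

/-- The dual Hardy space: the pullback under `w` of the Hardy space of `M_{γ*}` with its preferred
measure. -/
def dualHardySpace {γ : ℝ} (hγ : 1 < γ) : Set (Lp ℂ 2 (preferredDualMeasure hγ)) :=
  pullback (measurePreserving_dualMap hγ) ''
    hardySpace (dualExp γ) (preferredMeasure (normConst γ) (dualExp γ))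

/-- The integrand `g(ζ) / [γ z̄₁|z₁|^(γ-2)(z₁-ζ₁) + i(z₂-ζ₂) + ε]²` of the dual Leray integral;
the `ε` comes from replacing `ζ` by `ζ + (0, iε)`, and `ε = 0` is the unregularized integrand. -/
def dualIntegrand (γ : ℝ) (g : M γ → ℂ) (ε : ℝ) (z ζ : M γ) : ℂ :=
  g ζ / bracket γ (lift ε ζ) z ^ 2

/-- The dual Leray integral
`(γ² / 8π²i) ∫_{M_γ} g(ζ) |ζ₁|^(γ-2) dζ₂ ∧ dζ̄₁ ∧ dζ₁ /
  [γ z̄₁|z₁|^(γ-2)(z₁-ζ₁) + i(z₂-ζ₂) + ε]²`. -/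
def dualIntegral (γ : ℝ) (g : M γ → ℂ) (ε : ℝ) (z : M γ) : ℂ :=
  ((γ ^ 2 / (4 * Real.pi ^ 2) : ℝ) : ℂ) * ∫ ζ : M γ, dualIntegrand γ g ε z ζ ∂(sigma γ)

/-- The integral formula for the adjoint with respect to `σ`,
`(γ² / 8π²i) ∫_{M_γ} g(ζ) |ζ₁|^(γ-2) dζ₂ ∧ dζ̄₁ ∧ dζ₁ /
  [γ z₁|z₁|^(γ-2)(z̄₁-ζ̄₁) - i(z̄₂-ζ̄₂) + ε]²`. -/
def adjointIntegral (γ : ℝ) (g : M γ → ℂ) (ε : ℝ) (z : M γ) : ℂ :=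
  ((γ ^ 2 / (4 * Real.pi ^ 2) : ℝ) : ℂ) *
    ∫ ζ : M γ, g ζ / conj (bracket γ (lift ε ζ) z) ^ 2 ∂(sigma γ)

end DualLeray

end

open DualLeray

noncomputable section

namespace DualLeray
open scoped FourierTransform ContDiff Real SchwartzMap

theorem eLpNorm_two_sq {α E : Type*} [MeasurableSpace α] [NormedAddCommGroup E] (μ : Measure α)
    (f : α → E) : eLpNorm f 2 μ ^ 2 = ∫⁻ x, ‖f x‖ₑ ^ 2 ∂μ := by
  simpa using eLpNorm_nnreal_pow_eq_lintegral (f := f) (μ := μ) (p := 2) (by norm_num)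

/-- The `L²` Fourier transform of a function in `L¹ ∩ L²` is given by the Fourier integral. -/
theorem fourier_toLp_ae_eq {f : ℝ → ℂ} (h1 : Integrable f) (h2 : MemLp f 2) :
    𝓕 f =ᵐ[volume] (𝓕 (h2.toLp f) : Lp ℂ 2 (volume : Measure ℝ)) := by
  have hcont : Continuous (𝓕 f) :=
    VectorFourier.fourierIntegral_continuous Real.continuous_fourierChar
      (L := innerₗ ℝ) continuous_inner h1
  apply ae_eq_of_integral_contDiff_smul_eq
  · exact hcont.locallyIntegrable
  · exact (Lp.memLp _).locallyIntegrable (by norm_num)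
  · intro g g_smooth g_cpt
    have hg₁ : HasCompactSupport (Complex.ofRealCLM ∘ g) := g_cpt.comp_left rfl
    have hg₂ : ContDiff ℝ ∞ (Complex.ofRealCLM ∘ g) := by fun_prop
    set φ : 𝓢(ℝ, ℂ) := hg₁.toSchwartzMap hg₂ with hφ
    have e1 := Lp.fourier_toTemperedDistribution_eq (h2.toLp f)
    have e2 := congrArg (fun T => T φ) e1
    simp only [TemperedDistribution.fourier_apply, Lp.toTemperedDistribution_apply] at e2
    have e3 : ∫ x, g x • (𝓕 (h2.toLp f) : Lp ℂ 2 (volume : Measure ℝ)) x =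
        ∫ x, φ x • (𝓕 (h2.toLp f) : Lp ℂ 2 (volume : Measure ℝ)) x := by
      simp [hφ]
    have e4 : ∫ x, g x • 𝓕 f x = ∫ x, φ x • 𝓕 f x := by
      simp [hφ]
    rw [e3, e4, ← e2]
    have e5 : ∫ x, (𝓕 φ) x • (h2.toLp f) x = ∫ x, (𝓕 φ) x • f x := by
      apply integral_congr_ae
      filter_upwards [h2.coeFn_toLp] with x hx
      rw [hx]
    rw [e5]
    have e6 := VectorFourier.integral_fourierIntegral_smul_eq_flip
      (L := innerₗ ℝ) Real.continuous_fourierChar continuous_inner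
      (φ.integrable (μ := volume)) h1
    rw [flip_innerₗ] at e6
    exact e6.symm

/-- Plancherel's theorem for functions in `L¹ ∩ L²`. -/
theorem lintegral_enorm_sq_fourier {f : ℝ → ℂ} (h1 : Integrable f) (h2 : MemLp f 2) :
    ∫⁻ ξ, ‖𝓕 f ξ‖ₑ ^ 2 = ∫⁻ x, ‖f x‖ₑ ^ 2 := by
  have key : eLpNorm (𝓕 f) 2 volume = eLpNorm f 2 volume := by
    rw [eLpNorm_congr_ae (fourier_toLp_ae_eq h1 h2), ← eLpNorm_congr_ae h2.coeFn_toLp,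
      ← Lp.enorm_def, ← Lp.enorm_def, ← ofReal_norm, Lp.norm_fourier_eq, ofReal_norm]
  rw [← eLpNorm_two_sq, ← eLpNorm_two_sq, key]

end DualLeray
end

noncomputable section
namespace DualLeray
open scoped FourierTransform Real

/-- The function `ξ ↦ (2π)² ξ₊ e^{-2πξa}`, whose Fourier transform is `s ↦ 1 / (a + is)²`. -/
def laplaceKernel (a : ℂ) (ξ : ℝ) : ℂ :=
  (2 * π) ^ 2 * (max ξ 0 : ℝ) * Complex.exp (-(2 * π * ξ * a))

theorem measurable_laplaceKernel : Measurable (Function.uncurry laplaceKernel) := by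
  unfold laplaceKernel Function.uncurry
  fun_prop

theorem continuous_laplaceKernel (a : ℂ) : Continuous (laplaceKernel a) := by
  unfold laplaceKernel
  fun_prop

theorem laplaceKernel_of_nonpos (a : ℂ) {ξ : ℝ} (h : ξ ≤ 0) : laplaceKernel a ξ = 0 := by
  simp [laplaceKernel, max_eq_right h]

theorem laplaceKernel_add (a b : ℂ) (ξ : ℝ) :
    laplaceKernel (a + b) ξ = Complex.exp (-(2 * π * ξ * b)) * laplaceKernel a ξ := by
  simp only [laplaceKernel, mul_add, neg_add, Complex.exp_add]
  ring

theorem norm_laplaceKernel (a : ℂ) (ξ : ℝ) :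
    ‖laplaceKernel a ξ‖ = (2 * π) ^ 2 * max ξ 0 * Real.exp (-(2 * π * ξ * a.re)) := by
  have h : 0 ≤ max ξ 0 := le_max_right _ _
  rw [laplaceKernel, norm_mul, norm_mul, Complex.norm_exp, Complex.norm_real,
    Real.norm_of_nonneg h]
  norm_num [abs_of_pos Real.pi_pos]

theorem norm_laplaceKernel_le {a b : ℂ} (h : a.re ≤ b.re) (ξ : ℝ) :
    ‖laplaceKernel b ξ‖ ≤ ‖laplaceKernel a ξ‖ := by
  rcases le_or_gt ξ 0 with hξ | hξ
  · simp [laplaceKernel_of_nonpos _ hξ]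
  · rw [norm_laplaceKernel, norm_laplaceKernel]
    gcongr

theorem laplaceKernel_eq_indicator (a : ℂ) :
    laplaceKernel a = (Ioi 0).indicator
      (fun ξ : ℝ => (2 * π) ^ 2 * ((ξ : ℂ) ^ ((2 : ℂ) - 1) * Complex.exp (-((2 * π * a) * ξ)))) := by
  ext ξ
  rcases le_or_gt ξ 0 with hξ | hξ
  · rw [laplaceKernel_of_nonpos _ hξ, indicator_of_notMem (by simpa using hξ)]
  · rw [indicator_of_mem (by simpa using hξ), laplaceKernel, max_eq_left hξ.le]
    have : (2 : ℂ) - 1 = 1 := by norm_num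
    rw [this, Complex.cpow_one]
    ring_nf

theorem integrable_laplaceKernel {a : ℂ} (ha : 0 < a.re) : Integrable (laplaceKernel a) := by
  have h2 : Integrable (laplaceKernel a.re) := by
    have hr : 0 < 2 * π * a.re := by positivity
    rw [laplaceKernel_eq_indicator, integrable_indicator_iff measurableSet_Ioi]
    refine Integrable.const_mul ?_ _
    by_contra h
    have h3 := Complex.integral_cpow_mul_exp_neg_mul_Ioi (a := 2) (by norm_num) hr
    have h4 : Complex.Gamma 2 = 1 := by simp
    push_cast at h3
    rw [integral_undef h, h4] at h3
    have h6 : (2 * π * a.re : ℂ) ≠ 0 := by exact_mod_cast hr.ne'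
    rw [mul_one] at h3
    exact (Complex.cpow_ne_zero_iff.2 (Or.inl (one_div_ne_zero h6))) h3.symm
  refine h2.mono (continuous_laplaceKernel a).aestronglyMeasurable (ae_of_all _ fun ξ => ?_)
  exact norm_laplaceKernel_le (by simp) ξ

theorem integral_laplaceKernel {a : ℂ} (ha : 0 < a.re) : ∫ ξ, laplaceKernel a ξ = 1 / a ^ 2 := by
  have h0 : a ≠ 0 := by rintro rfl; simp at ha
  have hpi : (π : ℂ) ≠ 0 := by exact_mod_cast Real.pi_ne_zero
  set b : ℂ := 2 * π * a with hb
  have hb0 : b ≠ 0 := by simp [hb, h0]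
  have hbr : 0 < b.re := by
    have : b = ((2 * π : ℝ) : ℂ) * a := by rw [hb]; push_cast; ring
    rw [this, Complex.re_ofReal_mul]
    positivity
  have hint : IntegrableOn (fun ξ : ℝ => (ξ : ℂ) * Complex.exp (-(b * ξ))) (Ioi 0) := by
    have h := (integrable_laplaceKernel ha).integrableOn (s := Ioi 0)
    refine IntegrableOn.congr_fun (h.const_mul (((2 * π : ℂ) ^ 2)⁻¹)) (fun ξ hξ => ?_)
      measurableSet_Ioi
    rw [mem_Ioi] at hξ
    simp only [laplaceKernel, max_eq_left hξ.le]
    rw [hb]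
    field_simp
  have hint2 : IntegrableOn (fun ξ : ℝ => Complex.exp (-(b * ξ))) (Ioi 0) := by
    have := integrableOn_exp_mul_complex_Ioi (a := -b) (by simpa using hbr) 0
    simpa using this
  have hF : ∀ ξ : ℝ, HasDerivAt
      (fun ξ : ℝ => -((ξ : ℂ) * Complex.exp (-(b * ξ)) / b + Complex.exp (-(b * ξ)) / b ^ 2))
      ((ξ : ℂ) * Complex.exp (-(b * ξ))) ξ := by
    intro ξ
    have h1 : HasDerivAt (fun ξ : ℝ => (ξ : ℂ)) 1 ξ := Complex.ofRealCLM.hasDerivAt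
    have h2 : HasDerivAt (fun ξ : ℝ => Complex.exp (-(b * ξ)))
        (Complex.exp (-(b * ξ)) * (-(b * 1))) ξ := ((h1.const_mul b).fun_neg).cexp
    convert! (((h1.mul h2).div_const b).add (h2.div_const (b ^ 2))).neg using 1
    field_simp
    ring
  have hlim := tendsto_zero_of_hasDerivAt_of_integrableOn_Ioi (a := 0) (fun ξ _ => hF ξ) hint
    ((hint.div_const b).add (hint2.div_const (b ^ 2))).neg
  have h := integral_Ioi_of_hasDerivAt_of_tendsto' (a := 0) (fun ξ _ => hF ξ) hint hlim
  have h3 : laplaceKernel a = (Ioi 0).indicator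
      (fun ξ : ℝ => (2 * π) ^ 2 * ((ξ : ℂ) * Complex.exp (-(b * ξ)))) := by
    rw [laplaceKernel_eq_indicator]
    norm_num [hb]
  rw [h3, integral_indicator measurableSet_Ioi, integral_const_mul, h, hb]
  simp
  field_simp

theorem fourier_laplaceKernel {a : ℂ} (ha : 0 < a.re) (s : ℝ) :
    𝓕 (laplaceKernel a) s = 1 / (a + Complex.I * s) ^ 2 := by
  rw [← integral_laplaceKernel (a := a + Complex.I * s) (by simpa using ha),
    Real.fourier_eq]
  congr 1 with ξ
  rw [laplaceKernel_add, Circle.smul_def, smul_eq_mul, Real.fourierChar_apply]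
  congr 2
  simp
  ring

theorem norm_sq_add_I_mul (a : ℂ) (s : ℝ) :
    ‖(a + Complex.I * s) ^ 2‖ = a.re ^ 2 + (a.im + s) ^ 2 := by
  rw [norm_pow, ← Complex.normSq_eq_norm_sq, Complex.normSq_apply]
  simp
  ring

theorem integrable_inv_sq {b : ℝ} (hb : 0 < b) (d : ℝ) :
    Integrable (fun s : ℝ => 1 / (b ^ 2 + (d + s) ^ 2)) := by
  have h := (((integrable_inv_one_add_sq.comp_mul_left' (inv_ne_zero hb.ne')).const_mul
    ((b ^ 2)⁻¹)).comp_add_left d)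
  refine h.congr (ae_of_all _ fun s => ?_)
  field_simp

theorem integral_inv_sq {b : ℝ} (hb : 0 < b) (d : ℝ) :
    ∫ s : ℝ, 1 / (b ^ 2 + (d + s) ^ 2) = π / b := by
  have h1 : ∀ s : ℝ, 1 / (b ^ 2 + (d + s) ^ 2) = (b ^ 2)⁻¹ * (1 + (b⁻¹ * (d + s)) ^ 2)⁻¹ := by
    intro s; field_simp
  simp_rw [h1]
  rw [integral_const_mul, integral_add_left_eq_self (fun s => (1 + (b⁻¹ * s) ^ 2)⁻¹) d,
    Measure.integral_comp_mul_left (fun s => (1 + s ^ 2)⁻¹), integral_univ_inv_one_add_sq]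
  simp [abs_of_pos hb]
  field_simp

theorem integrable_fourier_laplaceKernel {a : ℂ} (ha : 0 < a.re) :
    Integrable (fun s : ℝ => 1 / (a + Complex.I * s) ^ 2) := by
  refine (integrable_inv_sq ha a.im).mono' ?_ (ae_of_all _ fun s => ?_)
  · exact Measurable.aestronglyMeasurable (by fun_prop)
  · rw [norm_div, norm_sq_add_I_mul, norm_one]

/-- Fourier inversion for `s ↦ 1 / (a + is)²`. -/
theorem integral_fourierChar_mul_inv_sq {a : ℂ} (ha : 0 < a.re) (ξ : ℝ) :
    ∫ s : ℝ, Complex.exp (2 * π * Complex.I * ξ * s) * (1 / (a + Complex.I * s) ^ 2) =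
      laplaceKernel a ξ := by
  have h := (continuous_laplaceKernel a).fourierInv_fourier_eq (integrable_laplaceKernel ha)
    (by
      rw [show 𝓕 (laplaceKernel a) = _ from funext (fourier_laplaceKernel ha)]
      exact integrable_fourier_laplaceKernel ha)
  rw [← congrFun h ξ, Real.fourierInv_eq]
  congr 1 with s
  rw [fourier_laplaceKernel ha, Circle.smul_def, smul_eq_mul, Real.fourierChar_apply]
  congr 2
  simp
  ring

end DualLeray
end

noncomputable section
namespace DualLeray
open scoped Real

/-- The Cauchy–Schwarz inequality for the Lebesgue integral. -/
theorem lintegral_mul_sq_le {X : Type*} [MeasurableSpace X] {ν : Measure X} {f g : X → ℝ≥0∞}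
    (hf : AEMeasurable f ν) (hg : AEMeasurable g ν) :
    (∫⁻ x, f x * g x ∂ν) ^ 2 ≤ (∫⁻ x, f x ^ 2 ∂ν) * ∫⁻ x, g x ^ 2 ∂ν := by
  have h := ENNReal.lintegral_mul_le_Lp_mul_Lq ν Real.HolderConjugate.two_two hf hg
  have h2 := pow_le_pow_left' h 2
  refine h2.trans (le_of_eq ?_)
  rw [mul_pow, ← ENNReal.rpow_natCast, ← ENNReal.rpow_natCast, ← ENNReal.rpow_mul,
    ← ENNReal.rpow_mul]
  norm_num

/-- Schur's test with two weights. -/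
theorem schur_test {X : Type*} [MeasurableSpace X] {ν : Measure X} [SFinite ν]
    {k : X → X → ℝ≥0∞} (hk : Measurable (Function.uncurry k)) {u v : X → ℝ≥0∞}
    (hu : Measurable u) (hv : Measurable v) (hu0 : ∀ᵐ x ∂ν, u x ≠ 0 ∧ u x ≠ ∞) {C : ℝ≥0∞}
    (h1 : ∀ y, ∫⁻ x, (u x)⁻¹ * k x y ∂ν ≤ C * (u y)⁻¹)
    (h2 : ∀ x, ∫⁻ y, (v y)⁻¹ * k x y ∂ν ≤ C * (v x)⁻¹) {g : X → ℝ≥0∞} (hg : Measurable g) :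
    ∫⁻ y, u y * (v y)⁻¹ * (∫⁻ x, k x y * g x ∂ν) ^ 2 ∂ν ≤
      C ^ 2 * ∫⁻ x, u x * (v x)⁻¹ * g x ^ 2 ∂ν := by
  have hk' : ∀ y, Measurable fun x => k x y := fun y =>
    hk.comp (measurable_id.prodMk measurable_const)
  have hk'' : ∀ x, Measurable fun y => k x y := fun x =>
    hk.comp (measurable_const.prodMk measurable_id)
  have hk3 : Measurable fun p : X × X => k p.1 p.2 := hk
  have hsq : ∀ a : ℝ≥0∞, (a ^ (1 / 2 : ℝ)) ^ 2 = a := fun a => by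
    rw [← ENNReal.rpow_natCast, ← ENNReal.rpow_mul]; norm_num
  have hpoint : ∀ y, u y * (∫⁻ x, k x y * g x ∂ν) ^ 2 ≤ C * ∫⁻ x, u x * k x y * g x ^ 2 ∂ν := by
    intro y
    have e : ∫⁻ x, k x y * g x ∂ν = ∫⁻ x, ((u x)⁻¹ * k x y) ^ (1 / 2 : ℝ) *
        ((u x * k x y) ^ (1 / 2 : ℝ) * g x) ∂ν := by
      refine lintegral_congr_ae ?_
      filter_upwards [hu0] with x hx
      rw [← mul_assoc, ← ENNReal.mul_rpow_of_nonneg _ _ (by norm_num),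
        show (u x)⁻¹ * k x y * (u x * k x y) = (u x)⁻¹ * u x * (k x y * k x y) by ring,
        ENNReal.inv_mul_cancel hx.1 hx.2, one_mul, ENNReal.mul_rpow_of_nonneg _ _ (by norm_num),
        ← sq, hsq]
    have h3 : (∫⁻ x, k x y * g x ∂ν) ^ 2 ≤
        (∫⁻ x, (u x)⁻¹ * k x y ∂ν) * ∫⁻ x, u x * k x y * g x ^ 2 ∂ν := by
      rw [e]
      refine (lintegral_mul_sq_le ?_ ?_).trans (le_of_eq ?_)
      · exact ((hu.inv.mul (hk' y)).pow_const _).aemeasurable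
      · exact (((hu.mul (hk' y)).pow_const _).mul hg).aemeasurable
      · simp_rw [mul_pow, hsq]
    calc u y * (∫⁻ x, k x y * g x ∂ν) ^ 2
        ≤ u y * ((C * (u y)⁻¹) * ∫⁻ x, u x * k x y * g x ^ 2 ∂ν) := by
          gcongr; exact h3.trans (by gcongr; exact h1 y)
      _ = (u y * (u y)⁻¹) * (C * ∫⁻ x, u x * k x y * g x ^ 2 ∂ν) := by ring
      _ ≤ 1 * (C * ∫⁻ x, u x * k x y * g x ^ 2 ∂ν) := by
          gcongr; exact ENNReal.mul_inv_le_one _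
      _ = _ := one_mul _
  calc ∫⁻ y, u y * (v y)⁻¹ * (∫⁻ x, k x y * g x ∂ν) ^ 2 ∂ν
      ≤ ∫⁻ y, (v y)⁻¹ * (C * ∫⁻ x, u x * k x y * g x ^ 2 ∂ν) ∂ν := by
        refine lintegral_mono fun y => ?_
        rw [mul_comm (u y), mul_assoc]
        exact mul_le_mul_right (hpoint y) _
    _ = C * ∫⁻ y, ∫⁻ x, (v y)⁻¹ * (u x * k x y * g x ^ 2) ∂ν ∂ν := by
        rw [← lintegral_const_mul]
        · refine lintegral_congr fun y => ?_
          rw [lintegral_const_mul _ (by fun_prop)]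
          ring
        · refine Measurable.lintegral_prod_right' (f := fun p : X × X =>
            (v p.1)⁻¹ * (u p.2 * k p.2 p.1 * g p.2 ^ 2)) ?_
          have := hk3.comp measurable_swap
          simp only [Function.comp_def, Prod.fst_swap, Prod.snd_swap] at this
          fun_prop
    _ = C * ∫⁻ x, ∫⁻ y, (v y)⁻¹ * (u x * k x y * g x ^ 2) ∂ν ∂ν := by
        rw [lintegral_lintegral_swap]
        have := hk3.comp measurable_swap
        simp only [Function.comp_def, Prod.fst_swap, Prod.snd_swap] at this
        refine Measurable.aemeasurable ?_
        unfold Function.uncurry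
        fun_prop
    _ ≤ C * ∫⁻ x, C * (u x * (v x)⁻¹ * g x ^ 2) ∂ν := by
        gcongr with x
        calc ∫⁻ y, (v y)⁻¹ * (u x * k x y * g x ^ 2) ∂ν
            = ∫⁻ y, (u x * g x ^ 2) * ((v y)⁻¹ * k x y) ∂ν := by congr 1 with y; ring
          _ = (u x * g x ^ 2) * ∫⁻ y, (v y)⁻¹ * k x y ∂ν :=
              lintegral_const_mul _ (hv.inv.mul (hk'' x))
          _ ≤ (u x * g x ^ 2) * (C * (v x)⁻¹) := by gcongr; exact h2 x
          _ = _ := by ring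
    _ = _ := by
        rw [lintegral_const_mul _ (by fun_prop)]
        ring

theorem lintegral_norm_rpow_mul_exp {q b : ℝ} (hq : -2 < q) (hb : 0 < b) :
    ∫⁻ x : ℂ, ENNReal.ofReal (‖x‖ ^ q * Real.exp (-b * ‖x‖ ^ 2)) =
      ENNReal.ofReal (π * b ^ (-(q + 2) / 2) * Real.Gamma ((q + 2) / 2)) := by
  have h := Complex.integral_rpow_mul_exp_neg_mul_rpow (p := 2) (by norm_num) hq hb
  simp only [Real.rpow_two] at h
  have hpos : 0 < Real.Gamma ((q + 2) / 2) := Real.Gamma_pos_of_pos (by linarith)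
  rw [← ofReal_integral_eq_lintegral_ofReal, h]
  · congr 1; ring
  · by_contra hn
    rw [integral_undef hn] at h
    have : 0 < (2 * π / 2) * b ^ (-(q + 2) / 2) * Real.Gamma ((q + 2) / 2) := by positivity
    linarith
  · exact ae_of_all _ fun x => by positivity

theorem rpow_le_exp {T s : ℝ} (hT : 0 ≤ T) (h0 : 0 ≤ s) (h1 : s ≤ 1) : T ^ s ≤ Real.exp T := by
  have : T ^ s ≤ 1 + T := by
    rcases le_total T 1 with h | h
    · linarith [Real.rpow_le_one hT h h0]
    · have := Real.rpow_le_rpow_of_exponent_le h h1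
      rw [Real.rpow_one] at this
      linarith
  linarith [Real.add_one_le_exp T]

/-- Gaussian averages of `|x|^(-q)`, `0 ≤ q < 2`, are bounded by `|y|^(-q)`, uniformly in the
width of the Gaussian. -/
theorem exists_gaussian_average_le {c q : ℝ} (hc : 0 < c) (hq0 : 0 ≤ q) (hq : q < 2) :
    ∃ C : ℝ≥0∞, C ≠ ∞ ∧ ∀ ξ : ℝ, 0 < ξ → ∀ y : ℂ,
      ∫⁻ x : ℂ, (‖x‖ₑ ^ q)⁻¹ * ENNReal.ofReal (ξ * Real.exp (-c * ξ * ‖x - y‖ ^ 2)) ≤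
        C * (‖y‖ₑ ^ q)⁻¹ := by
  have hgauss : ∀ ξ : ℝ, 0 < ξ → ∀ y : ℂ,
      ∫⁻ x : ℂ, ENNReal.ofReal (ξ * Real.exp (-c * ξ * ‖x - y‖ ^ 2)) = ENNReal.ofReal (π / c) := by
    intro ξ hξ y
    rw [lintegral_sub_right_eq_self
      (fun x : ℂ => ENNReal.ofReal (ξ * Real.exp (-c * ξ * ‖x‖ ^ 2))) y]
    have h := lintegral_norm_rpow_mul_exp (q := 0) (by norm_num) (mul_pos hc hξ)
    simp only [Real.rpow_zero, one_mul, zero_add] at h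
    have e : ∀ x : ℂ, ENNReal.ofReal (ξ * Real.exp (-c * ξ * ‖x‖ ^ 2)) =
        ENNReal.ofReal ξ * ENNReal.ofReal (Real.exp (-(c * ξ) * ‖x‖ ^ 2)) := by
      intro x
      rw [ENNReal.ofReal_mul hξ.le]
      ring_nf
    simp_rw [e]
    rw [lintegral_const_mul _ (by fun_prop), h, ← ENNReal.ofReal_mul hξ.le]
    congr 1
    norm_num [Real.rpow_neg_one]
    field_simp
  set K : ℝ := 2 ^ q * (π / c) + π * (c / 2) ^ (-(-q + 2) / 2) * Real.Gamma ((-q + 2) / 2) *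
    (8 / c) ^ (q / 2) with hK
  have hG : 0 < Real.Gamma ((-q + 2) / 2) := Real.Gamma_pos_of_pos (by linarith)
  have hKpos : 0 < K := by positivity
  refine ⟨ENNReal.ofReal K, ENNReal.ofReal_ne_top, fun ξ hξ y => ?_⟩
  rcases eq_or_ne y 0 with rfl | hy
  · rcases hq0.eq_or_lt with rfl | hq1
    · simp only [ENNReal.rpow_zero, inv_one, one_mul, mul_one]
      rw [hgauss ξ hξ 0]
      apply ENNReal.ofReal_le_ofReal
      rw [hK, Real.rpow_zero, one_mul]
      have : 0 ≤ π * (c / 2) ^ (-(-0 + 2) / 2 : ℝ) * Real.Gamma ((-0 + 2) / 2) *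
        (8 / c) ^ (0 / 2 : ℝ) := by positivity
      linarith
    · rw [enorm_zero, ENNReal.zero_rpow_of_pos hq1, ENNReal.inv_zero, ENNReal.mul_top]
      · exact le_top
      · simpa using hKpos
  have hy' : 0 < ‖y‖ := norm_pos_iff.2 hy
  have conv : ∀ x : ℂ, x ≠ 0 → (‖x‖ₑ ^ q)⁻¹ = ENNReal.ofReal (‖x‖ ^ (-q)) := by
    intro x hx
    have hx' : 0 < ‖x‖ := norm_pos_iff.2 hx
    rw [← ENNReal.rpow_neg, ← ofReal_norm, ENNReal.ofReal_rpow_of_pos hx']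
  have pt : ∀ x : ℂ, x ≠ 0 → ‖x‖ ^ (-q) * (ξ * Real.exp (-c * ξ * ‖x - y‖ ^ 2)) ≤
      2 ^ q * ‖y‖ ^ (-q) * (ξ * Real.exp (-c * ξ * ‖x - y‖ ^ 2)) +
      (ξ * Real.exp (-(c * ξ * ‖y‖ ^ 2 / 8))) *
        (‖x‖ ^ (-q) * Real.exp (-(c / 2 * ξ) * ‖x‖ ^ 2)) := by
    intro x hx
    have hx' : 0 < ‖x‖ := norm_pos_iff.2 hx
    rcases le_total (‖y‖ / 2) ‖x‖ with h | h
    · have h1 : ‖x‖ ^ (-q) ≤ 2 ^ q * ‖y‖ ^ (-q) := by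
        have := Real.rpow_le_rpow_of_nonpos (by positivity) h (by linarith : -q ≤ 0)
        refine this.trans (le_of_eq ?_)
        rw [Real.div_rpow hy'.le (by norm_num), Real.rpow_neg (by norm_num : (0 : ℝ) ≤ 2)]
        field_simp
      have h2 : 0 ≤ (ξ * Real.exp (-(c * ξ * ‖y‖ ^ 2 / 8))) *
        (‖x‖ ^ (-q) * Real.exp (-(c / 2 * ξ) * ‖x‖ ^ 2)) := by positivity
      have h3 := mul_le_mul_of_nonneg_right h1
        (by positivity : 0 ≤ ξ * Real.exp (-c * ξ * ‖x - y‖ ^ 2))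
      linarith
    · have h1 : ‖y‖ / 2 ≤ ‖x - y‖ := by
        have := norm_sub_norm_le y x
        rw [norm_sub_rev] at this
        linarith
      have h2 : ‖y‖ ^ 2 / 8 + ‖x‖ ^ 2 / 2 ≤ ‖x - y‖ ^ 2 := by
        have h3 : (‖y‖ / 2) ^ 2 ≤ ‖x - y‖ ^ 2 := by gcongr
        have h4 : ‖x‖ ^ 2 ≤ (‖y‖ / 2) ^ 2 := by gcongr
        nlinarith
      have h5 : Real.exp (-c * ξ * ‖x - y‖ ^ 2) ≤
          Real.exp (-(c * ξ * ‖y‖ ^ 2 / 8)) * Real.exp (-(c / 2 * ξ) * ‖x‖ ^ 2) := by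
        rw [← Real.exp_add]
        apply Real.exp_le_exp.2
        have := mul_le_mul_of_nonneg_left h2 (mul_pos hc hξ).le
        nlinarith
      have h6 : 0 ≤ 2 ^ q * ‖y‖ ^ (-q) * (ξ * Real.exp (-c * ξ * ‖x - y‖ ^ 2)) := by positivity
      have h7 := mul_le_mul_of_nonneg_left h5 (by positivity : 0 ≤ ‖x‖ ^ (-q) * ξ)
      linarith
  calc ∫⁻ x : ℂ, (‖x‖ₑ ^ q)⁻¹ * ENNReal.ofReal (ξ * Real.exp (-c * ξ * ‖x - y‖ ^ 2))
      ≤ ∫⁻ x : ℂ, (ENNReal.ofReal (2 ^ q * ‖y‖ ^ (-q)) *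
          ENNReal.ofReal (ξ * Real.exp (-c * ξ * ‖x - y‖ ^ 2)) +
          ENNReal.ofReal (ξ * Real.exp (-(c * ξ * ‖y‖ ^ 2 / 8))) *
          ENNReal.ofReal (‖x‖ ^ (-q) * Real.exp (-(c / 2 * ξ) * ‖x‖ ^ 2))) := by
        refine lintegral_mono_ae ?_
        have : ∀ᵐ x : ℂ, x ≠ 0 := Measure.ae_ne volume 0
        filter_upwards [this] with x hx
        rw [conv x hx, ← ENNReal.ofReal_mul (by positivity), ← ENNReal.ofReal_mul (by positivity),
          ← ENNReal.ofReal_mul (by positivity), ← ENNReal.ofReal_add (by positivity)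
          (by positivity)]
        exact ENNReal.ofReal_le_ofReal (pt x hx)
    _ = ENNReal.ofReal (2 ^ q * ‖y‖ ^ (-q) * (π / c) + ξ * Real.exp (-(c * ξ * ‖y‖ ^ 2 / 8)) *
          (π * (c / 2 * ξ) ^ (-(-q + 2) / 2) * Real.Gamma ((-q + 2) / 2))) := by
        rw [lintegral_add_left (by fun_prop), lintegral_const_mul _ (by fun_prop),
          lintegral_const_mul _ (by fun_prop), hgauss ξ hξ y,
          lintegral_norm_rpow_mul_exp (by linarith) (by positivity),
          ← ENNReal.ofReal_mul (by positivity), ← ENNReal.ofReal_mul (by positivity),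
          ← ENNReal.ofReal_add (by positivity) (by positivity)]
    _ ≤ ENNReal.ofReal (K * ‖y‖ ^ (-q)) := by
        apply ENNReal.ofReal_le_ofReal
        rw [hK, add_mul]
        refine add_le_add (le_of_eq (by ring)) ?_
        have h1 : ξ * (c / 2 * ξ) ^ (-(-q + 2) / 2) = (c / 2) ^ (-(-q + 2) / 2) * ξ ^ (q / 2) := by
          rw [Real.mul_rpow (by positivity) hξ.le, mul_left_comm]
          congr 1
          nth_rewrite 1 [← Real.rpow_one ξ]
          rw [← Real.rpow_add hξ]
          congr 1
          ring
        have h2 : ξ ^ (q / 2) * Real.exp (-(c * ξ * ‖y‖ ^ 2 / 8)) ≤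
            (8 / c) ^ (q / 2) * ‖y‖ ^ (-q) := by
          have h3 := rpow_le_exp (T := c * ξ * ‖y‖ ^ 2 / 8) (s := q / 2) (by positivity)
            (by positivity) (by linarith)
          have h4 : ξ ^ (q / 2) =
              (c * ξ * ‖y‖ ^ 2 / 8) ^ (q / 2) * ((8 / c) ^ (q / 2) * ‖y‖ ^ (-q)) := by
            have h5 : ‖y‖ ^ (-q) = ((‖y‖ ^ 2)⁻¹) ^ (q / 2) := by
              rw [← Real.rpow_two, ← Real.rpow_neg hy'.le, ← Real.rpow_mul hy'.le]
              congr 1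
              ring
            rw [h5, ← Real.mul_rpow (by positivity) (by positivity),
              ← Real.mul_rpow (by positivity) (by positivity)]
            congr 1
            field_simp
          rw [h4, Real.exp_neg]
          have hE := Real.exp_pos (c * ξ * ‖y‖ ^ 2 / 8)
          rw [← div_eq_mul_inv, div_le_iff₀ hE, mul_comm]
          gcongr
        calc ξ * Real.exp (-(c * ξ * ‖y‖ ^ 2 / 8)) *
              (π * (c / 2 * ξ) ^ (-(-q + 2) / 2) * Real.Gamma ((-q + 2) / 2))
            = (ξ * (c / 2 * ξ) ^ (-(-q + 2) / 2)) * Real.exp (-(c * ξ * ‖y‖ ^ 2 / 8)) *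
              (π * Real.Gamma ((-q + 2) / 2)) := by ring
          _ = (c / 2) ^ (-(-q + 2) / 2) * (ξ ^ (q / 2) * Real.exp (-(c * ξ * ‖y‖ ^ 2 / 8))) *
              (π * Real.Gamma ((-q + 2) / 2)) := by rw [h1]; ring
          _ ≤ (c / 2) ^ (-(-q + 2) / 2) * ((8 / c) ^ (q / 2) * ‖y‖ ^ (-q)) *
              (π * Real.Gamma ((-q + 2) / 2)) := by gcongr
          _ = _ := by ring
    _ = ENNReal.ofReal K * (‖y‖ₑ ^ q)⁻¹ := by rw [conv y hy, ENNReal.ofReal_mul hKpos.le]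

end DualLeray
end

noncomputable section
namespace DualLeray
open scoped FourierTransform Real

/-- A measurable phase function `B` on `ℂ × ℂ` with `Re B(x, y) ≥ c |x - y|²`, `c > 0`. -/
structure IsGaussianPhase (B : ℂ → ℂ → ℂ) (c : ℝ) : Prop where
  measurable : Measurable (Function.uncurry B)
  pos : 0 < c
  le_re : ∀ x y, c * ‖x - y‖ ^ 2 ≤ (B x y).re

/-- Bounded measurable functions on `ℂ × ℝ` with bounded support. -/
structure IsBoundedTest (f : ℂ × ℝ → ℂ) : Prop where
  measurable : Measurable f
  bounded : ∃ N : ℝ, (∀ p, ‖f p‖ ≤ N) ∧ ∀ p, N < ‖p‖ → f p = 0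

/-- The denominator `B(x, y) + ε + i(s - t)` at `p = (x, s)`, `q = (y, t)`. -/
def denom (B : ℂ → ℂ → ℂ) (ε : ℝ) (q p : ℂ × ℝ) : ℂ :=
  B p.1 q.1 + ε + Complex.I * ((p.2 : ℂ) - q.2)

/-- The integral operator with kernel `1 / (B(x, y) + ε + i(s - t))²`. -/
def kernelOp (B : ℂ → ℂ → ℂ) (ε : ℝ) (f : ℂ × ℝ → ℂ) (q : ℂ × ℝ) : ℂ :=
  ∫ p, f p / denom B ε q p ^ 2

/-- The Fourier transform in the real variable. -/
def partialFourier (f : ℂ × ℝ → ℂ) (x : ℂ) (ξ : ℝ) : ℂ := 𝓕 (fun s => f (x, s)) ξ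

/-- The limit `ε → 0` of the partial Fourier transform of `kernelOp B ε f`. -/
def fourierOp (B : ℂ → ℂ → ℂ) (f : ℂ × ℝ → ℂ) (y : ℂ) (ξ : ℝ) : ℂ :=
  ∫ x, laplaceKernel (B x y) ξ * partialFourier f x ξ

/-- The damping factor `e^{-2πεξ}`, `ξ ≥ 0`. -/
def damping (ε ξ : ℝ) : ℝ := Real.exp (-(2 * π * ε * max ξ 0))

theorem damping_le_one {ε : ℝ} (hε : 0 ≤ ε) (ξ : ℝ) : damping ε ξ ≤ 1 := by
  have : 0 ≤ max ξ 0 := le_max_right _ _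
  exact Real.exp_le_one_iff.2 (by have := Real.pi_pos; simp; positivity)

theorem damping_pos (ε ξ : ℝ) : 0 < damping ε ξ := Real.exp_pos _

theorem measurable_damping (ε : ℝ) : Measurable (damping ε) := by unfold damping; fun_prop

theorem measurable_integral_right {α β : Type*} [MeasurableSpace α] [MeasurableSpace β]
    {ν : Measure β} [SFinite ν] {F : α → β → ℂ} (hF : Measurable (Function.uncurry F)) :
    Measurable fun a => ∫ b, F a b ∂ν :=
  (hF.stronglyMeasurable.integral_prod_right).measurable

theorem memLp_of_bounded_of_support {E : Type*} [NormedAddCommGroup E] [MeasurableSpace E]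
    [BorelSpace E] [ProperSpace E] {μ : Measure E} [IsLocallyFiniteMeasure μ] {g : E → ℂ} {N : ℝ}
    (hg : Measurable g) (h1 : ∀ p, ‖g p‖ ≤ N) (h2 : ∀ p, N < ‖p‖ → g p = 0) (r : ℝ≥0∞) :
    MemLp g r μ := by
  have e : g = (Metric.closedBall 0 N).indicator g := by
    ext p
    by_cases hp : p ∈ Metric.closedBall (0 : E) N
    · rw [indicator_of_mem hp]
    · rw [indicator_of_notMem hp, h2 p (by simpa using hp)]
  rw [e, memLp_indicator_iff_restrict measurableSet_closedBall]
  have : IsFiniteMeasure (μ.restrict (Metric.closedBall 0 N)) :=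
    ⟨by rw [Measure.restrict_apply_univ]; exact measure_closedBall_lt_top⟩
  exact MemLp.of_bound hg.aestronglyMeasurable N (ae_of_all _ h1)

namespace IsBoundedTest

variable {f : ℂ × ℝ → ℂ}

theorem integrable (hf : IsBoundedTest f) : Integrable f := by
  obtain ⟨N, h1, h2⟩ := hf.bounded
  exact memLp_one_iff_integrable.1 (memLp_of_bounded_of_support hf.measurable h1 h2 1)

theorem memLp_section (hf : IsBoundedTest f) (x : ℂ) (r : ℝ≥0∞) :
    MemLp (fun s : ℝ => f (x, s)) r := by
  obtain ⟨N, h1, h2⟩ := hf.bounded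
  refine memLp_of_bounded_of_support (hf.measurable.comp (by fun_prop)) (fun s => h1 (x, s))
    (fun s hs => h2 (x, s) (hs.trans_le ?_)) r
  simp [Prod.norm_def]

theorem integrable_section (hf : IsBoundedTest f) (x : ℂ) :
    Integrable (fun s : ℝ => f (x, s)) :=
  memLp_one_iff_integrable.1 (hf.memLp_section x 1)

end IsBoundedTest

theorem partialFourier_eq (f : ℂ × ℝ → ℂ) (x : ℂ) (ξ : ℝ) :
    partialFourier f x ξ = ∫ s : ℝ, Complex.exp (-(2 * π * Complex.I * ξ * s)) * f (x, s) := by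
  rw [partialFourier, Real.fourier_real_eq_integral_exp_smul]
  congr 1 with s
  rw [smul_eq_mul]
  congr 2
  push_cast
  ring

theorem measurable_partialFourier {f : ℂ × ℝ → ℂ} (hf : Measurable f) :
    Measurable (Function.uncurry (partialFourier f)) := by
  have e : Function.uncurry (partialFourier f) = fun p : ℂ × ℝ =>
      ∫ s : ℝ, Complex.exp (-(2 * π * Complex.I * p.2 * s)) * f (p.1, s) :=
    funext fun p => partialFourier_eq f p.1 p.2
  rw [e]
  apply measurable_integral_right
  unfold Function.uncurry
  fun_prop

theorem norm_partialFourier_le (f : ℂ × ℝ → ℂ) (x : ℂ) (ξ : ℝ) :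
    ‖partialFourier f x ξ‖ ≤ ∫ s : ℝ, ‖f (x, s)‖ := by
  rw [partialFourier_eq]
  refine (norm_integral_le_integral_norm _).trans (le_of_eq ?_)
  congr 1 with s
  rw [norm_mul, Complex.norm_exp]
  simp

section Phase

variable {B : ℂ → ℂ → ℂ} {c : ℝ} {f : ℂ × ℝ → ℂ}

theorem IsGaussianPhase.re_nonneg (hB : IsGaussianPhase B c) (x y : ℂ) : 0 ≤ (B x y).re :=
  le_trans (by have := hB.pos; positivity) (hB.le_re x y)

theorem IsGaussianPhase.measurable_laplaceKernel (hB : IsGaussianPhase B c) :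
    Measurable fun p : (ℂ × ℂ) × ℝ => laplaceKernel (B p.1.1 p.1.2) p.2 :=
  DualLeray.measurable_laplaceKernel.comp
    ((hB.measurable.comp measurable_fst).prodMk measurable_snd)

theorem measurable_fourierOp (hB : IsGaussianPhase B c) (hf : Measurable f) :
    Measurable (Function.uncurry (fourierOp B f)) := by
  unfold fourierOp Function.uncurry
  apply measurable_integral_right
  refine Measurable.mul ?_ ?_
  · exact hB.measurable_laplaceKernel.comp
      (f := fun q : (ℂ × ℝ) × ℂ => ((q.2, q.1.1), q.1.2)) (by fun_prop)
  · exact (measurable_partialFourier hf).comp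
      (f := fun q : (ℂ × ℝ) × ℂ => (q.2, q.1.2)) (by fun_prop)

theorem fourierOp_of_nonpos (B : ℂ → ℂ → ℂ) (f : ℂ × ℝ → ℂ) (y : ℂ) {ξ : ℝ} (hξ : ξ ≤ 0) :
    fourierOp B f y ξ = 0 := by
  simp [fourierOp, laplaceKernel_of_nonpos _ hξ]

theorem laplaceKernel_add_ofReal (a : ℂ) (ε ξ : ℝ) :
    laplaceKernel (a + ε) ξ = damping ε ξ * laplaceKernel a ξ := by
  rcases le_or_gt ξ 0 with h | h
  · simp [laplaceKernel_of_nonpos _ h]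
  · rw [laplaceKernel_add, damping, max_eq_left h.le]
    push_cast
    congr 2
    ring

theorem norm_damping_mul_fourierOp_le (hB : IsGaussianPhase B c) (hf : IsBoundedTest f)
    (ε : ℝ) (y : ℂ) (ξ : ℝ) :
    ‖(damping ε ξ : ℂ) * fourierOp B f y ξ‖ ≤ (∫ p, ‖f p‖) * ‖laplaceKernel ε ξ‖ := by
  rw [fourierOp, ← integral_const_mul]
  have e : ∀ x, (damping ε ξ : ℂ) * (laplaceKernel (B x y) ξ * partialFourier f x ξ) =
      laplaceKernel (B x y + ε) ξ * partialFourier f x ξ := by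
    intro x; rw [laplaceKernel_add_ofReal]; ring
  simp_rw [e]
  have hi : Integrable (fun x => ∫ s : ℝ, ‖f (x, s)‖) := hf.integrable.norm.integral_prod_left
  refine (norm_integral_le_of_norm_le (hi.mul_const ‖laplaceKernel ε ξ‖)
    (ae_of_all _ fun x => ?_)).trans (le_of_eq ?_)
  · rw [norm_mul, mul_comm]
    gcongr
    · exact norm_partialFourier_le f x ξ
    · apply norm_laplaceKernel_le
      simpa using hB.re_nonneg x y
  · rw [integral_mul_const, Measure.volume_eq_prod, integral_prod _ (hf.integrable.norm)]

theorem measurable_damping_mul_fourierOp (hB : IsGaussianPhase B c) (hf : IsBoundedTest f)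
    (ε : ℝ) (y : ℂ) : Measurable fun ξ => (damping ε ξ : ℂ) * fourierOp B f y ξ := by
  have h1 := measurable_damping ε
  have h2 : Measurable fun ξ => fourierOp B f y ξ :=
    (measurable_fourierOp hB hf.measurable).comp (f := fun ξ : ℝ => (y, ξ)) (by fun_prop)
  fun_prop

theorem memLp_laplaceKernel {a : ℂ} (ha : 0 < a.re) : MemLp (laplaceKernel a) 2 := by
  refine (memLp_two_iff_integrable_sq_norm
    (continuous_laplaceKernel a).aestronglyMeasurable).2 ?_
  refine (integrable_laplaceKernel ha).norm.mul_bdd (c := (2 * π) ^ 2 * (2 * π * a.re)⁻¹)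
    (continuous_laplaceKernel a).norm.aestronglyMeasurable (ae_of_all _ fun ξ => ?_) |>.congr
      (ae_of_all _ fun ξ => (sq _).symm)
  rw [norm_norm, norm_laplaceKernel, mul_assoc]
  gcongr
  have hb : 0 < 2 * π * a.re := by positivity
  rcases le_or_gt ξ 0 with h | h
  · rw [max_eq_right h, zero_mul]; positivity
  · rw [max_eq_left h.le, Real.exp_neg, ← div_eq_mul_inv, div_le_iff₀ (Real.exp_pos _),
      inv_mul_eq_div, le_div_iff₀ hb]
    nlinarith [Real.add_one_le_exp (2 * π * ξ * a.re)]

theorem integrable_damping_mul_fourierOp (hB : IsGaussianPhase B c) (hf : IsBoundedTest f)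
    {ε : ℝ} (hε : 0 < ε) (y : ℂ) : Integrable fun ξ => (damping ε ξ : ℂ) * fourierOp B f y ξ :=
  ((integrable_laplaceKernel (a := ε) (by simpa using hε)).norm.const_mul (∫ p, ‖f p‖)).mono'
    (measurable_damping_mul_fourierOp hB hf ε y).aestronglyMeasurable
    (ae_of_all _ (norm_damping_mul_fourierOp_le hB hf ε y))

theorem memLp_damping_mul_fourierOp (hB : IsGaussianPhase B c) (hf : IsBoundedTest f)
    {ε : ℝ} (hε : 0 < ε) (y : ℂ) : MemLp (fun ξ => (damping ε ξ : ℂ) * fourierOp B f y ξ) 2 := by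
  refine MemLp.mono ((memLp_laplaceKernel (a := ε) (by simpa using hε)).norm.const_mul
    (∫ p, ‖f p‖)) (measurable_damping_mul_fourierOp hB hf ε y).aestronglyMeasurable
    (ae_of_all _ fun ξ => ?_)
  refine (norm_damping_mul_fourierOp_le hB hf ε y ξ).trans (le_abs_self _)

/-- On test functions `kernelOp B ε` is a Fourier integral in the real variable. -/
theorem kernelOp_eq_fourierInv (hB : IsGaussianPhase B c) (hf : IsBoundedTest f)
    {ε : ℝ} (hε : 0 < ε) (y : ℂ) (t : ℝ) :
    kernelOp B ε f (y, t) = 𝓕⁻ (fun ξ => (damping ε ξ : ℂ) * fourierOp B f y ξ) t := by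
  have hre : ∀ x, 0 < (B x y + ε).re := fun x => by
    have := hB.re_nonneg x y
    simp
    linarith
  have e1 : ∀ p : ℂ × ℝ, f p / denom B ε (y, t) p ^ 2 = ∫ ξ : ℝ,
      f p * (Complex.exp (2 * π * Complex.I * ξ * (t - p.2)) *
        laplaceKernel (B p.1 y + ε) ξ) := by
    intro p
    have h := fourier_laplaceKernel (hre p.1) (p.2 - t)
    rw [integral_const_mul, div_eq_mul_one_div]
    congr 1
    rw [denom]
    push_cast at h
    rw [← h, Real.fourier_real_eq_integral_exp_smul]
    congr 1 with ξ
    rw [smul_eq_mul]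
    congr 2
    push_cast
    ring
  have hint : Integrable (Function.uncurry fun (p : ℂ × ℝ) (ξ : ℝ) =>
      f p * (Complex.exp (2 * π * Complex.I * ξ * (t - p.2)) *
        laplaceKernel (B p.1 y + ε) ξ)) (volume.prod volume) := by
    refine ((hf.integrable.norm).mul_prod
      (integrable_laplaceKernel (a := ε) (by simpa using hε)).norm).mono' ?_
      (ae_of_all _ fun z => ?_)
    · refine Measurable.aestronglyMeasurable ?_
      unfold Function.uncurry
      have h1 := hf.measurable
      have h2 : Measurable fun z : (ℂ × ℝ) × ℝ => laplaceKernel (B z.1.1 y + ε) z.2 :=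
        measurable_laplaceKernel.comp (f := fun z : (ℂ × ℝ) × ℝ => (B z.1.1 y + ε, z.2))
          ((hB.measurable.comp (f := fun z : (ℂ × ℝ) × ℝ => (z.1.1, y))
            (by fun_prop)).add_const _ |>.prodMk (by fun_prop))
      fun_prop
    · simp only [Function.uncurry]
      rw [norm_mul, norm_mul]
      gcongr
      have h3 : ‖Complex.exp (2 * π * Complex.I * z.2 * (t - z.1.2))‖ = 1 := by
        rw [Complex.norm_exp]
        simp
      rw [h3, one_mul]
      apply norm_laplaceKernel_le
      simpa using hB.re_nonneg z.1.1 y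
  rw [kernelOp, integral_congr_ae (ae_of_all _ e1), integral_integral_swap hint,
    Real.fourierInv_eq]
  refine integral_congr_ae ?_
  filter_upwards [hint.prod_left_ae] with ξ hξ
  simp only [Function.uncurry] at hξ
  rw [Measure.volume_eq_prod] at hξ ⊢
  rw [integral_prod _ hξ, Circle.smul_def, smul_eq_mul,
    Real.fourierChar_apply, fourierOp, ← integral_const_mul, ← integral_const_mul]
  congr 1 with x
  simp only [partialFourier_eq, laplaceKernel_add_ofReal]
  rw [← integral_const_mul, ← integral_const_mul,
    ← integral_const_mul]
  congr 1 with s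
  have : Complex.exp (2 * π * Complex.I * ξ * (t - s)) =
      Complex.exp (2 * π * Complex.I * ξ * t) *
        Complex.exp (-(2 * π * Complex.I * ξ * s)) := by
    rw [← Complex.exp_add]; ring_nf
  rw [this]
  have h4 : Complex.exp (((2 * π * inner ℝ ξ t : ℝ) : ℂ) * Complex.I) =
      Complex.exp (2 * π * Complex.I * ξ * t) := by
    congr 1
    simp
    ring
  rw [h4]
  ring

theorem lintegral_enorm_sq_fourierInv {g : ℝ → ℂ} (h1 : Integrable g) (h2 : MemLp g 2) :
    ∫⁻ t, ‖𝓕⁻ g t‖ₑ ^ 2 = ∫⁻ ξ, ‖g ξ‖ₑ ^ 2 := by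
  rw [← lintegral_enorm_sq_fourier h1 h2,
    ← (Measure.measurePreserving_neg (volume : Measure ℝ)).lintegral_comp_emb
      (MeasurableEquiv.neg ℝ).measurableEmbedding (fun t => ‖𝓕 g t‖ₑ ^ 2)]
  simp_rw [Real.fourierInv_eq_fourier_neg]

theorem lintegral_kernelOp_sq (hB : IsGaussianPhase B c) (hf : IsBoundedTest f)
    {ε : ℝ} (hε : 0 < ε) (y : ℂ) :
    ∫⁻ t, ‖kernelOp B ε f (y, t)‖ₑ ^ 2 =
      ∫⁻ ξ, ENNReal.ofReal (damping ε ξ) ^ 2 * ‖fourierOp B f y ξ‖ₑ ^ 2 := by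
  simp_rw [kernelOp_eq_fourierInv hB hf hε]
  rw [lintegral_enorm_sq_fourierInv (integrable_damping_mul_fourierOp hB hf hε y)
    (memLp_damping_mul_fourierOp hB hf hε y)]
  congr 1 with ξ
  rw [enorm_mul, mul_pow, ← ofReal_norm (damping ε ξ : ℂ), Complex.norm_real,
    Real.norm_of_nonneg (damping_pos ε ξ).le]

theorem lintegral_kernelOp_sub_sq (hB : IsGaussianPhase B c) (hf : IsBoundedTest f)
    {ε ε' : ℝ} (hε : 0 < ε) (hε' : 0 < ε') (y : ℂ) :
    ∫⁻ t, ‖kernelOp B ε f (y, t) - kernelOp B ε' f (y, t)‖ₑ ^ 2 =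
      ∫⁻ ξ, ‖damping ε ξ - damping ε' ξ‖ₑ ^ 2 * ‖fourierOp B f y ξ‖ₑ ^ 2 := by
  have h1 := integrable_damping_mul_fourierOp hB hf hε y
  have h2 := integrable_damping_mul_fourierOp hB hf hε' y
  have e : ∀ t, kernelOp B ε f (y, t) - kernelOp B ε' f (y, t) =
      𝓕⁻ (fun ξ => ((damping ε ξ - damping ε' ξ : ℝ) : ℂ) * fourierOp B f y ξ) t := by
    intro t
    rw [kernelOp_eq_fourierInv hB hf hε, kernelOp_eq_fourierInv hB hf hε', Real.fourierInv_eq,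
      Real.fourierInv_eq, Real.fourierInv_eq, ← integral_sub]
    · congr 1 with ξ
      rw [← smul_sub, ← sub_mul]
      push_cast
      rfl
    · refine h1.norm.mono' ?_ (ae_of_all _ fun ξ => by simp [Circle.norm_smul])
      exact Continuous.aestronglyMeasurable (by fun_prop) |>.smul h1.1
    · refine h2.norm.mono' ?_ (ae_of_all _ fun ξ => by simp [Circle.norm_smul])
      exact Continuous.aestronglyMeasurable (by fun_prop) |>.smul h2.1
  simp_rw [e]
  rw [lintegral_enorm_sq_fourierInv]
  · congr 1 with ξ
    rw [enorm_mul, mul_pow, ← ofReal_norm (Complex.ofReal _), Complex.norm_real, ofReal_norm]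
  · refine (h1.sub h2).congr (ae_of_all _ fun ξ => ?_)
    simp only [Pi.sub_apply]
    push_cast
    ring
  · refine ((memLp_damping_mul_fourierOp hB hf hε y).sub
      (memLp_damping_mul_fourierOp hB hf hε' y)).ae_eq (ae_of_all _ fun ξ => ?_)
    simp only [Pi.sub_apply]
    push_cast
    ring

end Phase

end DualLeray
end

noncomputable section
namespace DualLeray
open scoped FourierTransform Real

/-- The measure `|x|^m dx ds` on `ℂ × ℝ`. -/
def weightedVolume (m : ℝ) : Measure (ℂ × ℝ) :=
  (volume : Measure (ℂ × ℝ)).withDensity fun p => ‖p.1‖ₑ ^ m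

theorem lintegral_weightedVolume (m : ℝ) {F : ℂ × ℝ → ℝ≥0∞} (hF : Measurable F) :
    ∫⁻ p, F p ∂(weightedVolume m) = ∫⁻ x : ℂ, ‖x‖ₑ ^ m * ∫⁻ s : ℝ, F (x, s) := by
  rw [weightedVolume, lintegral_withDensity_eq_lintegral_mul _ (by fun_prop) hF,
    Measure.volume_eq_prod, lintegral_prod _ (by fun_prop)]
  congr 1 with x
  simp only [Pi.mul_apply]
  rw [lintegral_const_mul _ (by fun_prop)]

theorem ae_enorm_ne_zero_and_ne_top : ∀ᵐ x : ℂ, ‖x‖ₑ ≠ 0 ∧ ‖x‖ₑ ≠ ∞ := by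
  filter_upwards [Measure.ae_ne volume (0 : ℂ)] with x hx
  exact ⟨by simpa using hx, enorm_ne_top⟩

theorem enorm_rpow_eq_mul_inv {x : ℂ} (hx : ‖x‖ₑ ≠ 0 ∧ ‖x‖ₑ ≠ ∞) (m : ℝ) :
    ‖x‖ₑ ^ m = ‖x‖ₑ ^ (max m 0) * (‖x‖ₑ ^ (max (-m) 0))⁻¹ := by
  rw [← ENNReal.rpow_neg, ← ENNReal.rpow_add _ _ hx.1 hx.2]
  congr 1
  rcases le_total m 0 with h | h
  · rw [max_eq_right h, max_eq_left (by linarith)]; ring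
  · rw [max_eq_left h, max_eq_right (by linarith)]; ring

theorem enorm_laplaceKernel_le {B : ℂ → ℂ → ℂ} {c : ℝ} (hB : IsGaussianPhase B c) {ξ : ℝ}
    (hξ : 0 < ξ) (x y : ℂ) : ‖laplaceKernel (B x y) ξ‖ₑ ≤ ENNReal.ofReal ((2 * π) ^ 2) *
      ENNReal.ofReal (ξ * Real.exp (-(2 * π * c) * ξ * ‖x - y‖ ^ 2)) := by
  rw [← ENNReal.ofReal_mul (by positivity), ← ofReal_norm, norm_laplaceKernel, max_eq_left hξ.le,
    ← mul_assoc]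
  apply ENNReal.ofReal_le_ofReal
  gcongr
  have := mul_le_mul_of_nonneg_left (hB.le_re x y) (by positivity : 0 ≤ 2 * π * ξ)
  linarith

theorem exists_lintegral_fourierOp_le {c m : ℝ} (hc : 0 < c) (h1 : -2 < m) (h2 : m < 2) :
    ∃ C : ℝ≥0∞, C ≠ ∞ ∧ ∀ B : ℂ → ℂ → ℂ, IsGaussianPhase B c → ∀ f : ℂ × ℝ → ℂ, Measurable f →
      ∀ ξ : ℝ, ∫⁻ y, ‖y‖ₑ ^ m * ‖fourierOp B f y ξ‖ₑ ^ 2 ≤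
        C * ∫⁻ x, ‖x‖ₑ ^ m * ‖partialFourier f x ξ‖ₑ ^ 2 := by
  have hc' : 0 < 2 * π * c := by positivity
  obtain ⟨C1, hC1, hC1'⟩ := exists_gaussian_average_le hc' (le_max_right m 0)
    (max_lt h2 (by norm_num))
  obtain ⟨C2, hC2, hC2'⟩ := exists_gaussian_average_le hc' (le_max_right (-m) 0)
    (max_lt (by linarith) (by norm_num))
  refine ⟨ENNReal.ofReal ((2 * π) ^ 2) ^ 2 * (C1 + C2) ^ 2, by finiteness,
    fun B hB f hf ξ => ?_⟩
  rcases le_or_gt ξ 0 with hξ | hξ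
  · simp [fourierOp_of_nonpos B f _ hξ]
  set k : ℂ → ℂ → ℝ≥0∞ := fun x y =>
    ENNReal.ofReal (ξ * Real.exp (-(2 * π * c) * ξ * ‖x - y‖ ^ 2)) with hk
  have hkm : Measurable (Function.uncurry k) := by
    simp only [hk]; unfold Function.uncurry; fun_prop
  have hg : Measurable fun x => ‖partialFourier f x ξ‖ₑ :=
    ((measurable_partialFourier hf).comp (f := fun x : ℂ => (x, ξ)) (by fun_prop)).enorm
  have hs := schur_test (ν := volume) hkm (u := fun x => ‖x‖ₑ ^ (max m 0))
    (v := fun x => ‖x‖ₑ ^ (max (-m) 0)) (by fun_prop) (by fun_prop) (C := C1 + C2)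
    (by
      filter_upwards [ae_enorm_ne_zero_and_ne_top] with x hx
      exact ⟨by simp [ENNReal.rpow_eq_zero_iff, hx.1, hx.2],
        by simp [ENNReal.rpow_eq_top_iff, hx.1, hx.2]⟩)
    (fun y => (hC1' ξ hξ y).trans (by gcongr; exact le_self_add))
    (fun x => by
      have := hC2' ξ hξ x
      simp only [hk]
      simp_rw [norm_sub_rev x]
      exact this.trans (by gcongr; exact le_add_self)) hg
  have hb : ∀ y, ‖fourierOp B f y ξ‖ₑ ≤ ENNReal.ofReal ((2 * π) ^ 2) *
      ∫⁻ x, k x y * ‖partialFourier f x ξ‖ₑ := by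
    intro y
    rw [← lintegral_const_mul' _ _ ENNReal.ofReal_ne_top]
    refine (enorm_integral_le_lintegral_enorm _).trans (lintegral_mono fun x => ?_)
    rw [enorm_mul, ← mul_assoc]
    gcongr
    exact enorm_laplaceKernel_le hB hξ x y
  calc ∫⁻ y, ‖y‖ₑ ^ m * ‖fourierOp B f y ξ‖ₑ ^ 2
      ≤ ∫⁻ y, ENNReal.ofReal ((2 * π) ^ 2) ^ 2 * (‖y‖ₑ ^ (max m 0) * (‖y‖ₑ ^ (max (-m) 0))⁻¹ *
          (∫⁻ x, k x y * ‖partialFourier f x ξ‖ₑ) ^ 2) := by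
        refine lintegral_mono_ae ?_
        filter_upwards [ae_enorm_ne_zero_and_ne_top] with y hy
        rw [enorm_rpow_eq_mul_inv hy m]
        calc _ ≤ _ := mul_le_mul_right (pow_le_pow_left' (hb y) 2) _
          _ = _ := by ring
    _ ≤ ENNReal.ofReal ((2 * π) ^ 2) ^ 2 * ((C1 + C2) ^ 2 *
          ∫⁻ x, ‖x‖ₑ ^ (max m 0) * (‖x‖ₑ ^ (max (-m) 0))⁻¹ * ‖partialFourier f x ξ‖ₑ ^ 2) := by
        rw [lintegral_const_mul' _ _ (by finiteness)]
        gcongr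
    _ = _ := by
        rw [mul_assoc]
        congr 2
        refine lintegral_congr_ae ?_
        filter_upwards [ae_enorm_ne_zero_and_ne_top] with y hy
        rw [enorm_rpow_eq_mul_inv hy m]

section Phase

variable {B : ℂ → ℂ → ℂ} {c m : ℝ} {f : ℂ × ℝ → ℂ}

theorem lintegral_partialFourier (hf : IsBoundedTest f) (m : ℝ) :
    ∫⁻ ξ, ∫⁻ x, ‖x‖ₑ ^ m * ‖partialFourier f x ξ‖ₑ ^ 2 =
      ∫⁻ p, ‖f p‖ₑ ^ 2 ∂(weightedVolume m) := by
  have hm := hf.measurable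
  have hm2 : Measurable fun p : ℝ × ℂ => partialFourier f p.2 p.1 :=
    (measurable_partialFourier hm).comp (f := fun p : ℝ × ℂ => (p.2, p.1)) (by fun_prop)
  have hm3 : ∀ x, Measurable fun ξ => partialFourier f x ξ := fun x =>
    hm2.comp (f := fun ξ : ℝ => (ξ, x)) (by fun_prop)
  have e : ∀ x, ∫⁻ ξ, ‖partialFourier f x ξ‖ₑ ^ 2 = ∫⁻ s, ‖f (x, s)‖ₑ ^ 2 := fun x =>
    lintegral_enorm_sq_fourier (hf.integrable_section x) (hf.memLp_section x 2)
  have hmeas : AEMeasurable (Function.uncurry fun (ξ : ℝ) (x : ℂ) =>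
      ‖x‖ₑ ^ m * ‖partialFourier f x ξ‖ₑ ^ 2) (volume.prod volume) := by
    refine Measurable.aemeasurable ?_
    unfold Function.uncurry
    exact (measurable_snd.enorm.pow_const m).mul (hm2.enorm.pow_const 2)
  rw [lintegral_lintegral_swap hmeas, lintegral_weightedVolume _ (hm.enorm.pow_const 2)]
  congr 1 with x
  rw [lintegral_const_mul _ ((hm3 x).enorm.pow_const 2), e x]

theorem measurable_denom (hB : IsGaussianPhase B c) (ε : ℝ) :
    Measurable fun z : (ℂ × ℝ) × (ℂ × ℝ) => denom B ε z.1 z.2 := by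
  have h : Measurable fun z : (ℂ × ℝ) × (ℂ × ℝ) => B z.2.1 z.1.1 :=
    hB.measurable.comp (f := fun z : (ℂ × ℝ) × (ℂ × ℝ) => (z.2.1, z.1.1)) (by fun_prop)
  unfold denom
  exact (h.add_const _).add (by fun_prop)

theorem measurable_kernelOp (hB : IsGaussianPhase B c) (ε : ℝ) (hf : Measurable f) :
    Measurable (kernelOp B ε f) := by
  apply measurable_integral_right
  have h := measurable_denom hB ε
  unfold Function.uncurry
  fun_prop

/-- The weighted energy of `fourierOp B f` at frequency `ξ`. -/
def fourierEnergy (B : ℂ → ℂ → ℂ) (m : ℝ) (f : ℂ × ℝ → ℂ) (ξ : ℝ) : ℝ≥0∞ :=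
  ∫⁻ y, ‖y‖ₑ ^ m * ‖fourierOp B f y ξ‖ₑ ^ 2

theorem measurable_fourierEnergy (hB : IsGaussianPhase B c) (hf : Measurable f) :
    Measurable (fourierEnergy B m f) := by
  refine Measurable.lintegral_prod_right' (f := fun p : ℝ × ℂ =>
    ‖p.2‖ₑ ^ m * ‖fourierOp B f p.2 p.1‖ₑ ^ 2) ?_
  have := (measurable_fourierOp hB hf).comp (measurable_swap (α := ℝ) (β := ℂ))
  simp only [Function.comp_def, Function.uncurry, Prod.fst_swap, Prod.snd_swap] at this
  fun_prop

theorem lintegral_weighted_fourierOp (hB : IsGaussianPhase B c) (hf : Measurable f)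
    {w : ℝ → ℝ≥0∞} (hw : Measurable w) :
    ∫⁻ y, ‖y‖ₑ ^ m * ∫⁻ ξ, w ξ * ‖fourierOp B f y ξ‖ₑ ^ 2 =
      ∫⁻ ξ, w ξ * fourierEnergy B m f ξ := by
  have h0 := measurable_fourierOp hB hf
  have h1 : Measurable fun p : ℂ × ℝ => fourierOp B f p.1 p.2 := h0
  have h2 : ∀ y, Measurable fun ξ => fourierOp B f y ξ := fun y =>
    h1.comp (f := fun ξ : ℝ => (y, ξ)) (by fun_prop)
  have h3 : ∀ ξ, Measurable fun y => fourierOp B f y ξ := fun ξ =>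
    h1.comp (f := fun y : ℂ => (y, ξ)) (by fun_prop)
  calc _ = ∫⁻ y, ∫⁻ ξ, ‖y‖ₑ ^ m * (w ξ * ‖fourierOp B f y ξ‖ₑ ^ 2) := by
        congr 1 with y
        have := h2 y
        rw [lintegral_const_mul _ (by fun_prop)]
    _ = ∫⁻ ξ, ∫⁻ y, ‖y‖ₑ ^ m * (w ξ * ‖fourierOp B f y ξ‖ₑ ^ 2) := by
        rw [lintegral_lintegral_swap]
        refine Measurable.aemeasurable ?_
        unfold Function.uncurry
        fun_prop
    _ = _ := by
        congr 1 with ξ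
        have := h3 ξ
        rw [fourierEnergy, ← lintegral_const_mul _ (by fun_prop)]
        congr 1 with y
        ring

theorem lintegral_kernelOp_weighted (hB : IsGaussianPhase B c) (hf : IsBoundedTest f)
    {ε : ℝ} (hε : 0 < ε) :
    ∫⁻ q, ‖kernelOp B ε f q‖ₑ ^ 2 ∂(weightedVolume m) =
      ∫⁻ ξ, ENNReal.ofReal (damping ε ξ) ^ 2 * fourierEnergy B m f ξ := by
  have h1 := measurable_kernelOp hB ε hf.measurable
  have h2 := measurable_damping ε
  rw [lintegral_weightedVolume _ (by fun_prop),
    ← lintegral_weighted_fourierOp hB hf.measurable (by fun_prop)]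
  simp_rw [lintegral_kernelOp_sq hB hf hε]

theorem lintegral_kernelOp_sub_weighted (hB : IsGaussianPhase B c) (hf : IsBoundedTest f)
    {ε ε' : ℝ} (hε : 0 < ε) (hε' : 0 < ε') :
    ∫⁻ q, ‖kernelOp B ε f q - kernelOp B ε' f q‖ₑ ^ 2 ∂(weightedVolume m) =
      ∫⁻ ξ, ‖damping ε ξ - damping ε' ξ‖ₑ ^ 2 * fourierEnergy B m f ξ := by
  have h1 := measurable_kernelOp hB ε hf.measurable
  have h1' := measurable_kernelOp hB ε' hf.measurable
  have h2 := measurable_damping ε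
  have h2' := measurable_damping ε'
  rw [lintegral_weightedVolume _ (by fun_prop),
    ← lintegral_weighted_fourierOp hB hf.measurable (by fun_prop)]
  simp_rw [lintegral_kernelOp_sub_sq hB hf hε hε']

/-- The `L²(|x|^m dx ds)` bound for `kernelOp` on test functions, uniform in `ε`. -/
theorem exists_kernelOp_bound_test {c m : ℝ} (hc : 0 < c) (h1 : -2 < m) (h2 : m < 2) :
    ∃ C : ℝ≥0∞, C ≠ ∞ ∧ ∀ B : ℂ → ℂ → ℂ, IsGaussianPhase B c →
      ∀ f : ℂ × ℝ → ℂ, IsBoundedTest f →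
        (∫⁻ ξ, fourierEnergy B m f ξ) ≤ C * ∫⁻ p, ‖f p‖ₑ ^ 2 ∂(weightedVolume m) ∧
        ∀ ε : ℝ, 0 < ε → ∫⁻ q, ‖kernelOp B ε f q‖ₑ ^ 2 ∂(weightedVolume m) ≤
          C * ∫⁻ p, ‖f p‖ₑ ^ 2 ∂(weightedVolume m) := by
  obtain ⟨C, hC, h⟩ := exists_lintegral_fourierOp_le hc h1 h2
  refine ⟨C, hC, fun B hB f hf => ?_⟩
  have key : (∫⁻ ξ, fourierEnergy B m f ξ) ≤ C * ∫⁻ p, ‖f p‖ₑ ^ 2 ∂(weightedVolume m) := by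
    rw [← lintegral_partialFourier hf, ← lintegral_const_mul' _ _ hC]
    exact lintegral_mono fun ξ => h B hB f hf.measurable ξ
  refine ⟨key, fun ε hε => ?_⟩
  rw [lintegral_kernelOp_weighted hB hf hε]
  refine (lintegral_mono fun ξ => ?_).trans key
  calc _ ≤ 1 * fourierEnergy B m f ξ := by
        gcongr
        refine pow_le_one' ?_ 2
        rw [← ENNReal.ofReal_one]
        exact ENNReal.ofReal_le_ofReal (damping_le_one hε.le ξ)
    _ = _ := one_mul _

/-- On test functions `kernelOp B ε` is Cauchy as `ε → 0+`. -/
theorem exists_kernelOp_cauchy_test (hB : IsGaussianPhase B c) (hf : IsBoundedTest f)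
    (hfin : (∫⁻ ξ, fourierEnergy B m f ξ) ≠ ∞) :
    ∃ h : ℝ → ℝ≥0∞, Tendsto h (𝓝[>] 0) (𝓝 0) ∧ ∀ ε ε' : ℝ, 0 < ε → 0 < ε' →
      ∫⁻ q, ‖kernelOp B ε f q - kernelOp B ε' f q‖ₑ ^ 2 ∂(weightedVolume m) ≤ h ε + h ε' := by
  have hE := measurable_fourierEnergy (m := m) hB hf.measurable
  refine ⟨fun ε => ∫⁻ ξ, 2 * ENNReal.ofReal (1 - damping ε ξ) ^ 2 * fourierEnergy B m f ξ, ?_,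
    fun ε ε' hε hε' => ?_⟩
  · have h0 : (0 : ℝ≥0∞) = ∫⁻ ξ : ℝ, (0 : ℝ≥0∞) := by simp
    rw [h0]
    refine tendsto_lintegral_filter_of_dominated_convergence
      (fun ξ => 2 * fourierEnergy B m f ξ) ?_ ?_ ?_ ?_
    · refine Eventually.of_forall fun ε => ?_
      have := measurable_damping ε
      fun_prop
    · filter_upwards [self_mem_nhdsWithin] with ε _
      refine ae_of_all _ fun ξ => ?_
      calc _ ≤ 2 * 1 * fourierEnergy B m f ξ := by
            gcongr
            refine pow_le_one' ?_ 2
            rw [← ENNReal.ofReal_one]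
            exact ENNReal.ofReal_le_ofReal (by linarith [damping_pos ε ξ])
        _ = _ := by rw [mul_one]
    · rw [lintegral_const_mul _ hE]
      finiteness
    · filter_upwards [ae_lt_top hE hfin] with ξ hξ
      have h1 : Tendsto (fun ε => 1 - damping ε ξ) (𝓝[>] 0) (𝓝 0) := by
        have : Continuous fun ε => 1 - damping ε ξ := by unfold damping; fun_prop
        have h := this.tendsto 0
        simp only [damping, mul_zero, zero_mul, neg_zero, Real.exp_zero, sub_self] at h
        exact h.mono_left nhdsWithin_le_nhds
      have h2 := ENNReal.tendsto_ofReal h1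
      have h3 := ((ENNReal.Tendsto.const_mul (a := 2) (ENNReal.Tendsto.pow (n := 2) h2) (Or.inr (by norm_num))))
      have h4 := ENNReal.Tendsto.mul_const h3 (Or.inr hξ.ne)
      simpa using h4
  · have := measurable_damping ε
    rw [lintegral_kernelOp_sub_weighted hB hf hε hε', ← lintegral_add_left (by fun_prop)]
    refine lintegral_mono fun ξ => ?_
    rw [← add_mul]
    gcongr
    have e : ∀ t : ℝ, 0 ≤ t → 2 * ENNReal.ofReal t ^ 2 = ENNReal.ofReal (2 * t ^ 2) := by
      intro t ht
      rw [ENNReal.ofReal_mul (by norm_num), ENNReal.ofReal_pow ht]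
      norm_num
    have d1 := damping_le_one hε.le ξ
    have d2 := damping_le_one hε'.le ξ
    rw [e _ (by linarith), e _ (by linarith), ← ENNReal.ofReal_add (by positivity) (by positivity),
      ← ofReal_norm, ← ENNReal.ofReal_pow (norm_nonneg _), Real.norm_eq_abs, sq_abs]
    apply ENNReal.ofReal_le_ofReal
    nlinarith [sq_nonneg ((1 - damping ε ξ) + (1 - damping ε' ξ))]

end Phase

end DualLeray
end

noncomputable section
namespace DualLeray
open scoped Real

theorem lintegral_inv_sq_sq_le {b : ℂ} {a : ℝ} (ha : 0 < a) (hb : a ≤ b.re) :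
    ∫⁻ s : ℝ, ‖1 / (b + Complex.I * (s : ℂ)) ^ 2‖ₑ ^ 2 ≤ ENNReal.ofReal (π * (a ^ 3)⁻¹) := by
  have hpos : ∀ s : ℝ, 0 < b.re ^ 2 + (b.im + s) ^ 2 := fun s => by
    have : 0 < b.re := ha.trans_le hb
    positivity
  have hb0 : 0 < b.re := ha.trans_le hb
  calc ∫⁻ s : ℝ, ‖1 / (b + Complex.I * (s : ℂ)) ^ 2‖ₑ ^ 2
      ≤ ∫⁻ s : ℝ, ENNReal.ofReal ((b.re ^ 2)⁻¹ * (1 / (b.re ^ 2 + (b.im + s) ^ 2))) := by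
        refine lintegral_mono fun s => ?_
        rw [← ofReal_norm, ← ENNReal.ofReal_pow (norm_nonneg _), norm_div, norm_sq_add_I_mul,
          norm_one, sq]
        apply ENNReal.ofReal_le_ofReal
        have := hpos s
        gcongr
        rw [one_div]
        gcongr
        nlinarith [sq_nonneg (b.im + s)]
    _ = ENNReal.ofReal ((b.re ^ 2)⁻¹ * (π / b.re)) := by
        rw [← ofReal_integral_eq_lintegral_ofReal ((integrable_inv_sq hb0 _).const_mul _),
          integral_const_mul, integral_inv_sq hb0]
        exact ae_of_all _ fun s => by have := hpos s; positivity
    _ ≤ _ := by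
        apply ENNReal.ofReal_le_ofReal
        have : (b.re ^ 2)⁻¹ * (π / b.re) = π * (b.re ^ 3)⁻¹ := by field_simp
        rw [this]
        gcongr

theorem lintegral_rpow_mul_inv_cube_lt_top {c ε k : ℝ} (hc : 0 < c) (hε : 0 < ε) (h1 : -2 < k)
    (h2 : k < 2) (y : ℂ) :
    ∫⁻ x : ℂ, ‖x‖ₑ ^ k * ENNReal.ofReal (π * ((c * ‖x - y‖ ^ 2 + ε) ^ 3)⁻¹) < ∞ := by
  set K : ℝ := 2 * (1 + ‖y‖) ^ 2 / ε + 2 / c with hK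
  have hKpos : 0 < K := by positivity
  have pt : ∀ x : ℂ, x ≠ 0 → ‖x‖ ^ k * (π * ((c * ‖x - y‖ ^ 2 + ε) ^ 3)⁻¹) ≤
      π * (ε ^ 3)⁻¹ * Real.exp 1 * (‖x‖ ^ k * Real.exp (-1 * ‖x‖ ^ 2)) +
        π * K ^ 3 * (1 + ‖x‖) ^ (-(4 : ℝ)) := by
    intro x hx
    have hx' : 0 < ‖x‖ := norm_pos_iff.2 hx
    rcases le_total ‖x‖ 1 with h | h
    · have e1 : (1 : ℝ) ≤ Real.exp 1 * Real.exp (-1 * ‖x‖ ^ 2) := by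
        rw [← Real.exp_add]
        apply Real.one_le_exp
        nlinarith
      have e2 : ((c * ‖x - y‖ ^ 2 + ε) ^ 3)⁻¹ ≤ (ε ^ 3)⁻¹ := by
        gcongr
        have : 0 ≤ c * ‖x - y‖ ^ 2 := by positivity
        linarith
      calc ‖x‖ ^ k * (π * ((c * ‖x - y‖ ^ 2 + ε) ^ 3)⁻¹) ≤ ‖x‖ ^ k * (π * (ε ^ 3)⁻¹) * 1 := by
            rw [mul_one]; gcongr
        _ ≤ ‖x‖ ^ k * (π * (ε ^ 3)⁻¹) * (Real.exp 1 * Real.exp (-1 * ‖x‖ ^ 2)) := by gcongr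
        _ = π * (ε ^ 3)⁻¹ * Real.exp 1 * (‖x‖ ^ k * Real.exp (-1 * ‖x‖ ^ 2)) := by ring
        _ ≤ _ := le_add_of_nonneg_right (by positivity)
    · have e1 : ‖x‖ ^ k ≤ (1 + ‖x‖) ^ 2 := by
        calc ‖x‖ ^ k ≤ ‖x‖ ^ (2 : ℝ) := Real.rpow_le_rpow_of_exponent_le h h2.le
          _ = ‖x‖ ^ 2 := Real.rpow_two _
          _ ≤ _ := by gcongr; linarith
      have e2 : (1 + ‖x‖) ^ 2 ≤ K * (c * ‖x - y‖ ^ 2 + ε) := by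
        have h3 : ‖x‖ ≤ ‖y‖ + ‖x - y‖ := by
          have := norm_add_le y (x - y)
          rwa [add_sub_cancel] at this
        have h4 : (1 + ‖x‖) ^ 2 ≤ 2 * (1 + ‖y‖) ^ 2 + 2 * ‖x - y‖ ^ 2 := by
          calc (1 + ‖x‖) ^ 2 ≤ ((1 + ‖y‖) + ‖x - y‖) ^ 2 :=
              pow_le_pow_left₀ (by positivity) (by linarith) 2
            _ ≤ _ := by nlinarith [sq_nonneg ((1 + ‖y‖) - ‖x - y‖)]
        have h5 : K * (c * ‖x - y‖ ^ 2 + ε) = 2 * (1 + ‖y‖) ^ 2 + 2 * ‖x - y‖ ^ 2 +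
            (2 * (1 + ‖y‖) ^ 2 / ε * (c * ‖x - y‖ ^ 2) + 2 / c * ε) := by
          rw [hK]; field_simp; ring
        have h6 : 0 ≤ 2 * (1 + ‖y‖) ^ 2 / ε * (c * ‖x - y‖ ^ 2) + 2 / c * ε := by positivity
        linarith
      have hD : 0 < c * ‖x - y‖ ^ 2 + ε := by positivity
      have hx1 : 0 < 1 + ‖x‖ := by positivity
      have e3 : ((c * ‖x - y‖ ^ 2 + ε) ^ 3)⁻¹ ≤ K ^ 3 * ((1 + ‖x‖) ^ 6)⁻¹ := by
        rw [← div_eq_mul_inv, inv_eq_one_div, div_le_div_iff₀ (by positivity) (by positivity),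
          one_mul, ← mul_pow]
        calc (1 + ‖x‖) ^ 6 = ((1 + ‖x‖) ^ 2) ^ 3 := by ring
          _ ≤ _ := by gcongr
      have e4 : (1 + ‖x‖) ^ (-(4 : ℝ)) = (1 + ‖x‖) ^ 2 * ((1 + ‖x‖) ^ 6)⁻¹ := by
        rw [Real.rpow_neg hx1.le]
        norm_cast
        field_simp
      calc ‖x‖ ^ k * (π * ((c * ‖x - y‖ ^ 2 + ε) ^ 3)⁻¹)
          ≤ (1 + ‖x‖) ^ 2 * (π * (K ^ 3 * ((1 + ‖x‖) ^ 6)⁻¹)) := by gcongr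
        _ = π * K ^ 3 * (1 + ‖x‖) ^ (-(4 : ℝ)) := by rw [e4]; ring
        _ ≤ _ := le_add_of_nonneg_left (by positivity)
  calc ∫⁻ x : ℂ, ‖x‖ₑ ^ k * ENNReal.ofReal (π * ((c * ‖x - y‖ ^ 2 + ε) ^ 3)⁻¹)
      ≤ ∫⁻ x : ℂ, (ENNReal.ofReal (π * (ε ^ 3)⁻¹ * Real.exp 1) *
          ENNReal.ofReal (‖x‖ ^ k * Real.exp (-1 * ‖x‖ ^ 2)) +
          ENNReal.ofReal (π * K ^ 3) * ENNReal.ofReal ((1 + ‖x‖) ^ (-(4 : ℝ)))) := by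
        refine lintegral_mono_ae ?_
        filter_upwards [Measure.ae_ne volume (0 : ℂ)] with x hx
        have hx' : 0 < ‖x‖ := norm_pos_iff.2 hx
        rw [← ofReal_norm, ENNReal.ofReal_rpow_of_pos hx', ← ENNReal.ofReal_mul (by positivity),
          ← ENNReal.ofReal_mul (by positivity), ← ENNReal.ofReal_mul (by positivity),
          ← ENNReal.ofReal_add (by positivity) (by positivity)]
        exact ENNReal.ofReal_le_ofReal (pt x hx)
    _ < ∞ := by
        rw [lintegral_add_left (by fun_prop), lintegral_const_mul _ (by fun_prop),
          lintegral_const_mul _ (by fun_prop), lintegral_norm_rpow_mul_exp h1 one_pos]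
        have := finite_integral_one_add_norm (E := ℂ) (μ := volume) (r := 4)
          (by rw [Complex.finrank_real_complex]; norm_num)
        exact ENNReal.add_lt_top.2 ⟨by finiteness, ENNReal.mul_lt_top (by finiteness) this⟩

section Phase

variable {B : ℂ → ℂ → ℂ} {c m ε : ℝ} {f : ℂ × ℝ → ℂ}

theorem le_re_denom (hB : IsGaussianPhase B c) (ε : ℝ) (q p : ℂ × ℝ) :
    c * ‖p.1 - q.1‖ ^ 2 + ε ≤ (denom B ε q p).re := by
  have := hB.le_re p.1 q.1
  simp [denom]
  linarith

theorem lintegral_inv_denom_sq_left (hB : IsGaussianPhase B c) (hε : 0 < ε) (q : ℂ × ℝ) (x : ℂ) :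
    ∫⁻ s : ℝ, ‖1 / denom B ε q (x, s) ^ 2‖ₑ ^ 2 ≤
      ENNReal.ofReal (π * ((c * ‖x - q.1‖ ^ 2 + ε) ^ 3)⁻¹) := by
  have hc := hB.pos
  have h := lintegral_inv_sq_sq_le (b := B x q.1 + ε) (a := c * ‖x - q.1‖ ^ 2 + ε)
    (by positivity) (by simpa using hB.le_re x q.1)
  rw [← lintegral_sub_right_eq_self _ q.2] at h
  refine (le_of_eq ?_).trans h
  simp [denom]

theorem lintegral_inv_denom_sq_right (hB : IsGaussianPhase B c) (hε : 0 < ε) (p : ℂ × ℝ) (y : ℂ) :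
    ∫⁻ t : ℝ, ‖1 / denom B ε (y, t) p ^ 2‖ₑ ^ 2 ≤
      ENNReal.ofReal (π * ((c * ‖y - p.1‖ ^ 2 + ε) ^ 3)⁻¹) := by
  have hc := hB.pos
  rw [norm_sub_rev]
  have h := lintegral_inv_sq_sq_le (b := B p.1 y + ε) (a := c * ‖p.1 - y‖ ^ 2 + ε)
    (by positivity) (by simpa using hB.le_re p.1 y)
  rw [← lintegral_sub_left_eq_self _ p.2] at h
  refine (le_of_eq ?_).trans h
  simp [denom]

theorem measurable_inv_denom_sq (hB : IsGaussianPhase B c) (ε : ℝ) :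
    Measurable fun z : (ℂ × ℝ) × (ℂ × ℝ) => 1 / denom B ε z.1 z.2 ^ 2 :=
  measurable_const.div ((measurable_denom hB ε).pow_const 2)

theorem measurable_inv_denom_sq_left (hB : IsGaussianPhase B c) (ε : ℝ) (q : ℂ × ℝ) :
    Measurable fun p => 1 / denom B ε q p ^ 2 :=
  (measurable_inv_denom_sq hB ε).comp (f := fun p => (q, p)) (by fun_prop)

theorem measurable_inv_denom_sq_right (hB : IsGaussianPhase B c) (ε : ℝ) (p : ℂ × ℝ) :
    Measurable fun q => 1 / denom B ε q p ^ 2 :=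
  (measurable_inv_denom_sq hB ε).comp (f := fun q => (q, p)) (by fun_prop)

theorem lintegral_kernel_sq_weighted_lt_top (hB : IsGaussianPhase B c) (hε : 0 < ε) {k : ℝ}
    (h1 : -2 < k) (h2 : k < 2) (q : ℂ × ℝ) :
    ∫⁻ p, ‖1 / denom B ε q p ^ 2‖ₑ ^ 2 ∂(weightedVolume k) < ∞ := by
  rw [lintegral_weightedVolume _ ((measurable_inv_denom_sq_left hB ε q).enorm.pow_const 2)]
  refine (lintegral_mono fun x => ?_).trans_lt
    (lintegral_rpow_mul_inv_cube_lt_top hB.pos hε h1 h2 q.1)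
  exact mul_le_mul_right (lintegral_inv_denom_sq_left hB hε q x) _

/-- The kernels are square integrable in each variable, uniformly in the other one. -/
theorem exists_lintegral_kernel_sq_le (hB : IsGaussianPhase B c) (hε : 0 < ε) :
    ∃ K : ℝ≥0∞, K ≠ ∞ ∧ (∀ q, ∫⁻ p, ‖1 / denom B ε q p ^ 2‖ₑ ^ 2 ≤ K) ∧
      ∀ p, ∫⁻ q, ‖1 / denom B ε q p ^ 2‖ₑ ^ 2 ≤ K := by
  have h0 := lintegral_rpow_mul_inv_cube_lt_top hB.pos hε (k := 0) (by norm_num) (by norm_num) 0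
  simp only [ENNReal.rpow_zero, one_mul, sub_zero] at h0
  refine ⟨_, h0.ne, fun q => ?_, fun p => ?_⟩
  · rw [Measure.volume_eq_prod, lintegral_prod _
      ((measurable_inv_denom_sq_left hB ε q).enorm.pow_const 2).aemeasurable]
    refine (lintegral_mono fun x => lintegral_inv_denom_sq_left hB hε q x).trans (le_of_eq ?_)
    exact lintegral_sub_right_eq_self
      (fun x : ℂ => ENNReal.ofReal (π * ((c * ‖x‖ ^ 2 + ε) ^ 3)⁻¹)) q.1
  · rw [Measure.volume_eq_prod, lintegral_prod _
      ((measurable_inv_denom_sq_right hB ε p).enorm.pow_const 2).aemeasurable]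
    refine (lintegral_mono fun x => lintegral_inv_denom_sq_right hB hε p x).trans (le_of_eq ?_)
    exact lintegral_sub_right_eq_self
      (fun x : ℂ => ENNReal.ofReal (π * ((c * ‖x‖ ^ 2 + ε) ^ 3)⁻¹)) p.1

theorem ae_fst_ne_zero : ∀ᵐ p : ℂ × ℝ, p.1 ≠ 0 := by
  rw [Measure.volume_eq_prod]
  exact Measure.quasiMeasurePreserving_fst.ae (Measure.ae_ne volume (0 : ℂ))

theorem lintegral_weightedVolume' (m : ℝ) {F : ℂ × ℝ → ℝ≥0∞} (hF : Measurable F) :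
    ∫⁻ p, F p ∂(weightedVolume m) = ∫⁻ p : ℂ × ℝ, ‖p.1‖ₑ ^ m * F p := by
  rw [weightedVolume, lintegral_withDensity_eq_lintegral_mul _ (by fun_prop) hF]
  rfl

theorem lintegral_mul_sq_le_weighted (m : ℝ) {F G : ℂ × ℝ → ℝ≥0∞} (hF : Measurable F)
    (hG : Measurable G) : (∫⁻ p, F p * G p) ^ 2 ≤
      (∫⁻ p, F p ^ 2 ∂(weightedVolume m)) * ∫⁻ p, G p ^ 2 ∂(weightedVolume (-m)) := by
  have e : ∫⁻ p, F p * G p =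
      ∫⁻ p : ℂ × ℝ, (‖p.1‖ₑ ^ (m / 2) * F p) * (‖p.1‖ₑ ^ (-m / 2) * G p) := by
    refine lintegral_congr_ae ?_
    filter_upwards [ae_fst_ne_zero] with p hp
    have h1 : ‖p.1‖ₑ ^ (m / 2) * ‖p.1‖ₑ ^ (-m / 2) = 1 := by
      rw [← ENNReal.rpow_add _ _ (by simpa using hp) enorm_ne_top]
      ring_nf
      simp
    calc F p * G p = (‖p.1‖ₑ ^ (m / 2) * ‖p.1‖ₑ ^ (-m / 2)) * (F p * G p) := by rw [h1, one_mul]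
      _ = _ := by ring
  have h2 : ∀ (a : ℝ≥0∞) (k : ℝ), (a ^ (k / 2)) ^ 2 = a ^ k := fun a k => by
    rw [← ENNReal.rpow_natCast, ← ENNReal.rpow_mul]; norm_num
  rw [e, lintegral_weightedVolume' _ (hF.pow_const 2), lintegral_weightedVolume' _
    (hG.pow_const 2)]
  refine (lintegral_mul_sq_le (by fun_prop) (by fun_prop)).trans (le_of_eq ?_)
  simp_rw [mul_pow, h2]

theorem integrable_div_denom_sq (hB : IsGaussianPhase B c) (hε : 0 < ε) (h1 : -2 < m) (h2 : m < 2)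
    (hf : Measurable f) (hfin : ∫⁻ p, ‖f p‖ₑ ^ 2 ∂(weightedVolume m) < ∞) (q : ℂ × ℝ) :
    Integrable fun p => f p / denom B ε q p ^ 2 := by
  have hk := measurable_inv_denom_sq_left hB ε q
  have e : (fun p => f p / denom B ε q p ^ 2) = fun p => f p * (1 / denom B ε q p ^ 2) := by
    ext p; rw [mul_one_div]
  rw [e]
  refine ⟨(hf.mul hk).aestronglyMeasurable, ?_⟩
  rw [hasFiniteIntegral_iff_enorm]
  simp_rw [enorm_mul]
  have h := (lintegral_mul_sq_le_weighted m hf.enorm hk.enorm).trans_lt (ENNReal.mul_lt_top hfin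
    (lintegral_kernel_sq_weighted_lt_top hB hε (by linarith) (by linarith) q))
  by_contra hn
  rw [not_lt, top_le_iff] at hn
  rw [hn] at h
  simp at h

open Classical in
/-- Truncation to a bounded function with bounded support. -/
def truncate (f : ℂ × ℝ → ℂ) (n : ℕ) (p : ℂ × ℝ) : ℂ := if ‖f p‖ ≤ n ∧ ‖p‖ ≤ n then f p else 0

theorem isBoundedTest_truncate (hf : Measurable f) (n : ℕ) : IsBoundedTest (truncate f n) := by
  refine ⟨?_, n, fun p => ?_, fun p hp => ?_⟩
  · refine Measurable.ite ?_ hf measurable_const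
    exact (measurableSet_le hf.norm measurable_const).inter
      (measurableSet_le measurable_norm measurable_const)
  · unfold truncate
    split_ifs with h
    · exact h.1
    · simp
  · unfold truncate
    rw [if_neg]
    rintro ⟨_, h⟩
    linarith

theorem norm_truncate_le (f : ℂ × ℝ → ℂ) (n : ℕ) (p : ℂ × ℝ) : ‖truncate f n p‖ ≤ ‖f p‖ := by
  unfold truncate
  split_ifs <;> simp

theorem truncate_eventually_eq (f : ℂ × ℝ → ℂ) (p : ℂ × ℝ) :
    ∀ᶠ n in atTop, truncate f n p = f p := by
  obtain ⟨N, hN⟩ := exists_nat_ge (max ‖f p‖ ‖p‖)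
  filter_upwards [eventually_ge_atTop N] with n hn
  have h : max ‖f p‖ ‖p‖ ≤ n := hN.trans (by exact_mod_cast hn)
  rw [truncate, if_pos ⟨(le_max_left _ _).trans h, (le_max_right _ _).trans h⟩]

theorem tendsto_kernelOp_truncate (hB : IsGaussianPhase B c) (hε : 0 < ε) (h1 : -2 < m)
    (h2 : m < 2) (hf : Measurable f) (hfin : ∫⁻ p, ‖f p‖ₑ ^ 2 ∂(weightedVolume m) < ∞)
    (q : ℂ × ℝ) :
    Tendsto (fun n => kernelOp B ε (truncate f n) q) atTop (𝓝 (kernelOp B ε f q)) := by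
  have hi := integrable_div_denom_sq hB hε h1 h2 hf hfin q
  refine tendsto_integral_of_dominated_convergence _ (fun n => ?_) hi.norm
    (fun n => ae_of_all _ fun p => ?_) (ae_of_all _ fun p => ?_)
  · have hk := measurable_inv_denom_sq_left hB ε q
    have := ((isBoundedTest_truncate hf n).measurable.mul hk).aestronglyMeasurable
      (μ := volume)
    refine this.congr (ae_of_all _ fun p => ?_)
    simp [div_eq_mul_inv]
  · rw [norm_div, norm_div]
    gcongr
    exact norm_truncate_le f n p
  · refine tendsto_nhds_of_eventually_eq ?_
    filter_upwards [truncate_eventually_eq f p] with n hn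
    rw [hn]

/-- The `L²(|x|^m dx ds)` bound for `kernelOp`, uniform in `ε`. -/
theorem exists_kernelOp_bound {c m : ℝ} (hc : 0 < c) (h1 : -2 < m) (h2 : m < 2) :
    ∃ C : ℝ≥0∞, C ≠ ∞ ∧ ∀ B : ℂ → ℂ → ℂ, IsGaussianPhase B c →
      ∀ f : ℂ × ℝ → ℂ, Measurable f → ∫⁻ p, ‖f p‖ₑ ^ 2 ∂(weightedVolume m) < ∞ →
        ∀ ε : ℝ, 0 < ε → ∫⁻ q, ‖kernelOp B ε f q‖ₑ ^ 2 ∂(weightedVolume m) ≤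
          C * ∫⁻ p, ‖f p‖ₑ ^ 2 ∂(weightedVolume m) := by
  obtain ⟨C, hC, h⟩ := exists_kernelOp_bound_test hc h1 h2
  refine ⟨C, hC, fun B hB f hf hfin ε hε => ?_⟩
  have hm : ∀ n, Measurable fun q => ‖kernelOp B ε (truncate f n) q‖ₑ ^ 2 := fun n =>
    (measurable_kernelOp hB ε (isBoundedTest_truncate hf n).measurable).enorm.pow_const 2
  have e : ∀ q, ‖kernelOp B ε f q‖ₑ ^ 2 =
      liminf (fun n => ‖kernelOp B ε (truncate f n) q‖ₑ ^ 2) atTop := by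
    intro q
    have h3 := tendsto_kernelOp_truncate hB hε h1 h2 hf hfin q
    exact (ENNReal.Tendsto.pow (n := 2) h3.enorm).liminf_eq.symm
  calc ∫⁻ q, ‖kernelOp B ε f q‖ₑ ^ 2 ∂(weightedVolume m)
      = ∫⁻ q, liminf (fun n => ‖kernelOp B ε (truncate f n) q‖ₑ ^ 2) atTop
          ∂(weightedVolume m) := by simp_rw [e]
    _ ≤ liminf (fun n => ∫⁻ q, ‖kernelOp B ε (truncate f n) q‖ₑ ^ 2 ∂(weightedVolume m)) atTop :=
        lintegral_liminf_le hm
    _ ≤ liminf (fun _ : ℕ => C * ∫⁻ p, ‖f p‖ₑ ^ 2 ∂(weightedVolume m)) atTop := by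
        refine liminf_le_liminf (Eventually.of_forall fun n => ?_)
        refine ((h B hB _ (isBoundedTest_truncate hf n)).2 ε hε).trans ?_
        gcongr with p
        rw [← ofReal_norm, ← ofReal_norm]
        exact ENNReal.ofReal_le_ofReal (norm_truncate_le f n p)
    _ = _ := liminf_const _

theorem tendsto_truncate (m : ℝ) (hf : Measurable f)
    (hfin : ∫⁻ p, ‖f p‖ₑ ^ 2 ∂(weightedVolume m) < ∞) :
    Tendsto (fun n => ∫⁻ p, ‖f p - truncate f n p‖ₑ ^ 2 ∂(weightedVolume m)) atTop (𝓝 0) := by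
  have h0 : (0 : ℝ≥0∞) = ∫⁻ p, 0 ∂(weightedVolume m) := by simp
  rw [h0]
  refine tendsto_lintegral_of_dominated_convergence (fun p => ‖f p‖ₑ ^ 2) (fun n => ?_)
    (fun n => ae_of_all _ fun p => ?_) hfin.ne (ae_of_all _ fun p => ?_)
  · exact (hf.sub (isBoundedTest_truncate hf n).measurable).enorm.pow_const 2
  · change ‖f p - truncate f n p‖ₑ ^ 2 ≤ ‖f p‖ₑ ^ 2
    unfold truncate
    split_ifs <;> simp
  · refine tendsto_nhds_of_eventually_eq ?_
    filter_upwards [truncate_eventually_eq f p] with n hn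
    simp [hn]

end Phase

end DualLeray
end

noncomputable section
namespace DualLeray

section Abstract

variable {E : Type*} [NormedAddCommGroup E] [NormedSpace ℂ E]

/-- A uniformly bounded family of operators that is Cauchy on a dense set converges strongly. -/
theorem exists_strong_limit [CompleteSpace E] (S : ℝ → E →L[ℂ] E) {C : ℝ} (hC : ∀ ε, 0 < ε → ‖S ε‖ ≤ C) {D : Set E}
    (hD : Dense D) (hS : ∀ f ∈ D, ∃ h : ℝ → ℝ≥0∞, Tendsto h (𝓝[>] 0) (𝓝 0) ∧
      ∀ ε ε' : ℝ, 0 < ε → 0 < ε' → ‖S ε f - S ε' f‖ₑ ^ 2 ≤ h ε + h ε') :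
    ∃ T : E →L[ℂ] E, ∀ f, Tendsto (fun ε => S ε f) (𝓝[>] 0) (𝓝 (T f)) := by
  have hC0 : 0 ≤ C := (norm_nonneg _).trans (hC 1 one_pos)
  have hcauchyD : ∀ f ∈ D, ∀ η : ℝ, 0 < η → ∃ A ∈ 𝓝[>] (0 : ℝ), ∀ ε ∈ A, ∀ ε' ∈ A,
      ‖S ε f - S ε' f‖ < η := by
    intro f hf η hη
    obtain ⟨h, h0, hh⟩ := hS f hf
    have hδ : (0 : ℝ≥0∞) < ENNReal.ofReal (η ^ 2 / 2) := ENNReal.ofReal_pos.2 (by positivity)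
    have hA : {ε | h ε < ENNReal.ofReal (η ^ 2 / 2)} ∩ Ioi 0 ∈ 𝓝[>] (0 : ℝ) :=
      inter_mem (h0.eventually (gt_mem_nhds hδ)) self_mem_nhdsWithin
    refine ⟨_, hA, fun ε hε ε' hε' => ?_⟩
    have h1 := (hh ε ε' hε.2 hε'.2).trans_lt (ENNReal.add_lt_add hε.1 hε'.1)
    rw [← ENNReal.ofReal_add (by positivity) (by positivity), ← ofReal_norm,
      ← ENNReal.ofReal_pow (norm_nonneg _), ENNReal.ofReal_lt_ofReal_iff (by positivity)] at h1
    exact lt_of_pow_lt_pow_left₀ 2 hη.le (by linarith)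
  have hcauchy : ∀ f, ∀ η : ℝ, 0 < η → ∃ A ∈ 𝓝[>] (0 : ℝ), ∀ ε ∈ A, ∀ ε' ∈ A,
      ‖S ε f - S ε' f‖ < η := by
    intro f η hη
    obtain ⟨g, hg, hfg⟩ := Metric.dense_iff.1 hD f (η / (3 * (C + 1))) (by positivity)
    obtain ⟨A, hA, hA'⟩ := hcauchyD g hfg (η / 3) (by positivity)
    refine ⟨A ∩ Ioi 0, inter_mem hA self_mem_nhdsWithin, fun ε hε ε' hε' => ?_⟩
    have h1 : ∀ δ : ℝ, 0 < δ → ‖S δ (f - g)‖ ≤ η / 3 := by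
      intro δ hδ
      have h2 : ‖f - g‖ ≤ η / (3 * (C + 1)) := by
        rw [← dist_eq_norm, dist_comm]
        exact (Metric.mem_ball.1 hg).le
      calc ‖S δ (f - g)‖ ≤ C * ‖f - g‖ := (S δ).le_of_opNorm_le (hC δ hδ) _
        _ ≤ (C + 1) * (η / (3 * (C + 1))) := by gcongr; linarith
        _ = η / 3 := by field_simp
    have e : S ε f - S ε' f = S ε (f - g) + (S ε g - S ε' g) - S ε' (f - g) := by
      simp only [map_sub]; abel
    have h3 := h1 ε hε.2
    have h4 := h1 ε' hε'.2
    have h5 := hA' ε hε.1 ε' hε'.1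
    calc ‖S ε f - S ε' f‖ ≤ ‖S ε (f - g)‖ + ‖S ε g - S ε' g‖ + ‖S ε' (f - g)‖ := by
          rw [e]
          exact (norm_sub_le _ _).trans (by gcongr; exact norm_add_le _ _)
      _ < η := by linarith
  have hlim : ∀ f, ∃ F, Tendsto (fun ε => S ε f) (𝓝[>] 0) (𝓝 F) := by
    intro f
    apply CompleteSpace.complete
    rw [Metric.cauchy_iff]
    refine ⟨inferInstance, fun η hη => ?_⟩
    obtain ⟨A, hA, hA'⟩ := hcauchy f η hη
    refine ⟨_, image_mem_map hA, ?_⟩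
    rintro _ ⟨ε, hε, rfl⟩ _ ⟨ε', hε', rfl⟩
    rw [dist_eq_norm]
    exact hA' ε hε ε' hε'
  choose T hT using hlim
  refine ⟨LinearMap.mkContinuous
    { toFun := T
      map_add' := fun f g => tendsto_nhds_unique (hT (f + g)) (by
        simpa only [map_add] using (hT f).add (hT g))
      map_smul' := fun a f => tendsto_nhds_unique (hT (a • f)) (by
        simpa only [map_smul, RingHom.id_apply] using (hT f).const_smul a) } C fun f => ?_, hT⟩
  refine le_of_tendsto (hT f).norm ?_
  filter_upwards [self_mem_nhdsWithin] with ε hε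
  exact (S ε).le_of_opNorm_le (hC ε hε) f

/-- The strong limit of a semigroup as `ε → 0+` is a projection. -/
theorem comp_self_of_strong_limit {S : ℝ → E →L[ℂ] E} {D : Set E} (hD : Dense D)
    (hS : ∀ f ∈ D, ∀ ε ε' : ℝ, 0 < ε → 0 < ε' → S ε' (S ε f) = S (ε' + ε) f) {T : E →L[ℂ] E}
    (hT : ∀ f, Tendsto (fun ε => S ε f) (𝓝[>] 0) (𝓝 (T f))) : T ∘L T = T := by
  have key : ∀ f ∈ D, T (T f) = T f := by
    intro f hf
    have h1 : Tendsto (fun ε => T (S ε f)) (𝓝[>] 0) (𝓝 (T (T f))) :=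
      (T.continuous.tendsto _).comp (hT f)
    refine tendsto_nhds_unique h1 ?_
    rw [Metric.tendsto_nhdsWithin_nhds]
    intro η hη
    obtain ⟨δ, hδ, h2⟩ := Metric.tendsto_nhdsWithin_nhds.1 (hT f) (η / 2) (by positivity)
    refine ⟨δ / 2, by positivity, fun {ε} hε hd => ?_⟩
    have hε0 : (0 : ℝ) < ε := hε
    rw [dist_zero_right, Real.norm_of_nonneg hε0.le] at hd
    have h3 : dist (T (S ε f)) (T f) ≤ η / 2 := by
      refine le_of_tendsto ((hT (S ε f)).dist tendsto_const_nhds) ?_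
      have : Ioo (0 : ℝ) (δ / 2) ∈ 𝓝[>] (0 : ℝ) := Ioo_mem_nhdsGT (by positivity)
      filter_upwards [this] with ε' hε'
      rw [hS f hf ε ε' hε0 hε'.1]
      refine (h2 (x := ε' + ε) (add_pos hε'.1 hε0) ?_).le
      rw [dist_zero_right, Real.norm_of_nonneg (by linarith [hε'.1])]
      linarith [hε'.2]
    linarith
  ext1 f
  exact congrFun (Continuous.ext_on hD (T.continuous.comp T.continuous) T.continuous key) f

end Abstract

section Function

variable {Y : Type*} [MeasurableSpace Y] {μ : Measure Y}

theorem enorm_sub_toLp {f g : Y → ℂ} (hf : MemLp f 2 μ) (hg : MemLp g 2 μ) :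
    ‖hf.toLp f - hg.toLp g‖ₑ ^ 2 = ∫⁻ y, ‖f y - g y‖ₑ ^ 2 ∂μ := by
  rw [← MemLp.toLp_sub, Lp.enorm_toLp, eLpNorm_two_sq]
  rfl

/-- A family of linear operators on functions that is uniformly bounded in `L²`, and Cauchy on
sufficiently many functions, converges strongly in `L²`; if it is a semigroup there, the limit is
a projection. -/
theorem exists_lp_strong_limit (S : ℝ → (Y → ℂ) → Y → ℂ) {C : ℝ≥0∞} (hC : C ≠ ∞)
    (hcongr : ∀ ε, 0 < ε → ∀ f g, f =ᵐ[μ] g → S ε f = S ε g)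
    (hadd : ∀ ε, 0 < ε → ∀ f g, Measurable f → Measurable g → MemLp f 2 μ → MemLp g 2 μ →
      S ε (f + g) = S ε f + S ε g)
    (hsmul : ∀ ε, 0 < ε → ∀ (a : ℂ) f, S ε (a • f) = a • S ε f)
    (hmeas : ∀ ε, 0 < ε → ∀ f, Measurable f → Measurable (S ε f))
    (hbound : ∀ ε, 0 < ε → ∀ f, Measurable f → MemLp f 2 μ →
      ∫⁻ y, ‖S ε f y‖ₑ ^ 2 ∂μ ≤ C * ∫⁻ y, ‖f y‖ₑ ^ 2 ∂μ)
    (D : Set (Y → ℂ)) (hDm : ∀ g ∈ D, Measurable g ∧ MemLp g 2 μ)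
    (hD : ∀ f, Measurable f → MemLp f 2 μ → ∃ g : ℕ → Y → ℂ, (∀ n, g n ∈ D) ∧
      Tendsto (fun n => ∫⁻ y, ‖f y - g n y‖ₑ ^ 2 ∂μ) atTop (𝓝 0))
    (hcauchy : ∀ g ∈ D, ∃ h : ℝ → ℝ≥0∞, Tendsto h (𝓝[>] 0) (𝓝 0) ∧
      ∀ ε ε' : ℝ, 0 < ε → 0 < ε' → ∫⁻ y, ‖S ε g y - S ε' g y‖ₑ ^ 2 ∂μ ≤ h ε + h ε')
    (hsemi : ∀ g ∈ D, ∀ ε ε' : ℝ, 0 < ε → 0 < ε' → S ε' (S ε g) = S (ε' + ε) g) :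
    ∃ T : Lp ℂ 2 μ →L[ℂ] Lp ℂ 2 μ, (∀ f : Lp ℂ 2 μ,
      Tendsto (fun ε => eLpNorm (fun y => S ε f y - T f y) 2 μ) (𝓝[>] 0) (𝓝 0)) ∧
      T ∘L T = T := by
  have hmem : ∀ ε, 0 < ε → ∀ f, Measurable f → MemLp f 2 μ → MemLp (S ε f) 2 μ := by
    intro ε hε f hf hf2
    refine ⟨(hmeas ε hε f hf).aestronglyMeasurable, ?_⟩
    have h1 := hbound ε hε f hf hf2
    rw [← eLpNorm_two_sq, ← eLpNorm_two_sq] at h1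
    have h2 := h1.trans_lt (ENNReal.mul_lt_top hC.lt_top (ENNReal.pow_lt_top hf2.2))
    by_contra hn
    rw [not_lt, top_le_iff] at hn
    simp [hn] at h2
  have hLm : ∀ f : Lp ℂ 2 μ, Measurable f := fun f => (Lp.stronglyMeasurable f).measurable
  have hLmem : ∀ ε, 0 < ε → ∀ f : Lp ℂ 2 μ, MemLp (S ε f) 2 μ := fun ε hε f =>
    hmem ε hε f (hLm f) (Lp.memLp f)
  have hop : ∀ ε : ℝ, ∃ Sε : Lp ℂ 2 μ →L[ℂ] Lp ℂ 2 μ, 0 < ε →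
      ‖Sε‖ ≤ C.toReal ^ (1 / 2 : ℝ) ∧ ∀ f : Lp ℂ 2 μ, Sε f =ᵐ[μ] S ε f := by
    intro ε
    by_cases hε : 0 < ε
    · let L : Lp ℂ 2 μ →ₗ[ℂ] Lp ℂ 2 μ :=
        { toFun := fun f => (hLmem ε hε f).toLp _
          map_add' := fun f g => by
            rw [← MemLp.toLp_add, MemLp.toLp_eq_toLp_iff, hcongr ε hε _ _ (Lp.coeFn_add f g),
              hadd ε hε _ _ (hLm f) (hLm g) (Lp.memLp f) (Lp.memLp g)]
          map_smul' := fun a f => by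
            rw [RingHom.id_apply, ← MemLp.toLp_const_smul, MemLp.toLp_eq_toLp_iff,
              hcongr ε hε _ _ (Lp.coeFn_smul a f), hsmul ε hε] }
      have hL : ∀ f, ‖L f‖ ≤ C.toReal ^ (1 / 2 : ℝ) * ‖f‖ := by
        intro f
        have h1 : ‖L f‖ₑ ^ 2 ≤ C * ‖f‖ₑ ^ 2 := by
          change ‖(hLmem ε hε f).toLp _‖ₑ ^ 2 ≤ _
          rw [Lp.enorm_toLp, Lp.enorm_def, eLpNorm_two_sq, eLpNorm_two_sq]
          exact hbound ε hε f (hLm f) (Lp.memLp f)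
        have h2 : ‖L f‖ ^ 2 ≤ C.toReal * ‖f‖ ^ 2 := by
          have := ENNReal.toReal_mono (by finiteness) h1
          simpa [ENNReal.toReal_mul, ENNReal.toReal_pow] using this
        have h3 : (C.toReal ^ (1 / 2 : ℝ) * ‖f‖) ^ 2 = C.toReal * ‖f‖ ^ 2 := by
          rw [mul_pow, ← Real.rpow_natCast, ← Real.rpow_mul ENNReal.toReal_nonneg]
          norm_num
        rw [← h3] at h2
        exact pow_le_pow_iff_left₀ (norm_nonneg _) (by positivity) two_ne_zero |>.1 h2
      refine ⟨L.mkContinuous _ hL, fun _ => ⟨L.mkContinuous_norm_le (by positivity) hL,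
        fun f => (hLmem ε hε f).coeFn_toLp⟩⟩
    · exact ⟨0, fun h => absurd h hε⟩
  choose Sop hSop using hop
  have hSop' : ∀ ε (hε : 0 < ε) (f : Lp ℂ 2 μ), Sop ε f = (hLmem ε hε f).toLp _ := by
    intro ε hε f
    apply Lp.ext
    exact ((hSop ε hε).2 f).trans (hLmem ε hε f).coeFn_toLp.symm
  have hSg : ∀ ε (hε : 0 < ε) g (hg : Measurable g) (hg2 : MemLp g 2 μ),
      Sop ε (hg2.toLp g) = (hmem ε hε g hg hg2).toLp _ := by
    intro ε hε g hg hg2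
    rw [hSop' ε hε, MemLp.toLp_eq_toLp_iff, hcongr ε hε _ _ hg2.coeFn_toLp]
  set D' : Set (Lp ℂ 2 μ) := {F | ∃ g ∈ D, ∃ h : MemLp g 2 μ, F = h.toLp g} with hD'
  have hdense : Dense D' := by
    intro F
    obtain ⟨g, hg, hlim⟩ := hD F (hLm F) (Lp.memLp F)
    refine mem_closure_of_tendsto (f := fun n => (hDm (g n) (hg n)).2.toLp (g n))
      (b := atTop) ?_ (Eventually.of_forall fun n => ⟨g n, hg n, _, rfl⟩)
    rw [tendsto_iff_norm_sub_tendsto_zero]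
    have h1 : Tendsto (fun n => ‖F - (hDm (g n) (hg n)).2.toLp (g n)‖ₑ ^ 2) atTop (𝓝 0) := by
      refine hlim.congr fun n => ?_
      rw [← enorm_sub_toLp (Lp.memLp F), Lp.toLp_coeFn]
    have h2 := (ENNReal.tendsto_toReal ENNReal.zero_ne_top).comp h1
    have h3 := (Real.continuous_sqrt.tendsto _).comp h2
    simp only [Function.comp_def, ENNReal.toReal_pow, toReal_enorm, Real.sqrt_sq (norm_nonneg _),
      ENNReal.toReal_zero, Real.sqrt_zero] at h3
    refine h3.congr fun n => norm_sub_rev _ _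
  obtain ⟨T, hT⟩ := exists_strong_limit Sop (fun ε hε => (hSop ε hε).1) hdense (by
    rintro _ ⟨g, hg, hg2, rfl⟩
    obtain ⟨h, h0, hh⟩ := hcauchy g hg
    refine ⟨h, h0, fun ε ε' hε hε' => ?_⟩
    rw [hSg ε hε g (hDm g hg).1, hSg ε' hε' g (hDm g hg).1, enorm_sub_toLp]
    exact hh ε ε' hε hε')
  refine ⟨T, fun f => ?_, comp_self_of_strong_limit hdense (by
    rintro _ ⟨g, hg, hg2, rfl⟩ ε ε' hε hε'
    have hm := (hDm g hg).1
    rw [hSg ε hε g hm, hSg ε' hε' _ (hmeas ε hε g hm), hSg _ (add_pos hε' hε) g hm,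
      MemLp.toLp_eq_toLp_iff, hsemi g hg ε ε' hε hε']) hT⟩
  have h1 := (tendsto_iff_norm_sub_tendsto_zero.1 (hT f))
  have h2 := ENNReal.tendsto_ofReal h1
  rw [ENNReal.ofReal_zero] at h2
  refine h2.congr' ?_
  filter_upwards [self_mem_nhdsWithin] with ε hε
  rw [ofReal_norm, Lp.enorm_def]
  refine eLpNorm_congr_ae ?_
  filter_upwards [Lp.coeFn_sub (Sop ε f) (T f), (hSop ε hε).2 f] with y hy hy2
  rw [hy, Pi.sub_apply, hy2]

end Function

end DualLeray
end

noncomputable section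
namespace DualLeray
open scoped Real

theorem laplaceKernel_mul_exp (a : ℂ) (ξ u : ℝ) :
    Complex.exp (-(2 * π * Complex.I * ξ * u)) * laplaceKernel a ξ =
      laplaceKernel (a + Complex.I * u) ξ := by
  rw [laplaceKernel_add]
  congr 2
  ring

theorem measurable_laplaceKernel_comp {α : Type*} [MeasurableSpace α] {g : α → ℂ} {h : α → ℝ}
    (hg : Measurable g) (hh : Measurable h) : Measurable fun z => laplaceKernel (g z) (h z) :=
  measurable_laplaceKernel.comp (hg.prodMk hh)

/-- The convolution of `1 / (a + i·)²` and `1 / (b + i·)²` as a Laplace transform. -/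
theorem integral_inv_sq_mul_inv_sq {a b : ℂ} (ha : 0 < a.re) (hb : 0 < b.re) (s τ : ℝ) :
    ∫ t : ℝ, 1 / (a + Complex.I * ((s : ℂ) - t)) ^ 2 * (1 / (b + Complex.I * ((t : ℂ) - τ)) ^ 2) =
      ∫ ξ : ℝ, laplaceKernel (a + Complex.I * ((s : ℂ) - τ)) ξ * laplaceKernel b ξ := by
  have e1 : ∀ t : ℝ, 1 / (b + Complex.I * ((t : ℂ) - τ)) ^ 2 =
      ∫ ξ : ℝ, Complex.exp (-(2 * π * Complex.I * ξ * (t - τ))) * laplaceKernel b ξ := by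
    intro t
    have h := integral_laplaceKernel (a := b + Complex.I * ((t - τ : ℝ) : ℂ)) (by simpa using hb)
    push_cast at h
    rw [← h]
    congr 1 with ξ
    have := laplaceKernel_mul_exp b ξ (t - τ)
    push_cast at this
    exact this.symm
  simp_rw [e1, ← integral_const_mul]
  have hi : Integrable (fun t : ℝ => 1 / (a + Complex.I * ((s : ℂ) - t)) ^ 2) := by
    have := (integrable_fourier_laplaceKernel ha).comp_sub_left s
    simpa using this
  rw [integral_integral_swap]
  · congr 1 with ξ
    have e2 : ∀ t : ℝ, 1 / (a + Complex.I * ((s : ℂ) - t)) ^ 2 *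
        (Complex.exp (-(2 * π * Complex.I * ξ * (t - τ))) * laplaceKernel b ξ) =
        (Complex.exp (-(2 * π * Complex.I * ξ * (s - τ))) * laplaceKernel b ξ) *
        (Complex.exp (2 * π * Complex.I * ξ * (s - t : ℝ)) *
          (1 / (a + Complex.I * ((s - t : ℝ) : ℂ)) ^ 2)) := by
      intro t
      have : Complex.exp (-(2 * π * Complex.I * ξ * (t - τ))) =
          Complex.exp (-(2 * π * Complex.I * ξ * (s - τ))) *
            Complex.exp (2 * π * Complex.I * ξ * (s - t : ℝ)) := by
        rw [← Complex.exp_add]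
        congr 1
        push_cast
        ring
      rw [this]
      push_cast
      ring
    simp_rw [e2]
    rw [integral_const_mul, integral_sub_left_eq_self (fun u : ℝ =>
      Complex.exp (2 * π * Complex.I * ξ * (u : ℝ)) * (1 / (a + Complex.I * (u : ℂ)) ^ 2)),
      integral_fourierChar_mul_inv_sq ha]
    have := laplaceKernel_mul_exp a ξ (s - τ)
    push_cast at this
    rw [← this]
    ring
  · refine (hi.norm.mul_prod (integrable_laplaceKernel hb).norm).mono' ?_ (ae_of_all _ fun z => ?_)
    · refine Measurable.aestronglyMeasurable ?_
      unfold Function.uncurry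
      have := measurable_laplaceKernel_comp (α := ℝ × ℝ) (measurable_const (a := b)) measurable_snd
      fun_prop
    · simp only [Function.uncurry]
      rw [norm_mul, norm_mul]
      have h3 : ‖Complex.exp (-(2 * π * Complex.I * z.2 * (z.1 - τ)))‖ = 1 := by
        rw [Complex.norm_exp]
        simp
      rw [h3, one_mul]

/-- The reproducing property `∫ e^{-ξ(B(x, y) + B(y, z))} dy = (K / ξ) e^{-ξ B(x, z)}`. -/
def IsReproducing (B : ℂ → ℂ → ℂ) (K : ℝ) : Prop :=
  ∀ ξ : ℝ, 0 < ξ → ∀ x z, ∫ y, Complex.exp (-(ξ * (B x y + B y z))) =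
    (K / ξ : ℝ) * Complex.exp (-(ξ * B x z))

section Phase

variable {B : ℂ → ℂ → ℂ} {c K ε ε' : ℝ} {f : ℂ × ℝ → ℂ}

theorem integrable_laplaceKernel_mul (hB : IsGaussianPhase B c) (hε' : 0 < ε') (x z d : ℂ)
    (hd : 0 < d.re) :
    Integrable (Function.uncurry fun (y : ℂ) (ξ : ℝ) =>
      laplaceKernel (B x y + d) ξ * laplaceKernel (B y z + ε') ξ) (volume.prod volume) := by
  have h1 : Measurable fun p : ℂ × ℝ => laplaceKernel (B x p.1 + d) p.2 :=
    measurable_laplaceKernel_comp ((hB.measurable.comp (f := fun p : ℂ × ℝ => (x, p.1))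
      (by fun_prop)).add_const _) measurable_snd
  have h2 : Measurable fun p : ℂ × ℝ => laplaceKernel (B p.1 z + ε') p.2 :=
    measurable_laplaceKernel_comp ((hB.measurable.comp (f := fun p : ℂ × ℝ => (p.1, z))
      (by fun_prop)).add_const _) measurable_snd
  refine ⟨(h1.mul h2).aestronglyMeasurable, ?_⟩
  have h12 : Measurable (Function.uncurry fun (y : ℂ) (ξ : ℝ) =>
      laplaceKernel (B x y + d) ξ * laplaceKernel (B y z + ε') ξ) := h1.mul h2
  rw [hasFiniteIntegral_iff_enorm, lintegral_prod_symm _ h12.enorm.aemeasurable]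
  obtain ⟨C, hC, hC'⟩ := exists_gaussian_average_le (c := 2 * π * c) (q := 0)
    (by have := hB.pos; positivity) le_rfl (by norm_num)
  have hi := (integrable_laplaceKernel (a := (ε' : ℂ)) (by simpa using hε')).2
  rw [hasFiniteIntegral_iff_enorm] at hi
  calc ∫⁻ ξ : ℝ, ∫⁻ y : ℂ, ‖laplaceKernel (B x y + d) ξ * laplaceKernel (B y z + ε') ξ‖ₑ
      ≤ ∫⁻ ξ : ℝ, (ENNReal.ofReal ((2 * π) ^ 2) * C) * ‖laplaceKernel ε' ξ‖ₑ := by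
        refine lintegral_mono fun ξ => ?_
        rcases le_or_gt ξ 0 with hξ | hξ
        · simp [laplaceKernel_of_nonpos _ hξ]
        have h3 := hC' ξ hξ x
        simp only [ENNReal.rpow_zero, inv_one, one_mul, mul_one] at h3
        calc ∫⁻ y : ℂ, ‖laplaceKernel (B x y + d) ξ * laplaceKernel (B y z + ε') ξ‖ₑ
            ≤ ∫⁻ y : ℂ, (ENNReal.ofReal ((2 * π) ^ 2) *
                ENNReal.ofReal (ξ * Real.exp (-(2 * π * c) * ξ * ‖y - x‖ ^ 2))) *
                ‖laplaceKernel ε' ξ‖ₑ := by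
              refine lintegral_mono fun y => ?_
              rw [enorm_mul, norm_sub_rev]
              gcongr
              · refine le_trans ?_ (enorm_laplaceKernel_le hB hξ x y)
                rw [← ofReal_norm, ← ofReal_norm]
                apply ENNReal.ofReal_le_ofReal
                apply norm_laplaceKernel_le
                simpa using hd.le
              · rw [← ofReal_norm, ← ofReal_norm]
                apply ENNReal.ofReal_le_ofReal
                apply norm_laplaceKernel_le
                simpa using hB.re_nonneg y z
          _ = (ENNReal.ofReal ((2 * π) ^ 2) * ∫⁻ y : ℂ,
                ENNReal.ofReal (ξ * Real.exp (-(2 * π * c) * ξ * ‖y - x‖ ^ 2))) *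
                ‖laplaceKernel ε' ξ‖ₑ := by
              rw [lintegral_mul_const' _ _ enorm_ne_top, lintegral_const_mul' _ _ (by finiteness)]
          _ ≤ _ := by gcongr
    _ < ∞ := by
        rw [lintegral_const_mul' _ _ (by finiteness)]
        exact ENNReal.mul_lt_top (by finiteness) hi

theorem integral_laplaceKernel_mul (hR : IsReproducing B K) (x z d : ℂ) (ε' ξ : ℝ) :
    ∫ y, laplaceKernel (B x y + d) ξ * laplaceKernel (B y z + ε') ξ =
      (2 * π * K : ℝ) * laplaceKernel (B x z + ε' + d) ξ := by
  rcases le_or_gt ξ 0 with hξ | hξ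
  · simp [laplaceKernel_of_nonpos _ hξ]
  have h := hR (2 * π * ξ) (by positivity) x z
  have e : ∀ y, laplaceKernel (B x y + d) ξ * laplaceKernel (B y z + ε') ξ =
      ((2 * π) ^ 2 * ξ * ((2 * π) ^ 2 * ξ) * Complex.exp (-(2 * π * ξ * (ε' + d)))) *
        Complex.exp (-((2 * π * ξ : ℝ) * (B x y + B y z))) := by
    intro y
    rw [mul_assoc _ (Complex.exp _), ← Complex.exp_add]
    simp only [laplaceKernel, max_eq_left hξ.le]
    rw [mul_mul_mul_comm, ← Complex.exp_add]
    congr 2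
    push_cast
    ring
  simp_rw [e]
  have hξ0 : (ξ : ℂ) ≠ 0 := by exact_mod_cast hξ.ne'
  have hpi : (π : ℂ) ≠ 0 := by exact_mod_cast Real.pi_ne_zero
  rw [integral_const_mul, h, laplaceKernel, max_eq_left hξ.le]
  have e2 : Complex.exp (-(2 * π * ξ * (B x z + ε' + d))) =
      Complex.exp (-(2 * π * ξ * (ε' + d))) * Complex.exp (-((2 * π * ξ : ℝ) * B x z)) := by
    rw [← Complex.exp_add]
    congr 1
    push_cast
    ring
  rw [e2]
  push_cast
  field_simp

theorem enorm_kernel_mul_le (hB : IsGaussianPhase B c) (hε : 0 < ε) (hε' : 0 < ε') :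
    ∃ M : ℝ≥0∞, M ≠ ∞ ∧ ∀ p r,
      ∫⁻ q, ‖1 / denom B ε q p ^ 2‖ₑ * ‖1 / denom B ε' r q ^ 2‖ₑ ≤ M := by
  obtain ⟨K1, hK1, _, h1⟩ := exists_lintegral_kernel_sq_le hB hε
  obtain ⟨K2, hK2, h2, _⟩ := exists_lintegral_kernel_sq_le hB hε'
  refine ⟨K1 * K2 + 1, by finiteness, fun p r => ?_⟩
  have h := lintegral_mul_sq_le (ν := volume)
    (measurable_inv_denom_sq_right hB ε p).enorm.aemeasurable
    (measurable_inv_denom_sq_left hB ε' r).enorm.aemeasurable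
  have h3 := h.trans (mul_le_mul' (h1 p) (h2 r))
  set J := ∫⁻ q, ‖1 / denom B ε q p ^ 2‖ₑ * ‖1 / denom B ε' r q ^ 2‖ₑ with hJ
  rcases le_total J 1 with h4 | h4
  · exact h4.trans le_add_self
  · calc J = J * 1 := (mul_one _).symm
      _ ≤ J ^ 2 := by rw [sq]; gcongr
      _ ≤ _ := h3.trans le_self_add

theorem integral_kernel_mul_kernel (hB : IsGaussianPhase B c) (hR : IsReproducing B K)
    (hε : 0 < ε) (hε' : 0 < ε') (p r : ℂ × ℝ) :
    ∫ q, 1 / denom B ε q p ^ 2 * (1 / denom B ε' r q ^ 2) =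
      (2 * π * K : ℝ) * (1 / denom B (ε' + ε) r p ^ 2) := by
  have hint : Integrable fun q => 1 / denom B ε q p ^ 2 * (1 / denom B ε' r q ^ 2) := by
    refine ⟨((measurable_inv_denom_sq_right hB ε p).mul
      (measurable_inv_denom_sq_left hB ε' r)).aestronglyMeasurable, ?_⟩
    rw [hasFiniteIntegral_iff_enorm]
    obtain ⟨M, hM, h⟩ := enorm_kernel_mul_le hB hε hε'
    simp_rw [enorm_mul]
    exact (h p r).trans_lt hM.lt_top
  rw [Measure.volume_eq_prod] at hint ⊢
  rw [integral_prod _ hint]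
  have e1 : ∀ y : ℂ, ∫ t : ℝ, 1 / denom B ε (y, t) p ^ 2 * (1 / denom B ε' r (y, t) ^ 2) =
      ∫ ξ : ℝ, laplaceKernel (B p.1 y + (ε + Complex.I * ((p.2 : ℂ) - r.2))) ξ *
        laplaceKernel (B y r.1 + ε') ξ := by
    intro y
    have h1 := hB.re_nonneg p.1 y
    have h2 := hB.re_nonneg y r.1
    have := integral_inv_sq_mul_inv_sq (a := B p.1 y + ε) (b := B y r.1 + ε')
      (by simp; linarith) (by simp; linarith) p.2 r.2
    simpa only [denom, add_assoc] using this
  simp_rw [e1]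
  rw [integral_integral_swap (integrable_laplaceKernel_mul hB hε' p.1 r.1 _ (by simpa using hε))]
  simp_rw [integral_laplaceKernel_mul hR]
  have h3 := hB.re_nonneg p.1 r.1
  rw [integral_const_mul, integral_laplaceKernel]
  · congr 3
    rw [denom]
    push_cast
    ring
  · simp
    linarith

/-- The semigroup property of `kernelOp`, up to a constant. -/
theorem kernelOp_kernelOp (hB : IsGaussianPhase B c) (hR : IsReproducing B K)
    (hf : IsBoundedTest f) (hε : 0 < ε) (hε' : 0 < ε') (r : ℂ × ℝ) :
    kernelOp B ε' (kernelOp B ε f) r = (2 * π * K : ℝ) * kernelOp B (ε' + ε) f r := by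
  have hint : Integrable (Function.uncurry fun q p : ℂ × ℝ =>
      f p * (1 / denom B ε q p ^ 2 * (1 / denom B ε' r q ^ 2))) (volume.prod volume) := by
    have hm : Measurable (Function.uncurry fun q p : ℂ × ℝ =>
        f p * (1 / denom B ε q p ^ 2 * (1 / denom B ε' r q ^ 2))) := by
      unfold Function.uncurry
      have h1 := measurable_inv_denom_sq hB ε
      have h2 : Measurable fun z : (ℂ × ℝ) × (ℂ × ℝ) => 1 / denom B ε' r z.1 ^ 2 :=
        (measurable_inv_denom_sq_left hB ε' r).comp measurable_fst
      exact (hf.measurable.comp measurable_snd).mul (h1.mul h2)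
    refine ⟨hm.aestronglyMeasurable, ?_⟩
    rw [hasFiniteIntegral_iff_enorm, lintegral_prod_symm _ hm.enorm.aemeasurable]
    obtain ⟨M, hM, h⟩ := enorm_kernel_mul_le hB hε hε'
    have hfi := hf.integrable.2
    rw [hasFiniteIntegral_iff_enorm] at hfi
    calc _ ≤ ∫⁻ p, ‖f p‖ₑ * M := by
          refine lintegral_mono fun p => ?_
          simp only [Function.uncurry, enorm_mul]
          rw [lintegral_const_mul' _ _ enorm_ne_top]
          gcongr
          exact h p r
      _ < ∞ := by
          rw [lintegral_mul_const' _ _ hM]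
          exact ENNReal.mul_lt_top hfi hM.lt_top
  calc kernelOp B ε' (kernelOp B ε f) r
      = ∫ q, ∫ p, f p * (1 / denom B ε q p ^ 2 * (1 / denom B ε' r q ^ 2)) := by
        unfold kernelOp
        congr 1 with q
        rw [div_eq_mul_one_div, ← integral_mul_const]
        congr 1 with p
        ring
    _ = ∫ p, f p * ∫ q, 1 / denom B ε q p ^ 2 * (1 / denom B ε' r q ^ 2) := by
        rw [integral_integral_swap hint]
        simp_rw [integral_const_mul]
    _ = _ := by
        simp_rw [integral_kernel_mul_kernel hB hR hε hε']
        rw [kernelOp, ← integral_const_mul]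
        congr 1 with p
        ring

end Phase

end DualLeray
end

noncomputable section
namespace DualLeray
open scoped Real

/-- The radial power map `x ↦ x |x|^(a-1)` of the plane. -/
def radialPow (a : ℝ) (x : ℂ) : ℂ := x * ((‖x‖ ^ (a - 1) : ℝ) : ℂ)

theorem radialPow_zero (a : ℝ) : radialPow a 0 = 0 := by simp [radialPow]

theorem norm_radialPow {a : ℝ} (ha : a ≠ 0) (x : ℂ) : ‖radialPow a x‖ = ‖x‖ ^ a := by
  rcases eq_or_ne x 0 with rfl | hx
  · simp [radialPow_zero, Real.zero_rpow ha]
  · have hx' : 0 < ‖x‖ := norm_pos_iff.2 hx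
    rw [radialPow, norm_mul, Complex.norm_real, Real.norm_of_nonneg (by positivity)]
    nth_rewrite 1 [← Real.rpow_one ‖x‖]
    rw [← Real.rpow_add hx']
    congr 1
    ring

theorem measurable_radialPow (a : ℝ) : Measurable (radialPow a) := by
  unfold radialPow
  fun_prop

theorem radialPow_one (x : ℂ) : radialPow 1 x = x := by simp [radialPow]

theorem radialPow_radialPow {a : ℝ} (ha : a ≠ 0) (b : ℝ) (x : ℂ) :
    radialPow b (radialPow a x) = radialPow (a * b) x := by
  rcases eq_or_ne x 0 with rfl | hx
  · simp [radialPow_zero]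
  · have hx' : 0 < ‖x‖ := norm_pos_iff.2 hx
    rw [radialPow, norm_radialPow ha, radialPow, radialPow, mul_assoc, ← Complex.ofReal_mul,
      ← Real.rpow_mul hx'.le, ← Real.rpow_add hx']
    ring_nf

theorem conj_radialPow (a : ℝ) (x : ℂ) : conj (radialPow a x) = radialPow a (conj x) := by
  simp [radialPow]

theorem radialPow_mul_of_norm_one (a : ℝ) {u : ℂ} (hu : ‖u‖ = 1) (x : ℂ) :
    radialPow a (u * x) = u * radialPow a x := by
  simp [radialPow, hu, mul_assoc]

/-- The phase of the Leray kernel in the coordinate `x`, `ζ₁ = x |x|^(2/γ - 1)`. -/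
def lerayPhase (γ : ℝ) (x y : ℂ) : ℂ :=
  ((γ - 1) * ‖x‖ ^ 2 + ‖y‖ ^ 2 : ℝ) - γ * (conj (radialPow (2 - 2 / γ) x) * radialPow (2 / γ) y)

/-- A sharpened weighted inequality between arithmetic and geometric means. -/
theorem rpow_mul_rpow_add_le {l a b : ℝ} (h0 : 0 < l) (h1 : l < 1) (ha : 0 < a) (hb : 0 < b) :
    a ^ (2 - 2 * l) * b ^ (2 * l) + min l (1 - l) * (a - b) ^ 2 ≤
      (1 - l) * a ^ 2 + l * b ^ 2 := by
  rcases le_total l (1 / 2) with h | h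
  · have h2 := Real.geom_mean_le_arith_mean2_weighted (w₁ := 1 - 2 * l) (w₂ := 2 * l)
      (p₁ := a ^ 2) (p₂ := a * b) (by linarith) (by linarith) (by positivity) (by positivity)
      (by ring)
    have e : (a ^ 2) ^ (1 - 2 * l) * (a * b) ^ (2 * l) = a ^ (2 - 2 * l) * b ^ (2 * l) := by
      rw [Real.mul_rpow ha.le hb.le, ← mul_assoc, ← Real.rpow_two, ← Real.rpow_mul ha.le,
        ← Real.rpow_add ha]
      ring_nf
    rw [e] at h2
    rw [min_eq_left (by linarith)]
    nlinarith
  · have h2 := Real.geom_mean_le_arith_mean2_weighted (w₁ := 2 * l - 1) (w₂ := 2 - 2 * l)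
      (p₁ := b ^ 2) (p₂ := a * b) (by linarith) (by linarith) (by positivity) (by positivity)
      (by ring)
    have e : (b ^ 2) ^ (2 * l - 1) * (a * b) ^ (2 - 2 * l) = a ^ (2 - 2 * l) * b ^ (2 * l) := by
      rw [Real.mul_rpow ha.le hb.le, mul_left_comm, ← Real.rpow_two, ← Real.rpow_mul hb.le,
        ← Real.rpow_add hb]
      ring_nf
    rw [e] at h2
    rw [min_eq_right (by linarith)]
    nlinarith

theorem isGaussianPhase_lerayPhase {γ : ℝ} (hγ : 1 < γ) :
    IsGaussianPhase (lerayPhase γ) (γ * min (1 / γ) (1 - 1 / γ) / 2) := by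
  have hγ0 : 0 < γ := by linarith
  have hl0 : 0 < 1 / γ := by positivity
  have hl1 : 1 / γ < 1 := by rw [div_lt_one hγ0]; exact hγ
  set l := 1 / γ with hl
  set m := min l (1 - l) with hm
  have hm0 : 0 < m := lt_min hl0 (by linarith)
  have hml : m ≤ l := min_le_left _ _
  have hml' : m ≤ 1 - l := min_le_right _ _
  have hγl : γ * l = 1 := by rw [hl]; field_simp
  refine ⟨?_, by positivity, fun x y => ?_⟩
  · have h1 := measurable_radialPow (2 - 2 / γ)
    have h2 := measurable_radialPow (2 / γ)
    have h3 : Measurable fun z : ℂ => conj z := Complex.continuous_conj.measurable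
    unfold lerayPhase Function.uncurry
    fun_prop
  set ρ : ℝ := (conj x * y).re with hρ
  have hxy : ‖x - y‖ ^ 2 = ‖x‖ ^ 2 + ‖y‖ ^ 2 - 2 * ρ := by
    rw [← Complex.normSq_eq_norm_sq, ← Complex.normSq_eq_norm_sq, ← Complex.normSq_eq_norm_sq,
      Complex.normSq_sub, hρ]
    congr 2
    simp
  have hρb : |ρ| ≤ ‖x‖ * ‖y‖ := by
    refine (Complex.abs_re_le_norm _).trans (le_of_eq ?_)
    rw [norm_mul, RCLike.norm_conj]
  have hre : (lerayPhase γ x y).re = (γ - 1) * ‖x‖ ^ 2 + ‖y‖ ^ 2 -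
      γ * (‖x‖ ^ (2 - 2 / γ - 1) * ‖y‖ ^ (2 / γ - 1) * ρ) := by
    have e : conj (radialPow (2 - 2 / γ) x) * radialPow (2 / γ) y =
        ((‖x‖ ^ (2 - 2 / γ - 1) * ‖y‖ ^ (2 / γ - 1) : ℝ) : ℂ) * (conj x * y) := by
      simp only [radialPow, map_mul, Complex.conj_ofReal]
      push_cast
      ring
    rw [lerayPhase, e, Complex.sub_re, Complex.ofReal_re, Complex.re_ofReal_mul,
      Complex.re_ofReal_mul]
  rw [hre, hxy]
  rcases eq_or_ne x 0 with rfl | hx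
  · simp only [hρ, norm_zero, map_zero, zero_mul, Complex.zero_re]
    nlinarith [sq_nonneg ‖y‖, mul_le_mul_of_nonneg_left hml hγ0.le]
  rcases eq_or_ne y 0 with rfl | hy
  · simp only [hρ, norm_zero, mul_zero, Complex.zero_re]
    nlinarith [sq_nonneg ‖x‖, mul_le_mul_of_nonneg_left hml' hγ0.le]
  have ha : 0 < ‖x‖ := norm_pos_iff.2 hx
  have hb : 0 < ‖y‖ := norm_pos_iff.2 hy
  set a := ‖x‖
  set b := ‖y‖
  have hamgm := rpow_mul_rpow_add_le hl0 hl1 ha hb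
  rw [← hm] at hamgm
  set G := a ^ (2 - 2 / γ - 1) * b ^ (2 / γ - 1) with hG
  have hG0 : 0 < G := by positivity
  have hGab : a ^ (2 - 2 * l) * b ^ (2 * l) = G * (a * b) := by
    have e1 : a ^ (2 - 2 * l) = a ^ (2 - 2 / γ - 1) * a := by
      nth_rewrite 3 [← Real.rpow_one a]
      rw [← Real.rpow_add ha, hl]
      ring_nf
    have e2 : b ^ (2 * l) = b ^ (2 / γ - 1) * b := by
      nth_rewrite 3 [← Real.rpow_one b]
      rw [← Real.rpow_add hb, hl]
      ring_nf
    rw [e1, e2, hG]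
    ring
  rw [hGab] at hamgm
  obtain ⟨hρ1, hρ2⟩ := abs_le.1 hρb
  have hsum : m * (a ^ 2 + b ^ 2) ≤ (1 - l) * a ^ 2 + l * b ^ 2 := by
    nlinarith [sq_nonneg a, sq_nonneg b]
  have hmain : m / 2 * (a ^ 2 + b ^ 2 - 2 * ρ) ≤ (1 - l) * a ^ 2 + l * b ^ 2 - G * ρ := by
    have hab : 0 < a * b := mul_pos ha hb
    have u1 : 0 ≤ (1 - l) * a ^ 2 + l * b ^ 2 - G * (a * b) - m / 2 * (a - b) ^ 2 := by
      nlinarith [mul_nonneg hm0.le (sq_nonneg (a - b))]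
    have u2 : 0 ≤ (1 - l) * a ^ 2 + l * b ^ 2 + G * (a * b) - m / 2 * (a + b) ^ 2 := by
      nlinarith [mul_nonneg hm0.le (sq_nonneg (a - b)), mul_pos hG0 hab]
    have key : 0 ≤ (a * b) * ((1 - l) * a ^ 2 + l * b ^ 2 - G * ρ -
        m / 2 * (a ^ 2 + b ^ 2 - 2 * ρ)) * 2 := by
      have v1 := mul_nonneg (by linarith : 0 ≤ a * b + ρ) u1
      have v2 := mul_nonneg (by linarith : 0 ≤ a * b - ρ) u2
      nlinarith
    by_contra hn
    push Not at hn
    have : (a * b) * ((1 - l) * a ^ 2 + l * b ^ 2 - G * ρ -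
        m / 2 * (a ^ 2 + b ^ 2 - 2 * ρ)) < 0 := mul_neg_of_pos_of_neg hab (by linarith)
    linarith
  have hfin := mul_le_mul_of_nonneg_left hmain hγ0.le
  have e3 : γ * ((1 - l) * a ^ 2 + l * b ^ 2 - G * ρ) =
      (γ - 1) * a ^ 2 + b ^ 2 - γ * (G * ρ) := by
    linear_combination (b ^ 2 - a ^ 2) * hγl
  rw [e3] at hfin
  linarith

/-- The circle integral of `exp (A w + B / w)` only depends on `A B`. -/
theorem intervalIntegral_exp_circle (A B : ℂ) {r : ℝ} (hr : 0 < r) :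
    ∫ θ in (0 : ℝ)..2 * π, Complex.exp (A * r * Complex.exp (θ * Complex.I) +
      B * (r : ℂ)⁻¹ * (Complex.exp (θ * Complex.I))⁻¹) =
    ∫ θ in (0 : ℝ)..2 * π, Complex.exp (A * Complex.exp (θ * Complex.I) +
      B * (Complex.exp (θ * Complex.I))⁻¹) := by
  set f : ℂ → ℂ := fun w => Complex.exp (A * w + B * w⁻¹) with hf
  have hd : ∀ w : ℂ, w ≠ 0 → DifferentiableAt ℂ f w := by
    intro w hw
    have : DifferentiableAt ℂ (fun w : ℂ => w⁻¹) w := differentiableAt_inv hw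
    simp only [hf]
    fun_prop
  have key : ∀ R S : ℝ, 0 < R → R ≤ S →
      (∮ w in C(0, S), (w - 0)⁻¹ • f w) = ∮ w in C(0, R), (w - 0)⁻¹ • f w := by
    intro R S hR hRS
    refine Complex.circleIntegral_sub_center_inv_smul_eq_of_differentiable_on_annulus_off_countable
      hR hRS countable_empty ?_ ?_
    · intro w hw
      refine (hd w ?_).continuousAt.continuousWithinAt
      rintro rfl
      exact hw.2 (by simpa using hR)
    · intro w hw
      refine hd w ?_
      rintro rfl
      exact hw.1.2 (by simpa using hR.le)
  have key2 : (∮ w in C(0, r), (w - 0)⁻¹ • f w) = ∮ w in C(0, 1), (w - 0)⁻¹ • f w := by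
    rcases le_total r 1 with h | h
    · exact (key r 1 hr h).symm
    · exact key 1 r one_pos h
  have expand : ∀ R : ℝ, 0 < R → (∮ w in C(0, R), (w - 0)⁻¹ • f w) =
      Complex.I * ∫ θ in (0 : ℝ)..2 * π, f (R * Complex.exp (θ * Complex.I)) := by
    intro R hR
    rw [circleIntegral, ← intervalIntegral.integral_const_mul]
    congr 1 with θ
    have hne : (R : ℂ) * Complex.exp (θ * Complex.I) ≠ 0 :=
      mul_ne_zero (by exact_mod_cast hR.ne') (Complex.exp_ne_zero _)
    simp only [deriv_circleMap, circleMap_zero, sub_zero, smul_eq_mul]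
    rw [mul_right_comm, ← mul_assoc, mul_right_comm, mul_inv_cancel₀ hne, one_mul]
  rw [expand r hr, expand 1 one_pos] at key2
  have key3 := mul_left_cancel₀ Complex.I_ne_zero key2
  simp only [hf, mul_inv, Complex.ofReal_one, one_mul, ← mul_assoc] at key3
  exact key3

theorem integral_gaussian_complex {c : ℝ} (hc : 0 < c) (α β : ℂ) :
    ∫ y : ℂ, Complex.exp (-(c * (‖y‖ ^ 2 - α * y - β * conj y))) =
      (π / c : ℝ) * Complex.exp (c * α * β) := by
  have hc' : (c : ℂ) ≠ 0 := by exact_mod_cast hc.ne'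
  rw [← (Complex.volume_preserving_equiv_real_prod.symm).integral_comp
    Complex.measurableEquivRealProd.symm.measurableEmbedding]
  have e : ∀ p : ℝ × ℝ, Complex.exp (-(c * (‖Complex.measurableEquivRealProd.symm p‖ ^ 2 -
      α * Complex.measurableEquivRealProd.symm p -
      β * conj (Complex.measurableEquivRealProd.symm p)))) =
      Complex.exp (-c * p.1 ^ 2 + c * (α + β) * p.1 + 0) *
        Complex.exp (-c * p.2 ^ 2 + Complex.I * c * (α - β) * p.2 + 0) := by
    intro p
    have h1 : Complex.measurableEquivRealProd.symm p = (p.1 : ℂ) + p.2 * Complex.I :=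
      Complex.mk_eq_add_mul_I _ _
    have h2 : ((‖(p.1 : ℂ) + p.2 * Complex.I‖ : ℝ) : ℂ) ^ 2 = p.1 ^ 2 + p.2 ^ 2 := by
      rw [← Complex.ofReal_pow, ← Complex.normSq_eq_norm_sq, Complex.normSq_add_mul_I]
      push_cast
      ring
    rw [h1, h2, ← Complex.exp_add]
    congr 1
    simp
    ring
  simp_rw [e]
  rw [Measure.volume_eq_prod, integral_prod_mul
    (fun u : ℝ => Complex.exp (-c * u ^ 2 + c * (α + β) * u + 0))
    (fun v : ℝ => Complex.exp (-c * v ^ 2 + Complex.I * c * (α - β) * v + 0)),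
    integral_cexp_quadratic (by simpa using hc), integral_cexp_quadratic (by simpa using hc),
    mul_mul_mul_comm, ← Complex.cpow_add _ _ (by simp [hc', Real.pi_ne_zero]), ← Complex.exp_add]
  rw [neg_neg, show (1 / 2 : ℂ) + 1 / 2 = 1 by norm_num, Complex.cpow_one, Complex.ofReal_div]
  congr 2
  field_simp
  rw [Complex.I_sq]
  ring

theorem exists_mul_rpow_le {a κ : ℝ} (ha : 0 ≤ a) (h0 : 0 < κ) (h2 : κ < 2) :
    ∃ C, ∀ ρ : ℝ, 0 ≤ ρ → a * ρ ^ κ ≤ ρ ^ 2 / 4 + C := by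
  set R : ℝ := (4 * a + 1) ^ (1 / (2 - κ)) with hR
  have hR0 : 0 < R := by positivity
  refine ⟨a * R ^ κ, fun ρ hρ => ?_⟩
  rcases le_total ρ R with h | h
  · have : a * ρ ^ κ ≤ a * R ^ κ := by gcongr
    have h3 : 0 ≤ ρ ^ 2 / 4 := by positivity
    linarith
  · have hρ0 : 0 < ρ := hR0.trans_le h
    have h3 : ρ ^ κ = ρ ^ 2 * ρ ^ (κ - 2) := by
      rw [← Real.rpow_two, ← Real.rpow_add hρ0]
      ring_nf
    have h4 : ρ ^ (κ - 2) ≤ 1 / (4 * a + 1) := by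
      refine (Real.rpow_le_rpow_of_nonpos hR0 h (by linarith)).trans (le_of_eq ?_)
      have : 2 - κ ≠ 0 := by linarith
      rw [hR, ← Real.rpow_mul (by positivity), show 1 / (2 - κ) * (κ - 2) = -1 by
        field_simp; ring, Real.rpow_neg_one, one_div]
    have h5 : a * (1 / (4 * a + 1)) ≤ 1 / 4 := by
      rw [mul_one_div, div_le_iff₀ (by positivity)]
      linarith
    calc a * ρ ^ κ = ρ ^ 2 * (a * ρ ^ (κ - 2)) := by rw [h3]; ring
      _ ≤ ρ ^ 2 * (a * (1 / (4 * a + 1))) := by gcongr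
      _ ≤ ρ ^ 2 * (1 / 4) := by gcongr
      _ ≤ _ := by
        have : 0 ≤ a * R ^ κ := by positivity
        linarith

/-- Averaging over rotations. -/
theorem integral_eq_integral_circle_average {F : ℂ → ℂ} {g : ℂ → ℝ} (hF : Measurable F)
    (hg : Integrable g)
    (hFg : ∀ (u y : ℂ), ‖u‖ = 1 → ‖F (u * y)‖ ≤ g y) :
    (2 * π : ℝ) * ∫ y, F y =
      ∫ y, ∫ θ in (0 : ℝ)..2 * π, F (Complex.exp (θ * Complex.I) * y) := by
  have hrot : ∀ θ : ℝ, ∫ y, F (Complex.exp (θ * Complex.I) * y) = ∫ y, F y := by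
    intro θ
    have h := ((rotation (Circle.exp θ)).measurePreserving).integral_comp
      (rotation (Circle.exp θ)).toHomeomorph.measurableEmbedding F
    simpa [rotation_apply, Circle.coe_exp] using h
  have h2pi : (0 : ℝ) ≤ 2 * π := by positivity
  simp_rw [intervalIntegral.integral_of_le h2pi]
  rw [integral_integral_swap]
  · simp_rw [hrot]
    rw [integral_const]
    simp [Real.volume_real_Ioc_of_le h2pi]
  · have : Integrable (fun z : ℂ × ℝ => g z.1)
        (volume.prod (volume.restrict (Ioc 0 (2 * π)))) := hg.comp_fst _
    refine this.mono' ?_ (ae_of_all _ fun z => ?_)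
    · refine Measurable.aestronglyMeasurable ?_
      unfold Function.uncurry
      fun_prop
    · exact hFg _ _ (Complex.norm_exp_ofReal_mul_I _)

theorem integral_exp_radialPow {c κ : ℝ} (hc : 0 < c) (h0 : 0 < κ) (h2 : κ < 2) (α β : ℂ) :
    ∫ y : ℂ, Complex.exp (-(c * (‖y‖ ^ 2 - α * radialPow κ y -
      β * conj (radialPow (2 - κ) y)))) = (π / c : ℝ) * Complex.exp (c * α * β) := by
  have key : ∀ κ : ℝ, 0 < κ → κ < 2 →
      (2 * π : ℝ) * ∫ y : ℂ, Complex.exp (-(c * (‖y‖ ^ 2 - α * radialPow κ y -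
        β * conj (radialPow (2 - κ) y)))) =
      ∫ y : ℂ, Complex.exp (-(c * ‖y‖ ^ 2)) * ∫ θ in (0 : ℝ)..2 * π,
        Complex.exp (c * α * y * Complex.exp (θ * Complex.I) +
          c * β * conj y * (Complex.exp (θ * Complex.I))⁻¹) := by
    intro κ h0 h2
    obtain ⟨C1, hC1⟩ := exists_mul_rpow_le (norm_nonneg α) h0 h2
    obtain ⟨C2, hC2⟩ := exists_mul_rpow_le (norm_nonneg β) (κ := 2 - κ) (by linarith) (by linarith)
    have hgi : Integrable fun y : ℂ => Real.exp (c * (C1 + C2)) *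
        Real.exp (-(c / 2) * ‖y‖ ^ 2) := by
      refine Integrable.const_mul ?_ _
      have h3 := lintegral_norm_rpow_mul_exp (q := 0) (b := c / 2) (by norm_num) (by positivity)
      simp only [Real.rpow_zero, one_mul] at h3
      refine ⟨by fun_prop, ?_⟩
      rw [hasFiniteIntegral_iff_ofReal (ae_of_all _ fun y => (Real.exp_pos _).le), h3]
      exact ENNReal.ofReal_lt_top
    have hm1 := measurable_radialPow κ
    have hm2 := measurable_radialPow (2 - κ)
    have hm3 : Measurable fun z : ℂ => conj z := Complex.continuous_conj.measurable
    rw [integral_eq_integral_circle_average (by fun_prop) hgi]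
    · congr 1 with y
      rcases eq_or_ne y 0 with rfl | hy
      · simp [radialPow_zero]
      have hy' : 0 < ‖y‖ := norm_pos_iff.2 hy
      have hinv := intervalIntegral_exp_circle (c * α * radialPow κ y)
        (c * β * conj (radialPow (2 - κ) y)) (r := ‖y‖ ^ (1 - κ)) (by positivity)
      have e1 : radialPow κ y * ((‖y‖ ^ (1 - κ) : ℝ) : ℂ) = y := by
        rw [radialPow, mul_assoc, ← Complex.ofReal_mul, ← Real.rpow_add hy']
        simp
      have e2 : conj (radialPow (2 - κ) y) * ((‖y‖ ^ (1 - κ) : ℝ) : ℂ)⁻¹ = conj y := by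
        have : ((‖y‖ ^ (1 - κ) : ℝ) : ℂ) ≠ 0 := by
          exact_mod_cast (Real.rpow_pos_of_pos hy' _).ne'
        rw [radialPow, map_mul, Complex.conj_ofReal, show 2 - κ - 1 = 1 - κ by ring]
        field_simp
      simp only [mul_assoc _ (radialPow κ y), e1, mul_assoc _ (conj (radialPow (2 - κ) y)),
        e2] at hinv
      rw [hinv, ← intervalIntegral.integral_const_mul]
      congr 1 with θ
      rw [← Complex.exp_add, radialPow_mul_of_norm_one _ (Complex.norm_exp_ofReal_mul_I θ),
        radialPow_mul_of_norm_one _ (Complex.norm_exp_ofReal_mul_I θ), norm_mul,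
        Complex.norm_exp_ofReal_mul_I, one_mul, map_mul]
      have e3 : conj (Complex.exp (θ * Complex.I)) = (Complex.exp (θ * Complex.I))⁻¹ := by
        rw [← Complex.exp_conj, ← Complex.exp_neg]
        simp
      rw [e3]
      congr 1
      ring
    · intro u y hu
      rw [Complex.norm_exp, ← Real.exp_add]
      apply Real.exp_le_exp.2
      have h4 := hC1 ‖y‖ (norm_nonneg y)
      have h5 := hC2 ‖y‖ (norm_nonneg y)
      have n1 : ‖α * radialPow κ (u * y)‖ = ‖α‖ * ‖y‖ ^ κ := by
        rw [norm_mul, norm_radialPow h0.ne', norm_mul, hu, one_mul]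
      have n2 : ‖β * conj (radialPow (2 - κ) (u * y))‖ = ‖β‖ * ‖y‖ ^ (2 - κ) := by
        rw [norm_mul, RCLike.norm_conj, norm_radialPow (by linarith), norm_mul, hu, one_mul]
      have r1 := Complex.re_le_norm (α * radialPow κ (u * y))
      have r2 := Complex.re_le_norm (β * conj (radialPow (2 - κ) (u * y)))
      have e : (-(c * (((‖u * y‖ : ℝ) : ℂ) ^ 2 - α * radialPow κ (u * y) -
          β * conj (radialPow (2 - κ) (u * y))))).re = -(c * (‖y‖ ^ 2 -
          (α * radialPow κ (u * y)).re - (β * conj (radialPow (2 - κ) (u * y))).re)) := by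
        rw [norm_mul, hu, one_mul, Complex.neg_re, Complex.re_ofReal_mul, Complex.sub_re,
          Complex.sub_re, ← Complex.ofReal_pow, Complex.ofReal_re]
      rw [e]
      rw [n1] at r1
      rw [n2] at r2
      nlinarith
  have h := (key κ h0 h2).trans (key 1 one_pos (by norm_num)).symm
  have hpi : ((2 * π : ℝ) : ℂ) ≠ 0 := by
    have : (2 * π : ℝ) ≠ 0 := by positivity
    exact_mod_cast this
  rw [mul_left_cancel₀ hpi h, ← integral_gaussian_complex hc]
  congr 1 with y
  rw [show (2 : ℝ) - 1 = 1 by norm_num, radialPow_one]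

theorem isReproducing_lerayPhase {γ : ℝ} (hγ : 1 < γ) :
    IsReproducing (lerayPhase γ) (π / γ) := by
  intro ξ hξ x z
  have hγ0 : 0 < γ := by linarith
  have hκ : 2 / γ < 2 := by rw [div_lt_iff₀ hγ0]; linarith
  have h := integral_exp_radialPow (c := ξ * γ) (κ := 2 / γ) (by positivity) (by positivity) hκ
    (conj (radialPow (2 - 2 / γ) x)) (radialPow (2 / γ) z)
  have e : ∀ y, Complex.exp (-(ξ * (lerayPhase γ x y + lerayPhase γ y z))) =
      Complex.exp (-(ξ * ((γ - 1) * ‖x‖ ^ 2 + ‖z‖ ^ 2))) *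
        Complex.exp (-((ξ * γ : ℝ) * (‖y‖ ^ 2 - conj (radialPow (2 - 2 / γ) x) *
          radialPow (2 / γ) y - radialPow (2 / γ) z * conj (radialPow (2 - 2 / γ) y)))) := by
    intro y
    rw [← Complex.exp_add, lerayPhase, lerayPhase]
    congr 1
    push_cast
    ring
  simp_rw [e]
  rw [integral_const_mul, h, mul_left_comm, ← Complex.exp_add, lerayPhase]
  congr 2
  · field_simp
  · push_cast
    ring

end DualLeray
end

noncomputable section
namespace DualLeray
open scoped Real

theorem lintegral_Ioi_comp_rpow {a : ℝ} (ha : 0 < a) (H : ℝ → ℝ≥0∞) :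
    ∫⁻ r in Ioi (0 : ℝ), ENNReal.ofReal (a * r ^ (a - 1)) * H (r ^ a) =
      ∫⁻ r in Ioi (0 : ℝ), H r := by
  have himg : (fun r : ℝ => r ^ a) '' Ioi 0 = Ioi 0 := by
    ext r
    constructor
    · rintro ⟨t, ht, rfl⟩
      exact Real.rpow_pos_of_pos ht a
    · intro hr
      refine ⟨r ^ a⁻¹, Real.rpow_pos_of_pos hr _, ?_⟩
      change (r ^ a⁻¹) ^ a = r
      rw [← Real.rpow_mul (le_of_lt hr), inv_mul_cancel₀ ha.ne', Real.rpow_one]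
  have hinj : InjOn (fun r : ℝ => r ^ a) (Ioi 0) := fun r hr t ht h =>
    (Real.rpow_left_inj (le_of_lt hr) (le_of_lt ht) ha.ne').1 h
  have h := lintegral_image_eq_lintegral_abs_deriv_mul (f := fun r : ℝ => r ^ a)
    (f' := fun r => a * r ^ (a - 1)) measurableSet_Ioi
    (fun r hr => (Real.hasDerivAt_rpow_const (Or.inl (ne_of_gt hr))).hasDerivWithinAt) hinj H
  rw [himg] at h
  rw [h]
  refine setLIntegral_congr_fun measurableSet_Ioi fun r hr => ?_
  have : 0 ≤ a * r ^ (a - 1) := mul_nonneg ha.le (Real.rpow_nonneg (le_of_lt hr) _)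
  simp only [abs_of_nonneg this]

theorem lintegral_complex_eq_polar {g : ℂ → ℝ≥0∞} (hg : Measurable g) :
    ∫⁻ z, g z = ∫⁻ θ in Ioo (-π) π, ∫⁻ r in Ioi (0 : ℝ),
      ENNReal.ofReal r * g (r * Complex.exp (θ * Complex.I)) := by
  have e : ∀ p : ℝ × ℝ, Complex.polarCoord.symm p = p.1 * Complex.exp (p.2 * Complex.I) := by
    intro p
    rw [Complex.polarCoord_symm_apply, Complex.exp_mul_I]
    push_cast
    ring
  rw [← Complex.lintegral_comp_polarCoord_symm, polarCoord_target, Measure.volume_eq_prod,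
    ← Measure.prod_restrict]
  simp_rw [e, smul_eq_mul]
  rw [lintegral_prod_symm]
  refine Measurable.aemeasurable ?_
  fun_prop

/-- The change of variables `ζ = radialPow a x` in the plane. -/
theorem lintegral_comp_radialPow {a : ℝ} (ha : 0 < a) {g : ℂ → ℝ≥0∞} (hg : Measurable g) :
    ∫⁻ x, ENNReal.ofReal (a * ‖x‖ ^ (2 * a - 2)) * g (radialPow a x) = ∫⁻ z, g z := by
  have hm := measurable_radialPow a
  rw [lintegral_complex_eq_polar hg, lintegral_complex_eq_polar (by fun_prop)]
  refine lintegral_congr fun θ => ?_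
  refine Eq.trans ?_ (lintegral_Ioi_comp_rpow ha _)
  refine setLIntegral_congr_fun measurableSet_Ioi fun r hr => ?_
  have hr' : 0 < r := hr
  have hn : ‖(r : ℂ) * Complex.exp (θ * Complex.I)‖ = r := by
    rw [norm_mul, Complex.norm_exp_ofReal_mul_I, mul_one, Complex.norm_real,
      Real.norm_of_nonneg hr'.le]
  have e1 : radialPow a ((r : ℂ) * Complex.exp (θ * Complex.I)) =
      ((r ^ a : ℝ) : ℂ) * Complex.exp (θ * Complex.I) := by
    rw [radialPow, hn, mul_right_comm, ← Complex.ofReal_mul]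
    congr 2
    nth_rewrite 1 [← Real.rpow_one r]
    rw [← Real.rpow_add hr']
    ring_nf
  simp only [e1, hn]
  rw [← mul_assoc, ← mul_assoc, ← ENNReal.ofReal_mul hr'.le, ← ENNReal.ofReal_mul (by positivity)]
  congr 2
  rw [mul_left_comm, mul_assoc]
  congr 1
  nth_rewrite 1 [← Real.rpow_one r]
  rw [← Real.rpow_add hr', ← Real.rpow_add hr']
  ring_nf

theorem measurable_graphMap (γ : ℝ) : Measurable (graphMap γ) := by
  unfold graphMap
  refine Measurable.subtype_mk ?_
  fun_prop

/-- The parametrization of `M_γ` by `(x, s)`, `ζ₁ = x |x|^(2/γ - 1)`, `s = Re ζ₂`. -/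
def chart {γ : ℝ} (hγ : 1 < γ) : (ℂ × ℝ) ≃ᵐ M γ where
  toFun p := graphMap γ (radialPow (2 / γ) p.1, p.2)
  invFun z := (radialPow (γ / 2) z.1.1, z.1.2.re)
  left_inv p := by
    have h : 2 / γ ≠ 0 := by positivity
    refine Prod.ext ?_ ?_
    · change radialPow (γ / 2) (radialPow (2 / γ) p.1) = p.1
      rw [radialPow_radialPow h, div_mul_div_cancel₀ (by positivity), div_self two_ne_zero,
        radialPow_one]
    · simp [graphMap]
  right_inv z := by
    have h : γ / 2 ≠ 0 := by positivity
    have e1 : radialPow (2 / γ) (radialPow (γ / 2) z.1.1) = z.1.1 := by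
      rw [radialPow_radialPow h, div_mul_div_cancel₀ two_ne_zero, div_self (by positivity),
        radialPow_one]
    refine Subtype.ext (Prod.ext ?_ ?_)
    · exact e1
    · have hz : z.1.2.im = ‖z.1.1‖ ^ γ := z.2
      simp only [graphMap, e1, ← hz]
      rw [mul_comm]
      exact Complex.re_add_im _
  measurable_toFun := (measurable_graphMap γ).comp
    (((measurable_radialPow _).comp measurable_fst).prodMk measurable_snd)
  measurable_invFun := ((measurable_radialPow _).comp
    (measurable_fst.comp measurable_subtype_coe)).prodMk
      (Complex.measurable_re.comp (measurable_snd.comp measurable_subtype_coe))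

theorem chart_apply {γ : ℝ} (hγ : 1 < γ) (p : ℂ × ℝ) :
    ((chart hγ p : M γ) : ℂ × ℂ) =
      (radialPow (2 / γ) p.1, (p.2 : ℂ) + Complex.I * (‖p.1‖ ^ 2 : ℝ)) := by
  have h : 2 / γ ≠ 0 := by positivity
  change ((graphMap γ (radialPow (2 / γ) p.1, p.2) : M γ) : ℂ × ℂ) = _
  simp only [graphMap]
  rw [norm_radialPow h, ← Real.rpow_mul (norm_nonneg _), div_mul_cancel₀ _ (by positivity),
    Real.rpow_two]

theorem conj_radialPow_mul_rpow {γ : ℝ} (hγ : 1 < γ) (x : ℂ) :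
    conj (radialPow (2 / γ) x) * ((‖radialPow (2 / γ) x‖ ^ (γ - 2) : ℝ) : ℂ) =
      conj (radialPow (2 - 2 / γ) x) := by
  rcases eq_or_ne x 0 with rfl | hx
  · simp [radialPow_zero]
  have hx' : 0 < ‖x‖ := norm_pos_iff.2 hx
  have hγ0 : γ ≠ 0 := by positivity
  rw [norm_radialPow (by positivity), radialPow, radialPow, map_mul, map_mul, Complex.conj_ofReal,
    Complex.conj_ofReal, mul_assoc, ← Complex.ofReal_mul, ← Real.rpow_mul hx'.le,
    ← Real.rpow_add hx']
  congr 3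
  field_simp
  ring

/-- The Leray denominator in the coordinates `chart`. -/
theorem bracket_lift_chart {γ : ℝ} (hγ : 1 < γ) (ε : ℝ) (q p : ℂ × ℝ) :
    bracket γ (lift ε (chart hγ q)) (chart hγ p) = denom (lerayPhase γ) ε q p := by
  have h1 := conj_radialPow_mul_rpow hγ p.1
  have h2 : conj (radialPow (2 - 2 / γ) p.1) * radialPow (2 / γ) p.1 = ((‖p.1‖ ^ 2 : ℝ) : ℂ) := by
    rcases eq_or_ne p.1 0 with hx | hx
    · simp [hx, radialPow_zero]
    have hx' : 0 < ‖p.1‖ := norm_pos_iff.2 hx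
    rw [radialPow, radialPow, map_mul, Complex.conj_ofReal, mul_mul_mul_comm,
      ← Complex.normSq_eq_conj_mul_self, ← Complex.ofReal_mul, ← Real.rpow_add hx',
      Complex.normSq_eq_norm_sq]
    ring_nf
    simp
  rw [bracket, lift, chart_apply, chart_apply, denom, lerayPhase]
  simp only
  rw [mul_assoc (γ : ℂ), h1]
  have h3 : (γ : ℂ) * conj (radialPow (2 - 2 / γ) p.1) *
      (radialPow (2 / γ) p.1 - radialPow (2 / γ) q.1) = γ * ((‖p.1‖ ^ 2 : ℝ) : ℂ) -
      γ * (conj (radialPow (2 - 2 / γ) p.1) * radialPow (2 / γ) q.1) := by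
    rw [← h2]; ring
  rw [h3]
  push_cast
  linear_combination (-(‖q.1‖ : ℂ) ^ 2 + (‖p.1‖ : ℂ) ^ 2 - ε) * Complex.I_sq

/-- The measures `μ_r` in the coordinates `chart`. -/
theorem mu_eq_map_chart {γ : ℝ} (hγ : 1 < γ) (r : ℝ) :
    mu γ r = ENNReal.ofReal (2 / γ) •
      (weightedVolume (2 / γ * (r + 1) - 2)).map (chart hγ) := by
  have hκ : 0 < 2 / γ := by positivity
  refine Measure.ext_of_lintegral _ fun F hF => ?_
  have hG : Measurable fun p : ℂ × ℝ => F (graphMap γ p) := hF.comp (measurable_graphMap γ)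
  have hm := measurable_radialPow (2 / γ)
  have hw : Measurable fun p : ℂ × ℝ => ENNReal.ofReal (‖p.1‖ ^ (r - 1)) := by fun_prop
  have hwG := hw.mul hG
  have hc : Measurable fun p : ℂ × ℝ => F (chart hγ p) := hF.comp (chart hγ).measurable
  rw [mu, lintegral_map hF (measurable_graphMap γ),
    lintegral_withDensity_eq_lintegral_mul _ (by fun_prop) hG, lintegral_smul_measure,
    lintegral_map hF (chart hγ).measurable, lintegral_weightedVolume' _ hc,
    Measure.volume_eq_prod, lintegral_prod_symm _ hwG.aemeasurable,
    lintegral_prod_symm _ (by fun_prop), smul_eq_mul,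
    ← lintegral_const_mul' _ _ ENNReal.ofReal_ne_top]
  refine lintegral_congr fun s => ?_
  refine (lintegral_comp_radialPow hκ (hwG.comp (f := fun x : ℂ => (x, s))
    (by fun_prop))).symm.trans ?_
  rw [← lintegral_const_mul' _ _ ENNReal.ofReal_ne_top]
  refine lintegral_congr_ae ?_
  filter_upwards [Measure.ae_ne volume (0 : ℂ)] with x hx
  have hx' : 0 < ‖x‖ := norm_pos_iff.2 hx
  have e : F (chart hγ (x, s)) = F (graphMap γ (radialPow (2 / γ) x, s)) := rfl
  simp only [e]
  change _ * (ENNReal.ofReal (‖radialPow (2 / γ) x‖ ^ (r - 1)) *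
    F (graphMap γ (radialPow (2 / γ) x, s))) = _
  rw [← mul_assoc, ← mul_assoc, norm_radialPow hκ.ne', ← Real.rpow_mul hx'.le, ← ofReal_norm,
    ENNReal.ofReal_rpow_of_pos hx', ← ENNReal.ofReal_mul hκ.le, ← ENNReal.ofReal_mul (by positivity),
    mul_assoc, ← Real.rpow_add hx']
  congr 4
  ring

theorem weightedVolume_zero : weightedVolume 0 = volume := by
  simp [weightedVolume]

theorem sigma_eq_map_chart {γ : ℝ} (hγ : 1 < γ) :
    sigma γ = ENNReal.ofReal (2 / γ) • (volume : Measure (ℂ × ℝ)).map (chart hγ) := by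
  rw [sigma, mu_eq_map_chart hγ, ← weightedVolume_zero]
  congr 3
  field_simp
  ring

theorem dualMap_chart {γ : ℝ} (hγ : 1 < γ) (p : ℂ × ℝ) :
    dualMap hγ (chart hγ p) = chart (one_lt_dualExp hγ) (conj p.1, (1 - γ)⁻¹ * p.2) := by
  have h1 : (1 - (γ : ℂ)) ≠ 0 := by
    have : (1 - γ) ≠ 0 := by linarith
    exact_mod_cast this
  have h2 : γ - 1 ≠ 0 := by linarith
  have hγ0 : γ ≠ 0 := by positivity
  refine Subtype.ext ?_
  rw [chart_apply]
  change dualPoint γ (chart hγ p : M γ) = _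
  rw [chart_apply, dualPoint]
  refine Prod.ext ?_ ?_
  · simp only
    rw [conj_radialPow_mul_rpow hγ, conj_radialPow]
    congr 1
    rw [dualExp]
    field_simp
  · simp only
    rw [norm_radialPow (by positivity), ← Real.rpow_mul (norm_nonneg _), div_mul_cancel₀ _ hγ0,
      Real.rpow_two, RCLike.norm_conj]
    push_cast
    field_simp
    ring

/-- The duality map carries `σ` on `M_γ` to `σ` on `M_{γ*}`. -/
theorem map_dualMap_sigma {γ : ℝ} (hγ : 1 < γ) :
    (sigma γ).map (dualMap hγ) = sigma (dualExp γ) := by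
  have h1 : 1 - γ ≠ 0 := by linarith
  set T : ℂ × ℝ → ℂ × ℝ := Prod.map conj (fun s => (1 - γ)⁻¹ * s) with hT
  have hconj : MeasurePreserving (fun z : ℂ => conj z) volume volume :=
    Complex.conjLIE.measurePreserving
  have hTm : Measurable T := hconj.measurable.prodMap (by fun_prop)
  have hTv : (volume : Measure (ℂ × ℝ)).map T = ENNReal.ofReal (γ - 1) • volume := by
    rw [hT, Measure.volume_eq_prod, ← Measure.map_prod_map _ _ hconj.measurable (by fun_prop),
      hconj.map_eq, Real.map_volume_mul_left (inv_ne_zero h1), inv_inv, Measure.prod_smul_right,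
      abs_of_neg (by linarith), neg_sub]
  have hcomp : dualMap hγ ∘ chart hγ = chart (one_lt_dualExp hγ) ∘ T :=
    funext fun p => dualMap_chart hγ p
  rw [sigma_eq_map_chart hγ, sigma_eq_map_chart (one_lt_dualExp hγ), Measure.map_smul,
    Measure.map_map (dualMap hγ).measurable (chart hγ).measurable, hcomp,
    ← Measure.map_map (chart _).measurable hTm, hTv, Measure.map_smul, smul_smul,
    ← ENNReal.ofReal_mul (by positivity)]
  congr 2
  have : γ - 1 ≠ 0 := by linarith
  rw [dualExp]
  field_simp

end DualLeray
end

noncomputable section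
namespace DualLeray
open scoped Real

/-- A measure which is a multiple of `|y|^m dy ds`, `|m| < 2`, in the coordinates `chart`. -/
structure IsPowerMeasure {γ : ℝ} (hγ : 1 < γ) (m : ℝ) (k : ℝ≥0∞) (μ : Measure (M γ)) : Prop where
  eq : μ = k • (weightedVolume m).map (chart hγ)
  ne_zero : k ≠ 0
  ne_top : k ≠ ∞
  lower : -2 < m
  upper : m < 2

theorem isPowerMeasure_sigma {γ : ℝ} (hγ : 1 < γ) :
    IsPowerMeasure hγ 0 (ENNReal.ofReal (2 / γ)) (sigma γ) where
  eq := by rw [sigma_eq_map_chart hγ, weightedVolume_zero]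
  ne_zero := by
    rw [Ne, ENNReal.ofReal_eq_zero, not_le]
    positivity
  ne_top := ENNReal.ofReal_ne_top
  lower := by norm_num
  upper := by norm_num

theorem isPowerMeasure_smul_mu {γ : ℝ} (hγ : 1 < γ) {r k : ℝ} (hk : 0 < k) (h1 : -1 < r)
    (h2 : r < 2 * γ - 1) :
    IsPowerMeasure hγ (2 / γ * (r + 1) - 2) (ENNReal.ofReal k * ENNReal.ofReal (2 / γ))
      (ENNReal.ofReal k • mu γ r) where
  eq := by rw [mu_eq_map_chart hγ, smul_smul]
  ne_zero := by
    rw [← ENNReal.ofReal_mul hk.le, Ne, ENNReal.ofReal_eq_zero, not_le]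
    positivity
  ne_top := ENNReal.mul_ne_top ENNReal.ofReal_ne_top ENNReal.ofReal_ne_top
  lower := by
    have : 0 < 2 / γ * (r + 1) := mul_pos (by positivity) (by linarith)
    linarith
  upper := by
    have hγ0 : 0 < γ := by linarith
    have : 2 / γ * (r + 1) < 4 := by
      rw [div_mul_eq_mul_div, div_lt_iff₀ hγ0]
      linarith
    linarith

variable {γ m : ℝ} {hγ : 1 < γ} {k : ℝ≥0∞} {μ : Measure (M γ)} {f g : M γ → ℂ} {ε : ℝ}

theorem IsPowerMeasure.lintegral (hμ : IsPowerMeasure hγ m k μ) (F : M γ → ℝ≥0∞) :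
    ∫⁻ z, F z ∂μ = k * ∫⁻ p, F (chart hγ p) ∂(weightedVolume m) := by
  rw [hμ.eq, lintegral_smul_measure, lintegral_map_equiv, smul_eq_mul]

theorem volume_absolutelyContinuous_weightedVolume (m : ℝ) :
    (volume : Measure (ℂ × ℝ)) ≪ weightedVolume m := by
  refine withDensity_absolutelyContinuous' (by fun_prop) ?_
  filter_upwards [ae_fst_ne_zero] with p hp
  have h : ‖p.1‖ₑ ≠ 0 := by simpa using hp
  simp [ENNReal.rpow_eq_zero_iff, h]

theorem IsPowerMeasure.absolutelyContinuous_map_volume (hμ : IsPowerMeasure hγ m k μ) :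
    (volume : Measure (ℂ × ℝ)).map (chart hγ) ≪ μ := by
  rw [hμ.eq]
  exact ((volume_absolutelyContinuous_weightedVolume m).map (chart hγ).measurable).trans
    (Measure.absolutelyContinuous_smul hμ.ne_zero)

theorem IsPowerMeasure.absolutelyContinuous_of_volume (hμ : IsPowerMeasure hγ m k μ) :
    μ ≪ (volume : Measure (ℂ × ℝ)).map (chart hγ) := by
  rw [hμ.eq]
  exact Measure.smul_absolutelyContinuous.trans
    ((withDensity_absolutelyContinuous _ _).map (chart hγ).measurable)

/-- All power measures have the same null sets. -/
theorem IsPowerMeasure.absolutelyContinuous {m' : ℝ} {k' : ℝ≥0∞} {μ' : Measure (M γ)}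
    (hμ : IsPowerMeasure hγ m k μ) (hμ' : IsPowerMeasure hγ m' k' μ') : μ ≪ μ' :=
  hμ.absolutelyContinuous_of_volume.trans hμ'.absolutelyContinuous_map_volume

/-- The Leray integral in the coordinates `chart`. -/
theorem lerayIntegral_lift (hγ : 1 < γ) (f : M γ → ℂ) (ε : ℝ) (z : M γ) :
    lerayIntegral γ f (lift ε z) = ((γ / (2 * π ^ 2) : ℝ) : ℂ) *
      kernelOp (lerayPhase γ) ε (fun p => f (chart hγ p)) ((chart hγ).symm z) := by
  obtain ⟨q, rfl⟩ := (chart hγ).surjective z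
  have hγ0 : γ ≠ 0 := by positivity
  rw [lerayIntegral, sigma_eq_map_chart hγ, integral_smul_measure,
    (chart hγ).measurableEmbedding.integral_map, ENNReal.toReal_ofReal (by positivity),
    MeasurableEquiv.symm_apply_apply, Complex.real_smul, ← mul_assoc, ← Complex.ofReal_mul, kernelOp]
  simp_rw [bracket_lift_chart hγ]
  congr 2
  field_simp
  norm_num

theorem IsPowerMeasure.lintegral_comp_chart_lt_top (hμ : IsPowerMeasure hγ m k μ)
    (hf : MemLp f 2 μ) : ∫⁻ p, ‖f (chart hγ p)‖ₑ ^ 2 ∂(weightedVolume m) < ∞ := by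
  have h := ENNReal.pow_lt_top hf.2 (n := 2)
  rw [eLpNorm_two_sq, hμ.lintegral] at h
  exact (ENNReal.lt_top_of_mul_ne_top_right h.ne hμ.ne_zero)

theorem IsPowerMeasure.integrable_div_bracket_sq_of_measurable (hμ : IsPowerMeasure hγ m k μ)
    (hε : 0 < ε) (hfm : Measurable f) (hf : MemLp f 2 μ) (z : M γ) :
    Integrable (fun ζ : M γ => f ζ / bracket γ (lift ε z) ζ ^ 2) (sigma γ) := by
  obtain ⟨q, rfl⟩ := (chart hγ).surjective z
  rw [sigma_eq_map_chart hγ]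
  refine Integrable.smul_measure ?_ ENNReal.ofReal_ne_top
  rw [(chart hγ).measurableEmbedding.integrable_map_iff]
  simp only [Function.comp_def, bracket_lift_chart hγ]
  exact integrable_div_denom_sq (isGaussianPhase_lerayPhase hγ) hε hμ.lower hμ.upper
    (hfm.comp (chart hγ).measurable) (hμ.lintegral_comp_chart_lt_top hf) q

theorem measurable_lerayIntegral_lift (hγ : 1 < γ) (ε : ℝ) (hf : Measurable f) :
    Measurable fun z : M γ => lerayIntegral γ f (lift ε z) := by
  simp only [lerayIntegral_lift hγ]
  exact ((measurable_kernelOp (isGaussianPhase_lerayPhase hγ) ε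
    (hf.comp (chart hγ).measurable)).comp (chart hγ).symm.measurable).const_mul _

theorem lerayIntegral_congr_ae (h : f =ᵐ[sigma γ] g) (z : ℂ × ℂ) :
    lerayIntegral γ f z = lerayIntegral γ g z := by
  rw [lerayIntegral, lerayIntegral]
  congr 1
  refine integral_congr_ae ?_
  filter_upwards [h] with ζ hζ
  rw [hζ]

theorem kernelOp_const_mul (B : ℂ → ℂ → ℂ) (ε : ℝ) (a : ℂ) (u : ℂ × ℝ → ℂ) (q : ℂ × ℝ) :
    kernelOp B ε (fun p => a * u p) q = a * kernelOp B ε u q := by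
  rw [kernelOp, kernelOp, ← integral_const_mul]
  simp_rw [mul_div_assoc]

/-- On every power measure space the regularized Leray integrals converge strongly, and the limit
is a bounded projection. -/
theorem IsPowerMeasure.exists_leray (hμ : IsPowerMeasure hγ m k μ) :
    ∃ T : Lp ℂ 2 μ →L[ℂ] Lp ℂ 2 μ, (∀ f : Lp ℂ 2 μ, IsLeray γ μ f (T f)) ∧ T ∘L T = T := by
  have hB := isGaussianPhase_lerayPhase hγ
  have hc : 0 < γ * min (1 / γ) (1 - 1 / γ) / 2 := hB.pos
  set k₀ : ℝ := γ / (2 * π ^ 2) with hk₀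
  obtain ⟨C₁, hC₁, hbt⟩ := exists_kernelOp_bound_test hc hμ.lower hμ.upper
  obtain ⟨C, hC, hb⟩ := exists_kernelOp_bound hc hμ.lower hμ.upper
  have hen : ∀ a : ℂ, ‖(k₀ : ℂ) * a‖ₑ ^ 2 = ‖(k₀ : ℂ)‖ₑ ^ 2 * ‖a‖ₑ ^ 2 := fun a => by
    rw [enorm_mul, mul_pow]
  have hk₀t : ‖(k₀ : ℂ)‖ₑ ^ 2 ≠ ∞ := ENNReal.pow_ne_top enorm_ne_top
  have hσ := isPowerMeasure_sigma hγ
  refine exists_lp_strong_limit (fun ε f z => lerayIntegral γ f (lift ε z))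
    (C := ‖(k₀ : ℂ)‖ₑ ^ 2 * C) (ENNReal.mul_ne_top hk₀t hC)
    (fun ε hε f g hfg => funext fun z => lerayIntegral_congr_ae (hσ.absolutelyContinuous hμ hfg) _)
    (fun ε hε f g hfm hgm hf hg => funext fun z => ?_)
    (fun ε hε a f => funext fun z => ?_)
    (fun ε hε f hf => measurable_lerayIntegral_lift hγ ε hf)
    (fun ε hε f hfm hf => ?_)
    {g | Measurable g ∧ MemLp g 2 μ ∧ IsBoundedTest fun p => g (chart hγ p)}
    (fun g hg => ⟨hg.1, hg.2.1⟩) (fun f hfm hf => ?_) (fun g hg => ?_)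
    (fun g hg ε ε' hε hε' => funext fun z => ?_)
  · change _ = lerayIntegral γ f (lift ε z) + lerayIntegral γ g (lift ε z)
    rw [lerayIntegral, lerayIntegral, lerayIntegral, ← mul_add, ← integral_add
      (hμ.integrable_div_bracket_sq_of_measurable hε hfm hf z)
      (hμ.integrable_div_bracket_sq_of_measurable hε hgm hg z)]
    simp_rw [Pi.add_apply, add_div]
  · change _ = a * lerayIntegral γ f (lift ε z)
    rw [lerayIntegral, lerayIntegral, mul_left_comm, ← integral_const_mul a]
    simp_rw [Pi.smul_apply, smul_eq_mul, mul_div_assoc]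
  · rw [hμ.lintegral, hμ.lintegral]
    simp only [lerayIntegral_lift hγ, MeasurableEquiv.symm_apply_apply]
    simp_rw [← hk₀, hen]
    rw [lintegral_const_mul' _ _ hk₀t]
    calc _ ≤ k * (‖(k₀ : ℂ)‖ₑ ^ 2 * (C * ∫⁻ p, ‖f (chart hγ p)‖ₑ ^ 2 ∂(weightedVolume m))) := by
          gcongr
          exact hb _ hB _ (hfm.comp (chart hγ).measurable) (hμ.lintegral_comp_chart_lt_top hf) ε hε
      _ = _ := by ring
  · set u : ℂ × ℝ → ℂ := fun p => f (chart hγ p) with hu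
    have hfc : Measurable u := hfm.comp (chart hγ).measurable
    have hfin := hμ.lintegral_comp_chart_lt_top hf
    refine ⟨fun n z => truncate u n ((chart hγ).symm z), fun n => ⟨?_, ?_, ?_⟩, ?_⟩
    · exact (isBoundedTest_truncate hfc n).measurable.comp (chart hγ).symm.measurable
    · refine hf.mono ((isBoundedTest_truncate hfc n).measurable.comp
        (chart hγ).symm.measurable).aestronglyMeasurable (ae_of_all _ fun z => ?_)
      refine (norm_truncate_le u n _).trans ?_
      simp [hu]
    · simpa using isBoundedTest_truncate hfc n
    · have h := ENNReal.Tendsto.const_mul (tendsto_truncate m hfc hfin) (Or.inr hμ.ne_top)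
      rw [mul_zero] at h
      refine h.congr fun n => ?_
      rw [hμ.lintegral]
      simp [hu]
  · have hfin := hμ.lintegral_comp_chart_lt_top hg.2.1
    obtain ⟨h, h0, hle⟩ := exists_kernelOp_cauchy_test (m := m) hB hg.2.2
      ((hbt _ hB _ hg.2.2).1.trans_lt (ENNReal.mul_lt_top hC₁.lt_top hfin)).ne
    refine ⟨fun ε => k * (‖(k₀ : ℂ)‖ₑ ^ 2 * h ε), ?_, fun ε ε' hε hε' => ?_⟩
    · have := ENNReal.Tendsto.const_mul (ENNReal.Tendsto.const_mul h0 (Or.inr hk₀t))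
        (Or.inr hμ.ne_top)
      simpa using this
    · rw [hμ.lintegral]
      simp only [lerayIntegral_lift hγ, MeasurableEquiv.symm_apply_apply]
      simp_rw [← hk₀, ← mul_sub, hen]
      rw [lintegral_const_mul' _ _ hk₀t, ← mul_add, ← mul_add]
      gcongr
      exact hle ε ε' hε hε'
  · simp only [lerayIntegral_lift hγ, MeasurableEquiv.symm_apply_apply]
    rw [kernelOp_const_mul, kernelOp_kernelOp hB (isReproducing_lerayPhase hγ) hg.2.2 hε hε',
      ← mul_assoc, ← mul_assoc, ← Complex.ofReal_mul, ← Complex.ofReal_mul]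
    congr 2
    have hγ0 : γ ≠ 0 := by positivity
    have := Real.pi_ne_zero
    field_simp

end DualLeray
end

noncomputable section
namespace DualLeray
open scoped Real

section Lp

variable {Y : Type*} [MeasurableSpace Y] {μ ν : Measure Y}

theorem Lp_star_add (f g : Lp ℂ 2 μ) : star (f + g) = star f + star g := by
  refine Lp.ext ?_
  filter_upwards [Lp.coeFn_star (f + g), Lp.coeFn_add f g, Lp.coeFn_add (star f) (star g),
    Lp.coeFn_star f, Lp.coeFn_star g] with y h1 h2 h3 h4 h5
  rw [h1, h3, Pi.star_apply, h2, Pi.add_apply, Pi.add_apply, h4, h5, star_add]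
  rfl

theorem Lp_star_smul (a : ℂ) (f : Lp ℂ 2 μ) : star (a • f) = conj a • star f := by
  refine Lp.ext ?_
  filter_upwards [Lp.coeFn_star (a • f), Lp.coeFn_smul a f, Lp.coeFn_smul (conj a) (star f),
    Lp.coeFn_star f] with y h1 h2 h3 h4
  rw [h1, h3, Pi.star_apply, h2, Pi.smul_apply, Pi.smul_apply, h4, star_smul]
  rfl

theorem Lp_norm_star (f : Lp ℂ 2 μ) : ‖star f‖ = ‖f‖ := by
  rw [Lp.norm_def, Lp.norm_def]
  congr 1
  refine eLpNorm_congr_norm_ae ?_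
  filter_upwards [Lp.coeFn_star f] with y h
  rw [h, Pi.star_apply, norm_star]

/-- The conjugate `𝔠 ∘ T ∘ 𝔠` of a bounded operator. -/
def conjOperator (T : Lp ℂ 2 μ →L[ℂ] Lp ℂ 2 μ) : Lp ℂ 2 μ →L[ℂ] Lp ℂ 2 μ :=
  LinearMap.mkContinuous
    { toFun := fun g => star (T (star g))
      map_add' := fun f g => by rw [Lp_star_add, map_add, Lp_star_add]
      map_smul' := fun a f => by
        rw [Lp_star_smul, map_smul, Lp_star_smul, Complex.conj_conj, RingHom.id_apply] }
    ‖T‖ fun g => by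
      change ‖star (T (star g))‖ ≤ _
      rw [Lp_norm_star]
      exact (T.le_opNorm _).trans_eq (by rw [Lp_norm_star])

theorem conjOperator_apply (T : Lp ℂ 2 μ →L[ℂ] Lp ℂ 2 μ) (g : Lp ℂ 2 μ) :
    conjOperator T g = star (T (star g)) := rfl

/-- Limits in the means with respect to two measures agree almost everywhere. -/
theorem ae_eq_of_tendsto_eLpNorm {u : ℝ → Y → ℂ} {F G : Y → ℂ} (hνμ : ν ≪ μ)
    (hu : ∀ ε, Measurable (u ε)) (hF : AEStronglyMeasurable F μ) (hG : AEStronglyMeasurable G ν)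
    (h1 : Tendsto (fun ε => eLpNorm (fun y => u ε y - F y) 2 μ) (𝓝[>] 0) (𝓝 0))
    (h2 : Tendsto (fun ε => eLpNorm (fun y => u ε y - G y) 2 ν) (𝓝[>] 0) (𝓝 0)) : F =ᵐ[ν] G := by
  obtain ⟨ns, hns, hF'⟩ := (tendstoInMeasure_of_tendsto_eLpNorm two_ne_zero
    (fun ε => (hu ε).aestronglyMeasurable) hF h1).exists_seq_tendsto_ae'
  obtain ⟨ms, hms, hG'⟩ := (tendstoInMeasure_of_tendsto_eLpNorm two_ne_zero
    (fun n => (hu (ns n)).aestronglyMeasurable) hG (h2.comp hns)).exists_seq_tendsto_ae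
  filter_upwards [hνμ hF', hG'] with y hy1 hy2
  exact tendsto_nhds_unique (hy1.comp hms.tendsto_atTop) hy2

theorem tendsto_integral_mul_of_tendsto_eLpNorm {u : ℝ → Y → ℂ} {F g : Y → ℂ}
    (hu : ∀ ε, Measurable (u ε)) (hF : MemLp F 2 μ) (hg : MemLp g 2 μ)
    (h : Tendsto (fun ε => eLpNorm (fun y => u ε y - F y) 2 μ) (𝓝[>] 0) (𝓝 0))
    (hint : ∀ ε, 0 < ε → Integrable (fun y => u ε y * g y) μ) :
    Tendsto (fun ε => ∫ y, u ε y * g y ∂μ) (𝓝[>] 0) (𝓝 (∫ y, F y * g y ∂μ)) := by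
  refine tendsto_integral_of_L1 _ (hF.1.mul hg.1) ?_ ?_
  · filter_upwards [self_mem_nhdsWithin] with ε hε using hint ε hε
  · refine tendsto_of_tendsto_of_tendsto_of_le_of_le' tendsto_const_nhds
      (h := fun ε => eLpNorm (fun y => u ε y - F y) 2 μ * eLpNorm g 2 μ) ?_
      (Eventually.of_forall fun ε => bot_le) (Eventually.of_forall fun ε => ?_)
    · simpa using ENNReal.Tendsto.mul_const h (Or.inr hg.2.ne)
    · have := eLpNorm_le_eLpNorm_mul_eLpNorm_of_nnnorm (p := 2) (q := 2) (r := 1)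
        (((hu ε).aestronglyMeasurable (μ := μ)).sub hF.1) hg.1 (fun a b => a * b) 1
        (ae_of_all _ fun y => by simp)
      rw [eLpNorm_one_eq_lintegral_enorm] at this
      simp only [ENNReal.coe_one, one_mul] at this
      refine le_trans (le_of_eq ?_) this
      refine lintegral_congr fun y => ?_
      rw [Pi.sub_apply, sub_mul]
      rfl

end Lp

variable {γ m : ℝ} {hγ : 1 < γ} {k : ℝ≥0∞} {μ : Measure (M γ)} {f g : M γ → ℂ} {ε : ℝ}

/-- A boundary value of the Leray integral is the Leray transform. -/
theorem lerayTransform_eq (hγ : 1 < γ) {f F : Lp ℂ 2 μ} (h : IsLeray γ μ f F) :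
    lerayTransform γ μ f = F := by
  have hex : ∃ F : Lp ℂ 2 μ, IsLeray γ μ f F := ⟨F, h⟩
  rw [lerayTransform, dif_pos hex]
  refine Lp.ext (ae_eq_of_tendsto_eLpNorm Measure.AbsolutelyContinuous.rfl
    (fun ε => measurable_lerayIntegral_lift hγ ε (Lp.stronglyMeasurable f).measurable)
    (Lp.aestronglyMeasurable _) (Lp.aestronglyMeasurable _) hex.choose_spec h)

/-- The Leray transform of a power measure space is a bounded projection. -/
theorem IsPowerMeasure.exists_lerayTransform (hμ : IsPowerMeasure hγ m k μ) :
    ∃ T : Lp ℂ 2 μ →L[ℂ] Lp ℂ 2 μ, (∀ f, T f = lerayTransform γ μ f) ∧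
      (∀ f : Lp ℂ 2 μ, IsLeray γ μ f (T f)) ∧ T ∘L T = T := by
  obtain ⟨T, h1, h2⟩ := hμ.exists_leray
  exact ⟨T, fun f => (lerayTransform_eq hγ (h1 f)).symm, h1, h2⟩

theorem conj_mul_rpow_mul_self (hγ : 1 < γ) (x : ℂ) :
    conj x * ((‖x‖ ^ (γ - 2) : ℝ) : ℂ) * x = ((‖x‖ ^ γ : ℝ) : ℂ) := by
  rcases eq_or_ne x 0 with rfl | hx
  · simp [Real.zero_rpow (by linarith : γ ≠ 0)]
  have hx' : 0 < ‖x‖ := norm_pos_iff.2 hx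
  rw [mul_right_comm, ← Complex.normSq_eq_conj_mul_self, ← Complex.ofReal_mul,
    Complex.normSq_eq_norm_sq, ← Real.rpow_two, ← Real.rpow_add hx']
  ring_nf

/-- Under the duality map the two arguments of the Leray kernel are interchanged. -/
theorem bracket_dualMap (hγ : 1 < γ) (e : ℝ) (z ζ : M γ) :
    bracket (dualExp γ) (lift e (dualMap hγ z)) (dualMap hγ ζ) =
      bracket γ (lift ((γ - 1) * e) ζ) z / ((γ : ℂ) - 1) := by
  have hc : (γ : ℂ) - 1 ≠ 0 := by
    have h : γ - 1 ≠ 0 := by linarith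
    exact_mod_cast h
  have hc' : 1 - (γ : ℂ) ≠ 0 := by rw [← neg_sub]; exact neg_ne_zero.mpr hc
  have h1 : conj (dualPoint γ ζ).1 * ((‖(dualPoint γ ζ).1‖ ^ (dualExp γ - 2) : ℝ) : ℂ) =
      (ζ : ℂ × ℂ).1 := congrArg Prod.fst (dualPoint_dualPoint hγ ζ)
  change bracket (dualExp γ) (lift e (dualPoint γ z)) (dualPoint γ ζ) = _
  rw [bracket, bracket, mul_assoc (dualExp γ : ℂ), h1]
  have hζ := conj_mul_rpow_mul_self hγ (ζ : ℂ × ℂ).1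
  have hz := conj_mul_rpow_mul_self hγ (z : ℂ × ℂ).1
  simp only [lift, dualPoint]
  rw [← hζ, ← hz]
  have e1 : (dualExp γ : ℂ) = (γ : ℂ) / ((γ : ℂ) - 1) := by
    unfold dualExp; push_cast; ring
  rw [e1]
  field_simp
  push_cast
  linear_combination (γ * (1 - γ) * (conj (ζ : ℂ × ℂ).1 * ((‖(ζ : ℂ × ℂ).1‖ ^ (γ - 2) : ℝ) : ℂ) *
    (ζ : ℂ × ℂ).1 - conj (z : ℂ × ℂ).1 * ((‖(z : ℂ × ℂ).1‖ ^ (γ - 2) : ℝ) : ℂ) *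
    (z : ℂ × ℂ).1)) * Complex.I_sq

variable {ν : Measure (M (dualExp γ))}

theorem dualIntegral_eq (hγ : 1 < γ) (g : M γ → ℂ) (ε : ℝ) (z : M γ) :
    dualIntegral γ g ε z = lerayIntegral (dualExp γ) (fun ω => g ((dualMap hγ).symm ω))
      (lift (ε / (γ - 1)) (dualMap hγ z)) := by
  have h0 : γ - 1 ≠ 0 := by linarith
  have hc : (γ : ℂ) - 1 ≠ 0 := by exact_mod_cast h0
  rw [dualIntegral, lerayIntegral, ← map_dualMap_sigma hγ, integral_map_equiv]
  simp only [bracket_dualMap, MeasurableEquiv.symm_apply_apply, dualIntegrand,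
    mul_div_cancel₀ _ h0]
  rw [← integral_const_mul, ← integral_const_mul]
  refine integral_congr_ae (ae_of_all _ fun ζ => ?_)
  simp only [dualExp]
  push_cast
  field_simp

theorem measurable_dualIntegral (hγ : 1 < γ) (ε : ℝ) (hg : Measurable g) :
    Measurable (dualIntegral γ g ε) := by
  have e : dualIntegral γ g ε = fun z => dualIntegral γ g ε z := rfl
  rw [e]
  simp only [dualIntegral_eq hγ]
  exact (measurable_lerayIntegral_lift (one_lt_dualExp hγ) _
    (hg.comp (dualMap hγ).symm.measurable)).comp (dualMap hγ).measurable

theorem dualIntegral_congr_ae (h : f =ᵐ[sigma γ] g) (ε : ℝ) (z : M γ) :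
    dualIntegral γ f ε z = dualIntegral γ g ε z := by
  rw [dualIntegral, dualIntegral]
  congr 1
  refine integral_congr_ae ?_
  filter_upwards [h] with ζ hζ
  rw [dualIntegrand, dualIntegrand, hζ]

theorem IsPowerMeasure.integrable_dualIntegrand (hν : IsPowerMeasure (one_lt_dualExp hγ) m k ν)
    (h : MeasurePreserving (dualMap hγ) μ ν) (hgm : Measurable g) (hg : MemLp g 2 μ) (hε : 0 < ε)
    (z : M γ) : Integrable (dualIntegrand γ g ε z) (sigma γ) := by
  have h0 : 0 < γ - 1 := by linarith
  have hc : (γ : ℂ) - 1 ≠ 0 := by exact_mod_cast h0.ne'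
  have h1 := hν.integrable_div_bracket_sq_of_measurable (div_pos hε h0)
    (hgm.comp (dualMap hγ).symm.measurable)
    (hg.comp_measurePreserving (h.symm (dualMap hγ))) (dualMap hγ z)
  rw [← map_dualMap_sigma hγ, integrable_map_equiv] at h1
  refine (h1.const_mul (((γ : ℂ) - 1) ^ 2)⁻¹).congr (ae_of_all _ fun ζ => ?_)
  simp only [Function.comp_apply, bracket_dualMap, MeasurableEquiv.symm_apply_apply, dualIntegrand,
    mul_div_cancel₀ _ h0.ne']
  field_simp

/-- The dual Leray transform as a bounded projection, with its regularized integral formula. -/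
theorem IsPowerMeasure.exists_dualLeray (hν : IsPowerMeasure (one_lt_dualExp hγ) m k ν)
    (h : MeasurePreserving (dualMap hγ) μ ν) :
    ∃ T : Lp ℂ 2 μ →L[ℂ] Lp ℂ 2 μ, (∀ g, T g = dualLeray h g) ∧ T ∘L T = T ∧
      range T = pullback h '' hardySpace (dualExp γ) ν ∧
      ∀ g : Lp ℂ 2 μ, Tendsto (fun ε : ℝ => eLpNorm (fun z : M γ => dualIntegral γ g ε z - T g z)
        2 μ) (𝓝[>] 0) (𝓝 0) := by
  obtain ⟨T₀, hT, hL, hP⟩ := hν.exists_lerayTransform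
  let P := (Lp.compMeasurePreservingₗᵢ (p := 2) ℂ (dualMap hγ) h (E := ℂ)).toContinuousLinearMap
  let Q := (Lp.compMeasurePreservingₗᵢ (p := 2) ℂ (dualMap hγ).symm (h.symm (dualMap hγ))
    (E := ℂ)).toContinuousLinearMap
  have hPa : ∀ G, P G = pullback h G := fun G => rfl
  have hQa : ∀ g, Q g = pushforward h g := fun g => rfl
  have hQc : ∀ g, (Q g : M (dualExp γ) → ℂ) =ᵐ[ν] fun ω => g ((dualMap hγ).symm ω) := fun g =>
    Lp.coeFn_compMeasurePreserving g (h.symm (dualMap hγ))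
  have hPc : ∀ G, (P G : M γ → ℂ) =ᵐ[μ] fun z => G (dualMap hγ z) := fun G =>
    Lp.coeFn_compMeasurePreserving G h
  have hQP : ∀ G, Q (P G) = G := fun G => Lp.ext <| by
    filter_upwards [hQc (P G), (h.symm (dualMap hγ)).quasiMeasurePreserving.ae (hPc G)]
      with ω h1 h2
    rw [h1, h2, MeasurableEquiv.apply_symm_apply]
  have hTd : ∀ g, (P ∘L T₀ ∘L Q) g = dualLeray h g := fun g => by
    rw [dualLeray, ← hQa, ← hT, ← hPa]
    rfl
  have h0 : 0 < γ - 1 := by linarith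
  refine ⟨P ∘L T₀ ∘L Q, hTd, ?_, ?_, fun g => ?_⟩
  · ext1 g
    have h1 : T₀ (T₀ (Q g)) = T₀ (Q g) := DFunLike.congr_fun hP (Q g)
    change P (T₀ (Q (P (T₀ (Q g))))) = P (T₀ (Q g))
    rw [hQP, h1]
  · ext g
    constructor
    · rintro ⟨f, rfl⟩
      exact ⟨T₀ (Q f), ⟨Q f, (hT _).symm⟩, rfl⟩
    · rintro ⟨_, ⟨f, rfl⟩, rfl⟩
      refine ⟨P f, ?_⟩
      change P (T₀ (Q (P f))) = _
      rw [hQP, hT]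
      rfl
  · have hlim : Tendsto (fun ε : ℝ => ε / (γ - 1)) (𝓝[>] 0) (𝓝[>] 0) := by
      refine tendsto_nhdsWithin_iff.2 ⟨?_, ?_⟩
      · have : Tendsto (fun ε : ℝ => ε / (γ - 1)) (𝓝 0) (𝓝 (0 / (γ - 1))) :=
          (continuous_id.div_const _).tendsto 0
        rw [zero_div] at this
        exact this.mono_left nhdsWithin_le_nhds
      · filter_upwards [self_mem_nhdsWithin] with ε hε using div_pos hε h0
    refine ((hL (Q g)).comp hlim).congr fun ε => ?_
    have hm := measurable_lerayIntegral_lift (one_lt_dualExp hγ) (ε / (γ - 1))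
      (Lp.stronglyMeasurable (Q g)).measurable
    have hσ : (Q g : M (dualExp γ) → ℂ) =ᵐ[sigma (dualExp γ)] fun ω => g ((dualMap hγ).symm ω) :=
      ((isPowerMeasure_sigma (one_lt_dualExp hγ)).absolutelyContinuous hν) (hQc g)
    refine (eLpNorm_comp_measurePreserving
      (hm.aestronglyMeasurable.sub (Lp.aestronglyMeasurable (T₀ (Q g)))) h).symm.trans ?_
    refine eLpNorm_congr_ae ?_
    filter_upwards [hPc (T₀ (Q g))] with z hz
    change lerayIntegral _ _ (lift _ (dualMap hγ z)) - T₀ (Q g) (dualMap hγ z) =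
      dualIntegral γ g ε z - P (T₀ (Q g)) z
    rw [hz, dualIntegral_eq hγ, lerayIntegral_congr_ae hσ]

end DualLeray
end

noncomputable section
namespace DualLeray
open scoped Real

variable {γ : ℝ} {hγ : 1 < γ} {μ : Measure (M γ)} {f g : M γ → ℂ} {ε : ℝ}

theorem bracket_lift (ε : ℝ) (z ζ : ℂ × ℂ) :
    bracket γ (lift ε ζ) z = bracket γ ζ z + ε := by
  rw [bracket, bracket, lift]
  linear_combination (-(ε : ℂ)) * Complex.I_sq

theorem bracket_chart (hγ : 1 < γ) (q p : ℂ × ℝ) :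
    bracket γ (chart hγ q) (chart hγ p) = denom (lerayPhase γ) 0 q p := by
  rw [← bracket_lift_chart hγ, bracket_lift, Complex.ofReal_zero, add_zero]

theorem re_bracket_nonneg (hγ : 1 < γ) (z ζ : M γ) : 0 ≤ (bracket γ ζ z).re := by
  obtain ⟨q, rfl⟩ := (chart hγ).surjective ζ
  obtain ⟨p, rfl⟩ := (chart hγ).surjective z
  rw [bracket_chart]
  have hB := isGaussianPhase_lerayPhase hγ
  refine le_trans ?_ (le_re_denom hB 0 q p)
  have := hB.pos
  positivity

theorem norm_bracket_le_norm_bracket_lift (hγ : 1 < γ) (hε : 0 ≤ ε) (z ζ : M γ) :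
    ‖bracket γ ζ z‖ ≤ ‖bracket γ (lift ε ζ) z‖ := by
  have h := re_bracket_nonneg hγ z ζ
  rw [bracket_lift, ← sq_le_sq₀ (norm_nonneg _) (norm_nonneg _), ← Complex.normSq_eq_norm_sq,
    ← Complex.normSq_eq_norm_sq, Complex.normSq_apply, Complex.normSq_apply, Complex.add_re,
    Complex.add_im, Complex.ofReal_re, Complex.ofReal_im]
  nlinarith

theorem le_norm_bracket_lift (hγ : 1 < γ) (ε : ℝ) (z ζ : M γ) :
    ε ≤ ‖bracket γ (lift ε ζ) z‖ := by
  have h := re_bracket_nonneg hγ z ζ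
  refine le_trans ?_ (Complex.re_le_norm _)
  rw [bracket_lift, Complex.add_re, Complex.ofReal_re]
  linarith

theorem ae_bracket_ne_zero (hγ : 1 < γ) (z : M γ) :
    ∀ᵐ ζ : M γ ∂(sigma γ), bracket γ ζ z ≠ 0 := by
  obtain ⟨p, rfl⟩ := (chart hγ).surjective z
  rw [sigma_eq_map_chart hγ]
  refine Measure.ae_smul_measure ?_ _
  rw [(chart hγ).measurableEmbedding.ae_map_iff]
  have h : ∀ᵐ q : ℂ × ℝ, q.1 ≠ p.1 := by
    rw [Measure.volume_eq_prod]
    exact Measure.quasiMeasurePreserving_fst.ae (Measure.ae_ne volume p.1)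
  filter_upwards [h] with q hq h0
  have hB := isGaussianPhase_lerayPhase hγ
  have h1 := hB.le_re p.1 q.1
  have h2 : 0 < ‖p.1 - q.1‖ := norm_pos_iff.2 (sub_ne_zero.2 hq.symm)
  have h3 : (bracket γ (chart hγ q) (chart hγ p)).re = 0 := by rw [h0, Complex.zero_re]
  rw [bracket_chart, denom] at h3
  simp at h3
  have := mul_pos hB.pos (pow_pos h2 2)
  linarith

/-- Where the dual Leray integral converges absolutely, it is the limit of its regularizations. -/
theorem tendsto_dualIntegral (hγ : 1 < γ) (hg : Measurable g) {z : M γ}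
    (hint : Integrable (dualIntegrand γ g 0 z) (sigma γ)) :
    Tendsto (fun ε => dualIntegral γ g ε z) (𝓝[>] 0) (𝓝 (dualIntegral γ g 0 z)) := by
  refine Tendsto.const_mul _ ?_
  have hb : Measurable fun ζ : M γ => bracket γ ζ z := by
    unfold bracket
    have : Measurable fun ζ : M γ => (ζ : ℂ × ℂ) := measurable_subtype_coe
    fun_prop
  have e0 : ∀ ζ : M γ, dualIntegrand γ g 0 z ζ = g ζ / bracket γ ζ z ^ 2 := fun ζ => by
    rw [dualIntegrand, bracket_lift, Complex.ofReal_zero, add_zero]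
  refine tendsto_integral_filter_of_dominated_convergence (fun ζ => ‖dualIntegrand γ g 0 z ζ‖) ?_ ?_
    hint.norm ?_
  · refine Eventually.of_forall fun ε => ?_
    have e : dualIntegrand γ g ε z = fun ζ => g ζ / (bracket γ ζ z + ε) ^ 2 := by
      funext ζ
      rw [dualIntegrand, bracket_lift]
    rw [e]
    exact (hg.div ((hb.add_const _).pow_const 2)).aestronglyMeasurable
  · filter_upwards [self_mem_nhdsWithin] with ε hε
    filter_upwards [ae_bracket_ne_zero hγ z] with ζ hζ
    rw [e0, dualIntegrand, norm_div, norm_div, norm_pow, norm_pow]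
    have := norm_bracket_le_norm_bracket_lift hγ (le_of_lt hε) z ζ
    have h0 := norm_pos_iff.2 hζ
    gcongr
  · filter_upwards [ae_bracket_ne_zero hγ z] with ζ hζ
    rw [e0]
    simp only [dualIntegrand, bracket_lift]
    have : ContinuousAt (fun ε : ℝ => g ζ / (bracket γ ζ z + (ε : ℂ)) ^ 2) 0 := by
      refine ContinuousAt.div (by fun_prop) (by fun_prop) ?_
      simpa using hζ
    have h := this.tendsto.mono_left (nhdsWithin_le_nhds (s := Ioi 0))
    simpa using h

/-- A limit in the mean of the regularized dual Leray integrals agrees almost everywhere with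
the dual Leray integral where this converges absolutely. -/
theorem ae_eq_dualIntegral (hγ : 1 < γ) {F : M γ → ℂ} (hg : Measurable g)
    (hF : AEStronglyMeasurable F μ)
    (h : Tendsto (fun ε : ℝ => eLpNorm (fun z : M γ => dualIntegral γ g ε z - F z) 2 μ)
      (𝓝[>] 0) (𝓝 0)) :
    ∀ᵐ z ∂μ, Integrable (dualIntegrand γ g 0 z) (sigma γ) → F z = dualIntegral γ g 0 z := by
  obtain ⟨ns, hns, hae⟩ := (tendstoInMeasure_of_tendsto_eLpNorm two_ne_zero
    (fun ε => (measurable_dualIntegral hγ ε hg).aestronglyMeasurable) hF h).exists_seq_tendsto_ae'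
  filter_upwards [hae] with z hz hint
  exact tendsto_nhds_unique hz ((tendsto_dualIntegral hγ hg hint).comp hns)

theorem adjointIntegral_eq (g : M γ → ℂ) (ε : ℝ) (z : M γ) :
    adjointIntegral γ g ε z = conj (dualIntegral γ (fun ζ => conj (g ζ)) ε z) := by
  rw [adjointIntegral, dualIntegral, map_mul, Complex.conj_ofReal, ← integral_conj]
  simp [dualIntegrand]

theorem measurable_bracket_lift (ε : ℝ) :
    Measurable fun p : M γ × M γ => bracket γ (lift ε p.1) p.2 := by
  have h1 : Measurable fun p : M γ × M γ => (p.1 : ℂ × ℂ) := by fun_prop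
  have h2 : Measurable fun p : M γ × M γ => (p.2 : ℂ × ℂ) := by fun_prop
  have h3 : Measurable fun p : M γ × M γ => conj (p.2 : ℂ × ℂ).1 :=
    Complex.continuous_conj.measurable.comp (by fun_prop)
  unfold bracket lift
  fun_prop

theorem sFinite_sigma (hγ : 1 < γ) : SFinite (sigma γ) := by
  rw [sigma_eq_map_chart hγ]
  infer_instance

theorem integrable_mul_div_bracket_sq (hγ : 1 < γ) (hε : 0 < ε) (hfm : Measurable f)
    (hgm : Measurable g) (hf : Integrable f (sigma γ)) (hg : Integrable g (sigma γ)) :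
    Integrable (fun p : M γ × M γ => f p.2 * g p.1 / bracket γ (lift ε p.1) p.2 ^ 2)
      ((sigma γ).prod (sigma γ)) := by
  have := sFinite_sigma hγ
  have h1 := (hg.mul_prod hf).mul_const (((ε ^ 2)⁻¹ : ℝ) : ℂ)
  refine h1.mono ?_ (ae_of_all _ fun p => ?_)
  · have := measurable_bracket_lift (γ := γ) ε
    refine Measurable.aestronglyMeasurable ?_
    exact ((hfm.comp measurable_snd).mul (hgm.comp measurable_fst)).div (this.pow_const 2)
  · have h2 := le_norm_bracket_lift hγ ε p.2 p.1
    rw [norm_div, norm_mul, norm_pow, norm_mul, norm_mul, Complex.norm_real,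
      Real.norm_of_nonneg (by positivity), div_eq_mul_inv, mul_comm ‖f _‖]
    gcongr

/-- For integrable functions the regularized Leray and dual Leray integrals are transposes of each
other with respect to `σ`. -/
theorem integral_lerayIntegral_mul (hγ : 1 < γ) (hε : 0 < ε) (hfm : Measurable f)
    (hgm : Measurable g) (hf : Integrable f (sigma γ)) (hg : Integrable g (sigma γ)) :
    Integrable (fun z : M γ => lerayIntegral γ f (lift ε z) * g z) (sigma γ) ∧
    Integrable (fun z : M γ => dualIntegral γ g ε z * f z) (sigma γ) ∧
    ∫ z : M γ, lerayIntegral γ f (lift ε z) * g z ∂(sigma γ) =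
      ∫ z : M γ, dualIntegral γ g ε z * f z ∂(sigma γ) := by
  have := sFinite_sigma hγ
  have h := integrable_mul_div_bracket_sq hγ hε hfm hgm hf hg
  have e1 : ∀ z : M γ, lerayIntegral γ f (lift ε z) * g z = ((γ ^ 2 / (4 * π ^ 2) : ℝ) : ℂ) *
      ∫ ζ : M γ, f ζ * g z / bracket γ (lift ε z) ζ ^ 2 ∂(sigma γ) := fun z => by
    rw [lerayIntegral, mul_assoc, ← integral_mul_const]
    simp_rw [div_mul_eq_mul_div]
  have e2 : ∀ z : M γ, dualIntegral γ g ε z * f z = ((γ ^ 2 / (4 * π ^ 2) : ℝ) : ℂ) *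
      ∫ ζ : M γ, f z * g ζ / bracket γ (lift ε ζ) z ^ 2 ∂(sigma γ) := fun z => by
    rw [dualIntegral, mul_assoc, ← integral_mul_const]
    simp_rw [dualIntegrand, div_mul_eq_mul_div, mul_comm (f z)]
  simp_rw [e1, e2]
  refine ⟨h.integral_prod_left.const_mul _, h.integral_prod_right.const_mul _, ?_⟩
  rw [integral_const_mul, integral_const_mul]
  congr 1
  exact integral_integral_swap h

end DualLeray
end

noncomputable section
namespace DualLeray
open scoped Real

section Lp

variable {Y : Type*} [MeasurableSpace Y] {μ : Measure Y}

theorem Lp_inner_star_left (f g : Lp ℂ 2 μ) : inner ℂ (star f) g = ∫ y, f y * g y ∂μ := by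
  rw [L2.inner_def]
  refine integral_congr_ae ?_
  filter_upwards [Lp.coeFn_star f] with y hy
  rw [hy, Pi.star_apply, RCLike.inner_apply, mul_comm]
  simp

theorem Lp_inner_star_comm (f g : Lp ℂ 2 μ) : inner ℂ (star f) g = inner ℂ (star g) f := by
  rw [Lp_inner_star_left, Lp_inner_star_left]
  simp_rw [mul_comm]

/-- Conjugation commutes with passing to the adjoint. -/
theorem adjoint_conjOperator (L : Lp ℂ 2 μ →L[ℂ] Lp ℂ 2 μ) :
    ContinuousLinearMap.adjoint (conjOperator L) = conjOperator (ContinuousLinearMap.adjoint L) := by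
  refine ((ContinuousLinearMap.eq_adjoint_iff _ _).2 fun x y => ?_).symm
  rw [conjOperator_apply, Lp_inner_star_comm, ContinuousLinearMap.adjoint_inner_right,
    conjOperator_apply, ← inner_conj_symm x, Lp_inner_star_comm (L (star y)), inner_conj_symm]

/-- Two operators on `L²` which are transposes of each other on integrable functions are transposes
of each other. -/
theorem eq_conj_adjoint_of_integrable {L D : Lp ℂ 2 μ →L[ℂ] Lp ℂ 2 μ}
    (h : ∀ f g : Lp ℂ 2 μ, Integrable f μ → Integrable g μ →
      ∫ y, L f y * g y ∂μ = ∫ y, D g y * f y ∂μ) (g : Lp ℂ 2 μ) :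
    D g = star (ContinuousLinearMap.adjoint L (star g)) := by
  have hint : ∀ f : Lp.simpleFunc ℂ 2 μ, Integrable (f : Lp ℂ 2 μ) μ := fun f =>
    ((SimpleFunc.memLp_iff_integrable two_ne_zero ENNReal.ofNat_ne_top).1
      (Lp.simpleFunc.memLp f)).congr (Lp.simpleFunc.toSimpleFunc_eq_toFun f)
  rw [← conjOperator_apply, ← adjoint_conjOperator]
  refine DFunLike.congr_fun ((ContinuousLinearMap.eq_adjoint_iff _ _).2 fun x y => ?_) g
  refine (Lp.simpleFunc.denseRange (E := ℂ) (p := 2) (μ := μ) ENNReal.ofNat_ne_top).induction_on₂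
    (p := fun x y => inner ℂ (D x) y = inner ℂ x (conjOperator L y)) ?_ (fun x y => ?_) x y
  · exact isClosed_eq (by fun_prop) (by fun_prop)
  · have hy : Integrable (star (y : Lp ℂ 2 μ) : Lp ℂ 2 μ) μ := by
      refine (hint y).mono (Lp.aestronglyMeasurable _) ?_
      filter_upwards [Lp.coeFn_star (y : Lp ℂ 2 μ)] with z hz
      rw [hz, Pi.star_apply, norm_star]
    have h1 := h _ _ hy (hint x)
    rw [← Lp_inner_star_left, ← Lp_inner_star_left] at h1
    rw [conjOperator_apply, ← inner_conj_symm (x : Lp ℂ 2 μ), h1, Lp_inner_star_comm, star_star,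
      inner_conj_symm]

end Lp

variable {γ m : ℝ} {hγ : 1 < γ} {k : ℝ≥0∞} {μ : Measure (M γ)} {ν : Measure (M (dualExp γ))}

/-- On `L²(σ)` the dual Leray transform is the conjugate of the adjoint of the Leray transform. -/
theorem eq_conj_adjoint_leray (hγ : 1 < γ) {L D : Lp ℂ 2 (sigma γ) →L[ℂ] Lp ℂ 2 (sigma γ)}
    (hL : ∀ f : Lp ℂ 2 (sigma γ), IsLeray γ (sigma γ) f (L f))
    (hD : ∀ g : Lp ℂ 2 (sigma γ), Tendsto (fun ε : ℝ => eLpNorm (fun z : M γ =>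
      dualIntegral γ g ε z - D g z) 2 (sigma γ)) (𝓝[>] 0) (𝓝 0)) (g : Lp ℂ 2 (sigma γ)) :
    D g = star (ContinuousLinearMap.adjoint L (star g)) := by
  refine eq_conj_adjoint_of_integrable (fun f g hf hg => ?_) g
  have hfm := (Lp.stronglyMeasurable f).measurable
  have hgm := (Lp.stronglyMeasurable g).measurable
  have key := fun (ε : ℝ) (hε : 0 < ε) => integral_lerayIntegral_mul hγ hε hfm hgm hf hg
  have h1 := tendsto_integral_mul_of_tendsto_eLpNorm
    (fun ε => measurable_lerayIntegral_lift hγ ε hfm) (Lp.memLp (L f)) (Lp.memLp g) (hL f)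
    (fun ε hε => (key ε hε).1)
  have h2 := tendsto_integral_mul_of_tendsto_eLpNorm
    (fun ε => measurable_dualIntegral hγ ε hgm) (Lp.memLp (D g)) (Lp.memLp f) (hD g)
    (fun ε hε => (key ε hε).2.1)
  refine tendsto_nhds_unique h1 (h2.congr' ?_)
  filter_upwards [self_mem_nhdsWithin] with ε hε using (key ε hε).2.2.symm

theorem isPowerMeasure_preferredMeasure {c : ℝ} (hc : 0 < c) (hγ : 1 < γ) :
    ∃ m k, IsPowerMeasure hγ m k (preferredMeasure c γ) := by
  have h : 0 < γ - 1 := by linarith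
  exact ⟨_, _, isPowerMeasure_smul_mu hγ (by positivity) (by linarith) (by linarith)⟩

theorem normConst_pos (hγ : 1 < γ) : 0 < normConst γ := by
  have h : 0 < γ - 1 := by linarith
  unfold normConst
  positivity

theorem absolutelyContinuous_sigma (hν : IsPowerMeasure (one_lt_dualExp hγ) m k ν)
    (h : MeasurePreserving (dualMap hγ) μ ν) : μ ≪ sigma γ ∧ sigma γ ≪ μ := by
  have hσ := isPowerMeasure_sigma (one_lt_dualExp hγ)
  have hs : MeasurePreserving (dualMap hγ) (sigma γ) (sigma (dualExp γ)) :=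
    ⟨(dualMap hγ).measurable, map_dualMap_sigma hγ⟩
  rw [← (h.symm (dualMap hγ)).map_eq, ← (hs.symm (dualMap hγ)).map_eq]
  exact ⟨(hν.absolutelyContinuous hσ).map (dualMap hγ).symm.measurable,
    (hσ.absolutelyContinuous hν).map (dualMap hγ).symm.measurable⟩

end DualLeray
end

open DualLeray
theorem propositionP (γ : ℝ) (hγ : 1 < γ) :
    -- the Leray transform of `M_{γ*}` is well defined on the two spaces where it is used
    (∀ f : Lp ℂ 2 (preferredMeasure (normConst γ) (dualExp γ)),
      IsLeray (dualExp γ) (preferredMeasure (normConst γ) (dualExp γ)) f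
        (lerayTransform (dualExp γ) (preferredMeasure (normConst γ) (dualExp γ)) f)) ∧
    (∀ f : Lp ℂ 2 ((sigma γ).map (dualMap hγ)),
      IsLeray (dualExp γ) ((sigma γ).map (dualMap hγ)) f
        (lerayTransform (dualExp γ) ((sigma γ).map (dualMap hγ)) f)) ∧
    ∃ T : Lp ℂ 2 (preferredDualMeasure hγ) →L[ℂ] Lp ℂ 2 (preferredDualMeasure hγ),
      -- `T` is the dual Leray transform, and it is a projection onto the dual Hardy space
      (∀ g, T g = dualLeray (measurePreserving_dualMap hγ) g) ∧
      T ∘L T = T ∧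
      range T = dualHardySpace hγ ∧
      -- integral formula: the regularized integrals converge absolutely and tend to `T g`
      -- in `L²`, and no regularization is needed where the integral converges absolutely
      (∀ g : Lp ℂ 2 (preferredDualMeasure hγ),
        (∀ ε : ℝ, 0 < ε → ∀ z : M γ, Integrable (dualIntegrand γ g ε z) (sigma γ)) ∧
        Tendsto (fun ε : ℝ => eLpNorm (fun z : M γ => dualIntegral γ g ε z - T g z) 2
          (preferredDualMeasure hγ)) (𝓝[>] 0) (𝓝 0) ∧
        ∀ᵐ z ∂(preferredDualMeasure hγ),
          Integrable (dualIntegrand γ g 0 z) (sigma γ) → T g z = dualIntegral γ g 0 z) ∧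
      -- relation with the adjoint `L†` of the Leray transform `L` of `L²(M_γ, σ)`
      ∃ L : Lp ℂ 2 (sigma γ) →L[ℂ] Lp ℂ 2 (sigma γ),
        (∀ f, L f = lerayTransform γ (sigma γ) f) ∧
        (∀ f : Lp ℂ 2 (sigma γ), IsLeray γ (sigma γ) f (L f)) ∧
        -- on `L²(M_γ, σ)`
        (∀ g : Lp ℂ 2 (sigma γ),
          dualLeray (hγ := hγ) ⟨(dualMap hγ).measurable, rfl⟩ g =
            star (ContinuousLinearMap.adjoint L (star g))) ∧
        -- on the space of the preferred dual measure, where `A` is the operator given by the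
        -- adjoint there: it extends `L†` and has the same integral formula
        ∃ A : Lp ℂ 2 (preferredDualMeasure hγ) →L[ℂ] Lp ℂ 2 (preferredDualMeasure hγ),
          (∀ (g : Lp ℂ 2 (preferredDualMeasure hγ)) (h : Lp ℂ 2 (sigma γ)),
            (g : M γ → ℂ) =ᵐ[sigma γ] h →
              (A g : M γ → ℂ) =ᵐ[sigma γ] ContinuousLinearMap.adjoint L h) ∧
          (∀ g : Lp ℂ 2 (preferredDualMeasure hγ),
            Tendsto (fun ε : ℝ => eLpNorm (fun z : M γ => adjointIntegral γ g ε z - A g z) 2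
              (preferredDualMeasure hγ)) (𝓝[>] 0) (𝓝 0)) ∧
          ∀ g : Lp ℂ 2 (preferredDualMeasure hγ), T g = star (A (star g)) := by
  have hδ := one_lt_dualExp hγ
  obtain ⟨m, k, hν⟩ := isPowerMeasure_preferredMeasure (normConst_pos hγ) hδ
  have hσ := isPowerMeasure_sigma hγ
  have hσ' := isPowerMeasure_sigma hδ
  rw [← map_dualMap_sigma hγ] at hσ'
  have hmp := measurePreserving_dualMap hγ
  obtain ⟨hac, hac'⟩ := absolutelyContinuous_sigma hν hmp
  obtain ⟨T, hT, hTT, hTr, hTl⟩ := hν.exists_dualLeray hmp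
  obtain ⟨L, hL, hLl, -⟩ := hσ.exists_lerayTransform
  obtain ⟨D, hD, -, -, hDl⟩ := hσ'.exists_dualLeray (hγ := hγ) ⟨(dualMap hγ).measurable, rfl⟩
  have hDL := eq_conj_adjoint_leray hγ hLl hDl
  have hmeas : ∀ {μ : Measure (M γ)} (g : Lp ℂ 2 μ), Measurable g := fun g =>
    (Lp.stronglyMeasurable g).measurable
  refine ⟨fun f => ?_, fun f => ?_, T, hT, hTT, hTr, fun g => ⟨fun ε hε z => ?_, hTl g, ?_⟩,
    L, hL, hLl, fun g => ?_, conjOperator T, fun g h hgh => ?_, fun g => ?_, fun g => ?_⟩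
  · obtain ⟨T', h1, h2, -⟩ := hν.exists_lerayTransform
    rw [← h1]
    exact h2 f
  · obtain ⟨T', h1, h2, -⟩ := hσ'.exists_lerayTransform
    rw [← h1]
    exact h2 f
  · exact hν.integrable_dualIntegrand hmp (hmeas g) (Lp.memLp g) hε z
  · exact ae_eq_dualIntegral hγ (hmeas g) (Lp.aestronglyMeasurable _) (hTl g)
  · rw [← hD, hDL]
  · have e1 : (star g : Lp ℂ 2 (preferredDualMeasure hγ)) =ᵐ[sigma γ] (star h : Lp ℂ 2 (sigma γ)) := by
      filter_upwards [hac' (Lp.coeFn_star g), Lp.coeFn_star h, hgh] with z h1 h2 h3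
      rw [h1, h2, Pi.star_apply, Pi.star_apply, h3]
    have e2 : T (star g) =ᵐ[sigma γ] D (star h) := by
      refine ae_eq_of_tendsto_eLpNorm hac' (fun ε => measurable_dualIntegral hγ ε (hmeas (star g)))
        (Lp.aestronglyMeasurable _) (Lp.aestronglyMeasurable _) (hTl _) ?_
      simp_rw [dualIntegral_congr_ae e1]
      exact hDl (star h)
    have e3 : ContinuousLinearMap.adjoint L h = star (D (star h)) := by
      rw [hDL, star_star, star_star]
    rw [e3, conjOperator_apply]
    filter_upwards [e2, hac' (Lp.coeFn_star (T (star g))), Lp.coeFn_star (D (star h))]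
      with z h1 h2 h3
    rw [h2, h3, Pi.star_apply, Pi.star_apply, h1]
  · refine (hTl (star g)).congr fun ε => eLpNorm_congr_norm_ae ?_
    have e1 : (star g : Lp ℂ 2 (preferredDualMeasure hγ)) =ᵐ[sigma γ] fun ζ => conj (g ζ) :=
      hac' (Lp.coeFn_star g)
    filter_upwards [Lp.coeFn_star (T (star g))] with z hz
    rw [conjOperator_apply, hz, Pi.star_apply, adjointIntegral_eq, dualIntegral_congr_ae e1,
      ← starRingEnd_apply, ← map_sub, RCLike.norm_conj]
  · rw [conjOperator_apply, star_star, star_star]
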